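/- All graphs are finite. A loopless multigraph is simple if it has no parallel edges. A (DP-)cover of a loopless multigraph $G$ is a pair $(H,L)$, where $H$ is a finite simple graph and $L$ assigns to each vertex $u$ of $G$ a set $L(u)\subseteq V(H)$, such that: the sets $L(u)$, $u\in V(G)$, partition $V(H)$; each $L(u)$ is independent in $H$; and for all distinct $u,v\in V(G)$ joined by exactly $s$ edges of $G$, the set $E_H(L(u),L(v))$ of edges of $H$ between $L(u)$ and $L(v)$ is a union of $s$ (possibly empty, not necessarily perfect) matchings. An $(H,L)$-coloring of $G$ is an independent set of $H$ containing exactly one vertex of each $L(u)$. The DP chromatic number $\chi_{\mathrm{DP}}(G)$ is the least positive integer $k$ such that $G$ has an $(H,L)$-coloring for every cover $(H,L)$ of $G$ with $|L(u)|\ge k$ for all $u\in V(G)$. The multigraph $G$ is DP $k$-critical if $\chi_{\mathrm{DP}}(G)=k$ and $\chi_{\mathrm{DP}}(G')\le k-1$ for every proper subgraph $G'$ of $G$. For a simple graph $F$, let $F^t$ be the multigraph obtained from $F$ by replacing each edge by $t$ parallel edges; a double cycle is a multigraph $C_m^2$ with $m\ge 3$. **Theorem.** Let $k\ge 5$ be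 an integer and $\lambda=\left\lceil \frac{k^2-7}{2k-7}\right\rceil$. If $G$ is a simple $n$-vertex DP $k$-critical graph, then one of the following holds (up to isomorphism): 1. $G=K_k$; 2. $k=5$ and either $G=K_2^4$ or $G$ is a double cycle; 3. $|E(G)|\ge\left(k-1+\frac1\lambda\right)\frac n2+\frac1\lambda$. (For simple $G$, case 2 does not actually occur.) -/

import Mathlib

/-- A loopless multigraph on the vertex set `V`, given by the number `mult s(u, v)` of edges
joining `u` and `v`. -/
structure Multigraph (V : Type*) where
  /-- The number of edges with a given (unordered) pair of endpoints. -/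
  mult : Sym2 V → ℕ
  loopless : ∀ e : Sym2 V, e.IsDiag → mult e = 0

namespace Multigraph

universe u v

/-- A multigraph is simple if it has no parallel edges. -/
def IsSimple {V : Type u} (G : Multigraph V) : Prop :=
  ∀ e : Sym2 V, G.mult e ≤ 1

/-- The number of edges, counted with multiplicity. -/
def edgeCount {V : Type u} [Fintype V] [DecidableEq V] (G : Multigraph V) : ℕ :=
  ∑ e : Sym2 V, G.mult e

/-- Two multigraphs are isomorphic if a bijection of their vertex sets preserves
multiplicities. -/
def IsIso {V : Type u} {W : Type v} (G : Multigraph V) (G' : Multigraph W) : Prop :=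
  ∃ f : V ≃ W, ∀ u v : V, G'.mult s(f u, f v) = G.mult s(u, v)

open Classical in
/-- The multiple `G^t` of a simple graph `G`: every edge is replaced with `t` parallel edges. -/
noncomputable def multiple {V : Type u} (G : SimpleGraph V) (t : ℕ) : Multigraph V where
  mult e := if e ∈ G.edgeSet then t else 0
  loopless := fun _ he => if_neg fun h => G.not_isDiag_of_mem_edgeSet h he

/-- `G` is (isomorphic to) the multiple `K_n^t` of the complete graph on `n` vertices. -/
def IsCompleteMultiple {V : Type u} (G : Multigraph V) (n t : ℕ) : Prop :=
  G.IsIso (multiple (⊤ : SimpleGraph (Fin n)) t)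

/-- `G` is a double cycle, that is, `C_n^2` for some `n ≥ 3`. -/
def IsDoubleCycle {V : Type u} (G : Multigraph V) : Prop :=
  ∃ n : ℕ, 3 ≤ n ∧ G.IsIso (multiple (SimpleGraph.cycleGraph n) 2)

/-- A subgraph of a multigraph: a set of vertices, together with some of the edges that join
two of these vertices. -/
structure Subgraph {V : Type u} (G : Multigraph V) where
  verts : Set V
  mult : Sym2 V → ℕ
  mult_le : ∀ e : Sym2 V, mult e ≤ G.mult e
  mem_verts : ∀ e : Sym2 V, mult e ≠ 0 → ∀ v ∈ e, v ∈ verts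

/-- A subgraph as a multigraph in its own right, on its own vertex set. -/
def Subgraph.coe {V : Type u} {G : Multigraph V} (G' : G.Subgraph) : Multigraph G'.verts where
  mult e := G'.mult (e.map Subtype.val)
  loopless := by
    intro e he
    induction e with
    | _ a b =>
      have hab : a = b := he
      subst hab
      exact Nat.le_zero.mp ((G'.mult_le _).trans (G.loopless _ (by simp)).le)

/-- A subgraph is proper if it misses a vertex or an edge. -/
def Subgraph.IsProper {V : Type u} {G : Multigraph V} (G' : G.Subgraph) : Prop :=
  ¬ (G'.verts = Set.univ ∧ G'.mult = G.mult)

/-- The set `E_H(A, B)` of the edges of `H` with one endpoint in `A` and the other in `B`. -/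
def edgesBetween {C : Type v} (H : SimpleGraph C) (A B : Set C) : Set (Sym2 C) :=
  {e | e ∈ H.edgeSet ∧ ∃ a ∈ A, ∃ b ∈ B, e = s(a, b)}

/-- A DP-cover `(H, L)` of a multigraph `G`, with `C` the vertex set of `H` (the colors). -/
structure Cover {V : Type u} (G : Multigraph V) (C : Type v) where
  H : SimpleGraph C
  L : V → Finset C
  disjoint : ∀ u v : V, u ≠ v → Disjoint (L u) (L v)
  exhaustive : ∀ c : C, ∃ v : V, c ∈ L v
  indep : ∀ u : V, H.IsIndepSet (L u : Set C)
  matchings : ∀ u v : V, u ≠ v → ∃ M : Fin (G.mult s(u, v)) → H.Subgraph,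
    (∀ i, (M i).IsMatching) ∧
      edgesBetween H (L u : Set C) (L v : Set C) = ⋃ i, (M i).edgeSet

/-- `G` has an `(H, L)`-coloring: `H` has an independent set that contains exactly one vertex
of each list. -/
def Cover.HasColoring {V : Type u} {G : Multigraph V} {C : Type v} (K : G.Cover C) : Prop :=
  ∃ I : Set C, K.H.IsIndepSet I ∧ ∀ v : V, ∃! c : C, c ∈ K.L v ∧ c ∈ I

/-- `G` has an `(H, L)`-coloring for every cover with all lists of size at least `k`.
For finite `G` the colors form a finite set, so that colors from `Type` are enough. -/
def DPColorable {V : Type u} (G : Multigraph V) (k : ℕ) : Prop :=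
  ∀ (C : Type) (K : G.Cover C), (∀ v : V, k ≤ (K.L v).card) → K.HasColoring

/-- The DP chromatic number. For finite `G` the set below is never empty. -/
noncomputable def dpChromaticNumber {V : Type u} (G : Multigraph V) : ℕ :=
  sInf {k : ℕ | 0 < k ∧ G.DPColorable k}

/-- `G` is DP `k`-critical. -/
def IsDPCritical {V : Type u} (G : Multigraph V) (k : ℕ) : Prop :=
  G.dpChromaticNumber = k ∧
    ∀ G' : G.Subgraph, G'.IsProper → G'.coe.dpChromaticNumber ≤ k - 1

end Multigraph

set_option linter.unusedSectionVars false

/-! The bound is strengthened so that induction on the number of vertices works. The objects are a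
simple graph, a vertex set `S` and list sizes `h ≤ k - 1` such that `S` is vertex-critical and no `h
v` below k - 1 can be raised (`Crit`). The potential is the sum over `S` of 1 - λ(d(v) - h(v)) - μ(k
- 1 - h(v)) with μ = (k - 1)/(k - 3). The claim (`Good`, `good_of_crit`) is that, apart from K_k
with all lists of size k - 1, the potential is at most -2 if `h` is constantly k - 1, and at most
-2μ otherwise. The first bound is the required inequality for |E|.

In a smallest counterexample, color a proper part `I` and apply induction to a critical set in what
remains. This gives the gap lemma `pot_add_le_phi`: `phi`, the potential of a part with a bonus μ
for each leaving edge, exceeds the potential of `S` by at least 2μ and so is positive.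

Call a vertex low if d = h. No nonempty set of low vertices is colorable from lists given by its
inner degrees, so its end blocks are cliques or cycles (Gallai). Without a clique of k - 1 low
vertices this bounds the edges among low vertices (`edge_bound`), and discharging shows that the
potential is small enough; λ is the least integer for which a vertex that is not low can pay for its
low neighbors. Hence such a clique `Q` exists (`exists_lowClique`).

Every vertex of `Q` has exactly one neighbor outside (`dg_eq_one`). If two such outer neighbors are
not adjacent, `Q` can be replaced by an edge between them, because the pairs of colors that block an
extension to `Q` form a matching. The gap lemma and submodularity of cuts exclude this
(`adj_of_outer`). So the outer neighbors form a clique, and counting leaves only k = 5 with two of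
them (`special`). All these exceptional blocks are then handled at once, by submodularity and one
more discharging (`not_lowClique`). -/

namespace DPCover

open Finset

/-! ### Lists, conflicts and residual covers -/

variable {V : Type*} [DecidableEq V]

/-- The number of neighbors of `v` in `X`. -/
noncomputable def dg (G : SimpleGraph V) (X : Finset V) (v : V) : ℕ :=
  by classical exact (X.filter (fun u => G.Adj v u)).card

/-- A system of lists of colors, with conflicts between colors of distinct vertices that form
a matching for every pair of vertices. -/
structure Cov (V : Type*) where
  L : V → Finset ℕ
  R : V → ℕ → V → ℕ → Prop
  symm : ∀ {u a v b}, R u a v b → R v b u a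
  inj : ∀ {u a v b b'}, R u a v b → R u a v b' → b = b'

theorem Cov.inj' (K : Cov V) {u a a' v b} (h : K.R u a v b) (h' : K.R u a' v b) : a = a' :=
  K.inj (K.symm h) (K.symm h')

/-- `f` colors the subgraph of `G` that is induced by `S`. -/
def IsCol (G : SimpleGraph V) (K : Cov V) (S : Finset V) (f : V → ℕ) : Prop :=
  (∀ v ∈ S, f v ∈ K.L v) ∧ ∀ u ∈ S, ∀ v ∈ S, G.Adj u v → ¬ K.R u (f u) v (f v)

def ColOn (G : SimpleGraph V) (K : Cov V) (S : Finset V) : Prop := ∃ f, IsCol G K S f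

/-- Every cover with lists of size at least `h` can be colored on `S`. -/
def Col (G : SimpleGraph V) (S : Finset V) (h : V → ℕ) : Prop :=
  ∀ K : Cov V, (∀ v ∈ S, h v ≤ (K.L v).card) → ColOn G K S

/-- What a coloring of `I` leaves of the lists. -/
noncomputable def Cov.res (K : Cov V) (G : SimpleGraph V) (I : Finset V) (f : V → ℕ) : Cov V where
  L v := by classical exact (K.L v).filter (fun b => ∀ u ∈ I, G.Adj u v → ¬ K.R u (f u) v b)
  R := K.R
  symm := K.symm
  inj := K.inj

theorem mem_res {K : Cov V} {G : SimpleGraph V} {I : Finset V} {f : V → ℕ} {v : V} {b : ℕ} :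
    b ∈ (K.res G I f).L v ↔ b ∈ K.L v ∧ ∀ u ∈ I, G.Adj u v → ¬ K.R u (f u) v b := by
  classical
  simp [Cov.res]

/-- Conflicts between two vertices form a matching, so each colored neighbor forbids at most one
color. -/
theorem card_le_res (K : Cov V) (G : SimpleGraph V) (I : Finset V) (f : V → ℕ) (v : V) :
    (K.L v).card ≤ ((K.res G I f).L v).card + dg G I v := by
  classical
  have hsub : K.L v ⊆ (K.res G I f).L v ∪
      (I.filter (fun u => G.Adj v u)).biUnion
        (fun u => (K.L v).filter (fun b => K.R u (f u) v b)) := by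
    intro b hb
    by_cases h : b ∈ (K.res G I f).L v
    · exact mem_union_left _ h
    · rw [mem_res] at h
      push Not at h
      obtain ⟨u, hu, ha, hr⟩ := h hb
      apply mem_union_right
      simp only [mem_biUnion, mem_filter]
      exact ⟨u, ⟨hu, ha.symm⟩, hb, hr⟩
  refine (card_le_card hsub).trans ((card_union_le _ _).trans ?_)
  gcongr
  refine (card_biUnion_le_card_mul _ _ 1 fun u _ => ?_).trans (by rw [mul_one, dg])
  rw [card_le_one]
  intro a ha b hb
  exact K.inj (mem_filter.1 ha).2 (mem_filter.1 hb).2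

theorem IsCol.congr {G : SimpleGraph V} {K : Cov V} {S : Finset V} {f g : V → ℕ}
    (h : IsCol G K S f) (hfg : ∀ v ∈ S, f v = g v) : IsCol G K S g := by
  refine ⟨fun v hv => hfg v hv ▸ h.1 v hv, fun u hu v hv huv => ?_⟩
  rw [← hfg u hu, ← hfg v hv]
  exact h.2 u hu v hv huv

theorem Col.mono {G : SimpleGraph V} {h h' : V → ℕ} {S : Finset V}
    (hS : Col G S h) (hh : ∀ v ∈ S, h v ≤ h' v) : Col G S h' :=
  fun K hK => hS K fun v hv => (hh v hv).trans (hK v hv)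

theorem colOn_empty (G : SimpleGraph V) (K : Cov V) : ColOn G K ∅ :=
  ⟨fun _ => 0, by simp, by simp⟩

theorem IsCol.glue {G : SimpleGraph V} {K : Cov V} {I J : Finset V} {f g : V → ℕ}
    (hf : IsCol G K I f) (hg : IsCol G (K.res G I f) J g) (hd : Disjoint I J) :
    IsCol G K (I ∪ J) (fun v => if v ∈ I then f v else g v) := by
  have hJ : ∀ v ∈ J, v ∉ I := fun v hv hI => (disjoint_left.1 hd) hI hv
  refine ⟨fun v hv => ?_, fun u hu v hv huv => ?_⟩
  · by_cases hI : v ∈ I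
    · simpa [hI] using hf.1 v hI
    · have hv' : v ∈ J := (mem_union.1 hv).resolve_left hI
      simpa [hI] using (mem_res.1 (hg.1 v hv')).1
  · by_cases hu' : u ∈ I <;> by_cases hv' : v ∈ I
    · simpa [hu', hv'] using hf.2 u hu' v hv' huv
    · have hv2 : v ∈ J := (mem_union.1 hv).resolve_left hv'
      simpa [hu', hv'] using (mem_res.1 (hg.1 v hv2)).2 u hu' huv
    · have hu2 : u ∈ J := (mem_union.1 hu).resolve_left hu'
      simp only [hu', hv', if_true, if_false]
      exact fun hr => (mem_res.1 (hg.1 u hu2)).2 v hv' huv.symm (K.symm hr)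
    · have hv2 : v ∈ J := (mem_union.1 hv).resolve_left hv'
      have hu2 : u ∈ J := (mem_union.1 hu).resolve_left hu'
      simp only [hu', hv', if_false]
      exact hg.2 u hu2 v hv2 huv

theorem ColOn.of_res {G : SimpleGraph V} {K : Cov V} {I S : Finset V} {f : V → ℕ}
    (hf : IsCol G K I f) (hI : I ⊆ S) (hg : ColOn G (K.res G I f) (S \ I)) : ColOn G K S := by
  obtain ⟨g, hg⟩ := hg
  have := hf.glue hg disjoint_sdiff
  rw [union_sdiff_of_subset hI] at this
  exact ⟨_, this⟩

theorem IsCol.insert {G : SimpleGraph V} {K : Cov V} {I : Finset V} {f : V → ℕ}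
    (hf : IsCol G K I f) {v : V} (hv : v ∉ I) {c : ℕ} (hc : c ∈ (K.res G I f).L v) :
    IsCol G K (insert v I) (Function.update f v c) := by
  have h := hf.glue (J := {v}) (g := fun _ => c) ⟨by simpa using hc, by simp⟩ (by simpa using hv)
  rw [union_comm, ← insert_eq] at h
  refine h.congr fun w hw => ?_
  rcases mem_insert.1 hw with rfl | hw
  · simp [hv]
  · have : w ≠ v := fun h => hv (h ▸ hw)
    simp [this, hw]

theorem exists_minimal_not {P : Finset V → Prop} {S : Finset V} (h : P S) :
    ∃ T ⊆ S, P T ∧ ∀ T' ⊂ T, ¬ P T' := by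
  induction S using Finset.strongInduction with
  | _ S ih =>
    by_cases hS : ∃ T ⊂ S, P T
    · obtain ⟨T, hT, hP⟩ := hS
      obtain ⟨T', h1, h2⟩ := ih T hT hP
      exact ⟨T', h1.trans hT.subset, h2⟩
    · push Not at hS
      exact ⟨S, Subset.rfl, h, hS⟩

theorem card_le_dg_of_minimal {G : SimpleGraph V} {K : Cov V} {S : Finset V}
    (hS : ¬ ColOn G K S) (hmin : ∀ T ⊂ S, ColOn G K T) {v : V} (hv : v ∈ S) :
    (K.L v).card ≤ dg G S v := by
  classical
  obtain ⟨f, hf⟩ := hmin (S.erase v) (erase_ssubset hv)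
  by_contra hlt
  push Not at hlt
  have h1 := card_le_res K G (S.erase v) f v
  have h2 : dg G (S.erase v) v ≤ dg G S v := card_le_card (filter_subset_filter _ (erase_subset _ _))
  obtain ⟨c, hc⟩ : ((K.res G (S.erase v) f).L v).Nonempty := by
    rw [← card_pos]; omega
  have := hf.insert (notMem_erase v S) hc
  rw [insert_erase hv] at this
  exact hS ⟨_, this⟩

/-! ### Connected sets and surplus colors -/

/-- `X` induces a connected subgraph (or is empty), in terms of cuts. -/
def Conn (G : SimpleGraph V) (X : Finset V) : Prop :=
  ∀ Y ⊆ X, Y.Nonempty → Y ≠ X → ∃ a ∈ Y, ∃ b ∈ X, b ∉ Y ∧ G.Adj a b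

theorem dg_mono {G : SimpleGraph V} {X Y : Finset V} (h : X ⊆ Y) (v : V) : dg G X v ≤ dg G Y v := by
  classical
  exact card_le_card (filter_subset_filter _ h)

theorem dg_lt {G : SimpleGraph V} {X Y : Finset V} (h : X ⊆ Y) {v b : V} (hb : b ∈ Y) (hbX : b ∉ X)
    (hvb : G.Adj v b) : dg G X v < dg G Y v := by
  classical
  apply card_lt_card
  refine ⟨filter_subset_filter _ h, fun hh => ?_⟩
  have : b ∈ X.filter (fun u => G.Adj v u) := hh (by simp [hb, hvb])
  simp [hbX] at this

theorem dg_union {G : SimpleGraph V} {X Y : Finset V} (h : Disjoint X Y) (v : V) :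
    dg G (X ∪ Y) v = dg G X v + dg G Y v := by
  classical
  rw [dg, filter_union, card_union_of_disjoint]
  · rfl
  · exact disjoint_filter_filter h

theorem dg_sdiff {G : SimpleGraph V} {X S : Finset V} (h : X ⊆ S) (v : V) :
    dg G S v = dg G X v + dg G (S \ X) v := by
  conv_lhs => rw [← union_sdiff_of_subset h]
  exact dg_union disjoint_sdiff v

/-- In a minimal uncolorable `T` no list exceeds the degree inside `T`. For `T = X` this contradicts
the surplus at `y`; otherwise an edge leaves `T`, and its end in `T` has a degree in `X` larger than
its list. -/
theorem colOn_of_surplus {G : SimpleGraph V} {K : Cov V} {X : Finset V} (hX : Conn G X)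
    (hL : ∀ v ∈ X, dg G X v ≤ (K.L v).card) {y : V} (hy : y ∈ X)
    (hlt : dg G X y < (K.L y).card) : ColOn G K X := by
  by_contra hcol
  obtain ⟨T, hT, hTc, hmin⟩ := exists_minimal_not (P := fun T => ¬ ColOn G K T) hcol
  simp only [not_not] at hmin
  have hne : T.Nonempty := by
    rw [nonempty_iff_ne_empty]
    rintro rfl
    exact hTc (colOn_empty G K)
  have hdeg : ∀ v ∈ T, (K.L v).card ≤ dg G T v := fun v hv => card_le_dg_of_minimal hTc hmin hv
  by_cases hTX : T = X
  · subst hTX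
    exact absurd (hdeg y hy) (by omega)
  · obtain ⟨a, ha, b, hb, hbT, hab⟩ := hX T hT hne hTX
    have h1 := dg_lt hT hb hbT hab
    have h2 := hL a (hT ha)
    have h3 := hdeg a ha
    omega

theorem exists_trim {G : SimpleGraph V} {S : Finset V} {h : V → ℕ} (hS : ¬ Col G S h) :
    ∃ K : Cov V, ¬ ColOn G K S ∧ ∀ v ∈ S, (K.L v).card = h v := by
  classical
  unfold Col at hS
  push Not at hS
  obtain ⟨K, hK, hc⟩ := hS
  have : ∀ v, ∃ L ⊆ K.L v, v ∈ S → L.card = h v := by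
    intro v
    by_cases hv : v ∈ S
    · obtain ⟨L, h1, h2⟩ := exists_subset_card_eq (hK v hv)
      exact ⟨L, h1, fun _ => h2⟩
    · exact ⟨∅, empty_subset _, fun h => absurd h hv⟩
  choose L hL hL' using this
  refine ⟨⟨L, K.R, K.symm, K.inj⟩, ?_, hL'⟩
  rintro ⟨f, hf⟩
  exact hc ⟨f, fun v hv => hL v (hf.1 v hv), hf.2⟩

/-! ### Critical list sizes -/

/-- `S` is vertex-critical for lists of size `h`, and `h ≤ r` is as large as possible. -/
structure Crit (G : SimpleGraph V) (r : ℕ) (S : Finset V) (h : V → ℕ) : Prop where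
  le : ∀ v ∈ S, h v ≤ r
  not_col : ¬ Col G S h
  minimal : ∀ T ⊂ S, Col G T h
  raise : ∀ v ∈ S, h v < r → Col G S (Function.update h v (h v + 1))

theorem Crit.nonempty {G : SimpleGraph V} {r : ℕ} {S : Finset V} {h : V → ℕ} (hc : Crit G r S h) :
    S.Nonempty := by
  rw [nonempty_iff_ne_empty]
  rintro rfl
  exact hc.not_col fun K _ => colOn_empty G K

/-- Shrink `S` to a minimal uncolorable `T`, then raise values of `h` as long as `T` stays
uncolorable. Raising keeps the proper subsets colorable and lowers the total slack. -/
theorem exists_crit {G : SimpleGraph V} {r : ℕ} {S : Finset V} {h : V → ℕ}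
    (hr : ∀ v ∈ S, h v ≤ r) (hS : ¬ Col G S h) :
    ∃ T ⊆ S, ∃ h' : V → ℕ, (∀ v, h v ≤ h' v) ∧ Crit G r T h' := by
  obtain ⟨T, hT, hTc, hmin⟩ := exists_minimal_not (P := fun T => ¬ Col G T h) hS
  simp only [not_not] at hmin
  obtain ⟨n, hn⟩ : ∃ n, n = ∑ v ∈ T, (r - h v) := ⟨_, rfl⟩
  replace hr : ∀ v ∈ T, h v ≤ r := fun v hv => hr v (hT hv)
  refine ⟨T, hT, ?_⟩
  clear hT hS
  induction n using Nat.strong_induction_on generalizing h with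
  | _ n ih =>
    by_cases hraise : ∀ v ∈ T, h v < r → Col G T (Function.update h v (h v + 1))
    · exact ⟨h, fun _ => le_rfl, hr, hTc, hmin, hraise⟩
    · push Not at hraise
      obtain ⟨v, hv, hvr, hnc⟩ := hraise
      have hup : ∀ w, h w ≤ Function.update h v (h v + 1) w := by
        intro w
        by_cases hw : w = v
        · subst hw; simp
        · simp [hw]
      obtain ⟨h', h1, h2⟩ := ih (∑ w ∈ T, (r - Function.update h v (h v + 1) w)) (by
          rw [hn]
          apply sum_lt_sum
          · intro w _
            have := hup w
            omega
          · exact ⟨v, hv, by simp; omega⟩) hnc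
          (fun T' hT' => (hmin T' hT').mono fun w _ => hup w) rfl (by
          intro w hw
          by_cases hwv : w = v
          · subst hwv; simp; omega
          · simpa [hwv] using hr w hw)
      exact ⟨h', fun w => (hup w).trans (h1 w), h2⟩

theorem Crit.le_dg {G : SimpleGraph V} {r : ℕ} {S : Finset V} {h : V → ℕ} (hc : Crit G r S h)
    {v : V} (hv : v ∈ S) : h v ≤ dg G S v := by
  obtain ⟨K, hK, hcard⟩ := exists_trim hc.not_col
  rw [← hcard v hv]
  exact card_le_dg_of_minimal hK
    (fun T hT => hc.minimal T hT K fun w hw => (hcard w (hT.subset hw)).ge) hv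

/-- A subset cannot be colored from lists that are given by the degrees inside of it, if it lies
in a critical set and its vertices have the least possible degree. -/
theorem Crit.not_col_dg {G : SimpleGraph V} {r : ℕ} {S : Finset V} {h : V → ℕ} (hc : Crit G r S h)
    {X : Finset V} (hX : X ⊆ S) (hne : X.Nonempty) (hd : ∀ v ∈ X, dg G S v = h v) :
    ¬ Col G X (dg G X) := by
  intro hcol
  obtain ⟨K, hK, hcard⟩ := exists_trim hc.not_col
  have hss : S \ X ⊂ S := sdiff_ssubset hX hne
  -- After `S \ X` is colored, at least `h v - dg G (S \ X) v = dg G X v` colors are left at each `v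
  -- ∈ X`.
  obtain ⟨f, hf⟩ := hc.minimal _ hss K fun w hw => (hcard w (hss.subset hw)).ge
  refine hK (ColOn.of_res hf hss.subset ?_)
  rw [Finset.sdiff_sdiff_eq_self hX]
  refine hcol _ fun v hv => ?_
  have h1 := card_le_res K G (S \ X) f v
  have h2 := dg_sdiff (G := G) hX v
  have h3 := hcard v (hX hv)
  have h4 := hd v hv
  omega

/-! ### Degree arithmetic -/

theorem dg_pos_iff {G : SimpleGraph V} {X : Finset V} {v : V} :
    0 < dg G X v ↔ ∃ u ∈ X, G.Adj v u := by
  classical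
  simp [dg, card_pos, Finset.Nonempty]

theorem dg_insert_of_adj {G : SimpleGraph V} {X : Finset V} {u v : V} (hu : u ∉ X)
    (h : G.Adj v u) : dg G (insert u X) v = dg G X v + 1 := by
  classical
  rw [dg, filter_insert, if_pos h, card_insert_of_notMem (by simp [hu])]
  rfl

theorem dg_insert_of_not_adj {G : SimpleGraph V} {X : Finset V} {u v : V}
    (h : ¬ G.Adj v u) : dg G (insert u X) v = dg G X v := by
  classical
  rw [dg, filter_insert, if_neg h]
  rfl

theorem dg_insert_self {G : SimpleGraph V} {X : Finset V} {v : V} :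
    dg G (insert v X) v = dg G X v :=
  dg_insert_of_not_adj (G.loopless.irrefl v)

theorem dg_singleton_of_adj {G : SimpleGraph V} {u v : V} (h : G.Adj v u) :
    dg G {u} v = 1 := by
  classical
  simp [dg, filter_singleton, h]

theorem dg_singleton_of_not_adj {G : SimpleGraph V} {u v : V} (h : ¬ G.Adj v u) :
    dg G {u} v = 0 := by
  classical
  simp [dg, filter_singleton, h]

theorem dg_erase_of_adj {G : SimpleGraph V} {X : Finset V} {u v : V} (hu : u ∈ X)
    (h : G.Adj v u) : dg G (X.erase u) v + 1 = dg G X v := by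
  rw [← dg_insert_of_adj (notMem_erase u X) h, insert_erase hu]

theorem dg_erase_of_not_adj {G : SimpleGraph V} {X : Finset V} {u v : V}
    (h : ¬ G.Adj v u) : dg G (X.erase u) v = dg G X v := by
  by_cases hu : u ∈ X
  · rw [← dg_insert_of_not_adj h, insert_erase hu]
  · rw [erase_eq_of_notMem hu]

/-! ### Lobes and Brooks triples -/

/-- `P` is separated from the rest of `X` by the vertex `p`. -/
structure Lobe (G : SimpleGraph V) (X P : Finset V) (p : V) : Prop where
  sub : P ⊆ X
  mem : p ∈ X
  notMem : p ∉ P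
  ne : P.Nonempty
  sep : ∀ a ∈ P, ∀ b ∈ X, G.Adj a b → b ∈ P ∨ b = p

/-- In a lobe without a smaller lobe, deleting a vertex does not disconnect the graph. -/
theorem Lobe.conn_erase {G : SimpleGraph V} {Z X P : Finset V} {p y : V} (hl : Lobe G X P p)
    (hmin : ∀ T ⊂ P, ∀ q ∈ P, ¬ Lobe G Z T q) (hlZ : Lobe G Z P p) (hX : Conn G X)
    (hy : y ∈ P) : Conn G (X.erase y) := by
  -- A set `T` without such an edge would be a smaller lobe, attached at `y`.
  have key : ∀ T ⊆ P.erase y, T.Nonempty →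
      ∃ a ∈ T, ∃ b, (b ∈ P ∨ b = p) ∧ b ≠ y ∧ b ∉ T ∧ G.Adj a b := by
    intro T hT hne
    by_contra hcon
    push Not at hcon
    have hyT : y ∉ T := fun h => by simpa using hT h
    have hTP : T ⊆ P := hT.trans (erase_subset _ _)
    refine hmin T ⟨hTP, fun h => hyT (h hy)⟩ y hy ⟨hTP.trans hlZ.sub, hlZ.sub hy, hyT, hne, ?_⟩
    intro a ha b hb hab
    by_contra hb'
    push Not at hb'
    exact hcon a ha b (hlZ.sep a (hTP ha) b hb hab) hb'.2 hb'.1 hab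
  have hpy : p ≠ y := fun h => hl.notMem (h ▸ hy)
  intro W hW hne hWX
  by_contra hcon
  push Not at hcon
  have hWX' : W ⊆ X := hW.trans (erase_subset _ _)
  have hyW : y ∉ W := fun h => by simpa using hW h
  have hin : ∀ b, b ∈ P ∨ b = p → b ∈ X := by
    rintro b (hb | rfl)
    · exact hl.sub hb
    · exact hl.mem
  -- If `p ∈ W`, then `key` forces all of `P.erase y` into `W`, and no edge of `X` leaves `W` with
  -- `y` added. If not, `W` misses `P`, and an edge from `W` to `y` is impossible. Both contradict
  -- the connectivity of `X`.
  by_cases hp : p ∈ W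
  · have hPW : P.erase y ⊆ W := by
      by_contra hnot
      obtain ⟨a, ha, b, hb, hby, hbT, hab⟩ := key (P.erase y \ W) sdiff_subset
        (sdiff_nonempty.2 hnot)
      rw [mem_sdiff, mem_erase] at ha
      have hbW : b ∈ W := by
        rcases hb with hb | rfl
        · by_contra hbW
          exact hbT (by simp [hby, hb, hbW])
        · exact hp
      exact hcon b hbW a (mem_erase.2 ⟨ha.1.1, hl.sub ha.1.2⟩) ha.2 hab.symm
    obtain ⟨a, ha, b, hb, hbW, hab⟩ := hX (insert y W)
      (insert_subset (hl.sub hy) hWX') (insert_nonempty _ _) (by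
        intro h
        apply hWX
        rw [← h, erase_insert hyW])
    rw [mem_insert, not_or] at hbW
    rcases mem_insert.1 ha with rfl | ha
    · rcases hl.sep a hy b hb hab with h | rfl
      · exact hbW.2 (hPW (mem_erase.2 ⟨hbW.1, h⟩))
      · exact hbW.2 hp
    · exact hcon a ha b (mem_erase.2 ⟨hbW.1, hb⟩) hbW.2 hab
  · have hPW : ∀ a ∈ P, a ∉ W := by
      by_contra hnot
      push Not at hnot
      obtain ⟨a0, ha0, ha0W⟩ := hnot
      obtain ⟨a, ha, b, hb, hby, hbT, hab⟩ := key (P.erase y ∩ W) inter_subset_left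
        ⟨a0, by
          have : a0 ≠ y := fun h => hyW (h ▸ ha0W)
          simp [ha0, ha0W, this]⟩
      rw [mem_inter] at ha
      refine hcon a ha.2 b (mem_erase.2 ⟨hby, hin b hb⟩) ?_ hab
      rcases hb with hb | rfl
      · intro hbW
        exact hbT (by simp [hby, hb, hbW])
      · exact hp
    obtain ⟨a, ha, b, hb, hbW, hab⟩ := hX W hWX' hne
      (fun h => hyW (by rw [h]; exact hl.sub hy))
    by_cases hby : b = y
    · subst hby
      rcases hl.sep b hy a (hWX' ha) hab.symm with h | rfl
      · exact hPW a h ha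
      · exact hp ha
    · exact hcon a ha b (mem_erase.2 ⟨hby, hb⟩) hbW hab

theorem Conn.insert {G : SimpleGraph V} {X : Finset V} {u t : V} (hX : Conn G X) (ht : t ∈ X)
    (hut : G.Adj u t) : Conn G (insert u X) := by
  by_cases hu : u ∈ X
  · rwa [insert_eq_of_mem hu]
  intro W hW hne hWX
  by_cases huW : u ∈ W
  · by_cases hW' : (W.erase u).Nonempty
    · obtain ⟨a, ha, b, hb, hbW, hab⟩ := hX (W.erase u) (by
        intro x hx
        rw [mem_erase] at hx
        exact (mem_insert.1 (hW hx.2)).resolve_left hx.1) hW' (fun h => hWX (by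
          rw [← h, insert_erase huW]))
      refine ⟨a, mem_of_mem_erase ha, b, mem_insert_of_mem hb, fun h => hbW ?_, hab⟩
      exact mem_erase.2 ⟨fun h' => hu (h' ▸ hb), h⟩
    · refine ⟨u, huW, t, mem_insert_of_mem ht, fun h => hW' ⟨t, mem_erase.2 ⟨?_, h⟩⟩, hut⟩
      exact fun h => hu (h ▸ ht)
  · have hWX' : W ⊆ X := fun x hx => (mem_insert.1 (hW hx)).resolve_left fun h => huW (h ▸ hx)
    by_cases hWe : W = X
    · subst hWe
      exact ⟨t, ht, u, by simp, hu, hut.symm⟩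
    · obtain ⟨a, ha, b, hb, hbW, hab⟩ := hX W hWX' hne hWe
      exact ⟨a, ha, b, mem_insert_of_mem hb, hbW, hab⟩

/-- By connectivity, an edge leaves the closed neighborhood of `u` in `B`. -/
theorem exists_dist_two {G : SimpleGraph V} {B : Finset V} (hB : Conn G B) {u w : V} (hu : u ∈ B)
    (hw : w ∈ B) (hne : w ≠ u) (huw : ¬ G.Adj u w) :
    ∃ x ∈ B, ∃ z ∈ B, G.Adj x u ∧ G.Adj x z ∧ u ≠ z ∧ ¬ G.Adj u z := by
  classical
  obtain ⟨a, ha, b, hb, hbY, hab⟩ := hB (insert u (B.filter (G.Adj u)))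
    (insert_subset hu (filter_subset _ _)) (insert_nonempty _ _) (by
      intro h
      rw [← h] at hw
      simp [hne, huw] at hw)
  simp only [mem_insert, mem_filter, not_or, not_and] at ha hbY
  rcases ha with rfl | ha
  · exact absurd hab (hbY.2 hb)
  · exact ⟨a, ha.1, b, hb, ha.2.symm, hab, Ne.symm hbY.1, hbY.2 hb⟩

/-- The triple of vertices in the standard proof of Brooks' theorem. -/
theorem exists_brooks_triple {G : SimpleGraph V} {B : Finset V} (hB : Conn G B)
    (hB' : ∀ u ∈ B, Conn G (B.erase u)) (hr : ∀ u ∈ B, 3 ≤ dg G B u)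
    (hcl : ¬ G.IsClique (B : Set V)) :
    ∃ x ∈ B, ∃ y ∈ B, ∃ z ∈ B, G.Adj x y ∧ G.Adj x z ∧ y ≠ z ∧ ¬ G.Adj y z ∧
      Conn G ((B.erase y).erase z) := by
  classical
  rw [SimpleGraph.IsClique, Set.Pairwise] at hcl
  push Not at hcl
  obtain ⟨u, hu, w, hw, huw, hadj⟩ := hcl
  rw [mem_coe] at hu hw
  -- If no further deletion disconnects `B.erase u`, then `u` serves as `y`. Otherwise `u` serves as
  -- `x`, and `y`, `z` come from minimal lobes on the two sides of a cut vertex `c`.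
  by_cases hall : ∀ c ∈ B.erase u, Conn G ((B.erase u).erase c)
  · obtain ⟨x, hx, z, hz, h1, h2, h3, h4⟩ := exists_dist_two hB hu hw huw.symm hadj
    exact ⟨x, hx, u, hu, z, hz, h1, h2, h3, h4, hall z (mem_erase.2 ⟨h3.symm, hz⟩)⟩
  push Not at hall
  obtain ⟨c, hc, hcut⟩ := hall
  set Z := B.erase u with hZ
  unfold Conn at hcut
  push Not at hcut
  obtain ⟨P₁, hP₁, hne₁, hneq, hsep⟩ := hcut
  set P₂ := (Z.erase c) \ P₁ with hP₂def
  have hne₂ : P₂.Nonempty := by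
    rw [sdiff_nonempty]
    exact fun h => hneq (subset_antisymm hP₁ h)
  have hP₂ : P₂ ⊆ Z.erase c := sdiff_subset
  have hsep₁ : ∀ a ∈ P₁, ∀ b ∈ P₂, ¬ G.Adj a b := fun a ha b hb =>
    hsep a ha b (mem_sdiff.1 hb).1 (mem_sdiff.1 hb).2
  have hmem : ∀ b ∈ Z, b ∈ P₁ ∨ b ∈ P₂ ∨ b = c := by
    intro b hb
    by_cases h1 : b = c
    · exact Or.inr (Or.inr h1)
    by_cases h2 : b ∈ P₁
    · exact Or.inl h2
    · exact Or.inr (Or.inl (mem_sdiff.2 ⟨mem_erase.2 ⟨h1, hb⟩, h2⟩))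
  have hZB : Z ⊆ B := erase_subset _ _
  have hdisj : ∀ a ∈ P₁, a ∉ P₂ := fun a ha hb => (mem_sdiff.1 hb).2 ha
  -- A minimal lobe contains a neighbor of `u`; otherwise its attachment `p` would separate it from
  -- `u` in `B`.
  have find : ∀ P ⊆ Z.erase c, P.Nonempty → (∀ a ∈ P, ∀ b ∈ Z, G.Adj a b → b ∈ P ∨ b = c) →
      ∃ T ⊆ P, ∃ p, (p ∈ P ∨ p = c) ∧ Lobe G Z T p ∧
        (∀ T' ⊂ T, ∀ q ∈ T, ¬ Lobe G Z T' q) ∧ ∃ y ∈ T, G.Adj u y := by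
    intro P hP hne hs
    obtain ⟨T, hT, ⟨p, hp, hl⟩, hmin⟩ := exists_minimal_not
      (P := fun T => ∃ p, (p ∈ P ∨ p = c) ∧ Lobe G Z T p) (S := P)
      ⟨c, Or.inr rfl, hP.trans (erase_subset _ _), hc,
        fun h => by simpa using hP h, hne, hs⟩
    refine ⟨T, hT, p, hp, hl, fun T' hT' q hq h => hmin T' hT' ⟨q, Or.inl (hT hq), h⟩, ?_⟩
    have hpB : p ∈ B := hZB hl.mem
    have huT : u ∉ T := fun h => by simpa [hZ] using hl.sub h
    have hup : u ≠ p := fun h => by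
      have := hl.mem
      rw [← h] at this
      simp [hZ] at this
    obtain ⟨a, ha, b, hb, hbT, hab⟩ := hB' p hpB T (by
      intro x hx
      exact mem_erase.2 ⟨fun h => hl.notMem (h ▸ hx), hZB (hl.sub hx)⟩) hl.ne (by
        intro h
        exact huT (by rw [h]; exact mem_erase.2 ⟨hup, hu⟩))
    rw [mem_erase] at hb
    by_cases hbu : b = u
    · subst hbu
      exact ⟨a, ha, hab.symm⟩
    · rcases hl.sep a ha b (mem_erase.2 ⟨hbu, hb.2⟩) hab with h | h
      · exact absurd h hbT
      · exact absurd h hb.1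
  obtain ⟨T₁, hT₁, p₁, hp₁, hl₁, hm₁, y, hy, huy⟩ := find P₁ hP₁ hne₁ (by
    intro a ha b hb hab
    rcases hmem b hb with h | h | h
    · exact Or.inl h
    · exact absurd hab (hsep₁ a ha b h)
    · exact Or.inr h)
  obtain ⟨T₂, hT₂, p₂, hp₂, hl₂, hm₂, z, hz, huz⟩ := find P₂ hP₂ hne₂ (by
    intro a ha b hb hab
    rcases hmem b hb with h | h | h
    · exact absurd hab.symm (hsep₁ b h a ha)
    · exact Or.inl h
    · exact Or.inr h)
  have hyZ := hl₁.sub hy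
  have hzZ := hl₂.sub hz
  have hyz : y ≠ z := fun h => hdisj y (hT₁ hy) (h ▸ hT₂ hz)
  have hyT₂ : y ∉ T₂ := fun h => hdisj y (hT₁ hy) (hT₂ h)
  have hyp₂ : p₂ ≠ y := by
    rintro rfl
    rcases hp₂ with h | h
    · exact hdisj _ (hT₁ hy) h
    · have := hP₁ (hT₁ hy)
      rw [h] at this
      simp at this
  refine ⟨u, hu, y, hZB hyZ, z, hZB hzZ, huy, huz, hyz, hsep₁ y (hT₁ hy) z (hT₂ hz), ?_⟩
  have hc₁ : Conn G (Z.erase y) := hl₁.conn_erase hm₁ hl₁ (hB' u hu) hy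
  have hl₂' : Lobe G (Z.erase y) T₂ p₂ :=
    ⟨fun x hx => mem_erase.2 ⟨fun h => hyT₂ (h ▸ hx), hl₂.sub hx⟩, mem_erase.2 ⟨hyp₂, hl₂.mem⟩,
      hl₂.notMem, hl₂.ne, fun a ha b hb hab => hl₂.sep a ha b (mem_of_mem_erase hb) hab⟩
  have hc₂ : Conn G ((Z.erase y).erase z) := hl₂'.conn_erase hm₂ hl₂ hc₁ hz
  have h3 := hr u hu
  have e1 := dg_erase_of_adj (hZB hyZ) huy
  have e2 := dg_erase_of_adj (X := B.erase y) (mem_erase.2 ⟨hyz.symm, hZB hzZ⟩) huz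
  -- A third neighbor of `u` joins `u` to the connected rest.
  obtain ⟨t, ht, hut⟩ := dg_pos_iff.1 (show 0 < dg G ((B.erase y).erase z) u by omega)
  have htu : t ≠ u := fun h => G.loopless.irrefl u (h ▸ hut)
  have := hc₂.insert (u := u) (t := t) (by
    simp only [mem_erase, hZ] at ht ⊢
    exact ⟨ht.1, ht.2.1, htu, ht.2.2⟩) hut
  convert this using 1
  rw [hZ, erase_right_comm (a := u), erase_right_comm (a := u), insert_erase]
  simp only [mem_erase]
  exact ⟨huz.ne, huy.ne, hu⟩

/-! ### Gallai's theorem for lists as large as the degrees -/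

/-- If deleting `x` does not disconnect `B`, then in a cover without coloring all colors of `x`
have conflicts in the lists of the neighbors of `x`. -/
theorem exists_conflict {G : SimpleGraph V} {B : Finset V} {K : Cov V} {x y : V}
    (hB : Conn G (B.erase x)) (hdeg : ∀ v ∈ B, dg G B v ≤ (K.L v).card) (hK : ¬ ColOn G K B)
    (hx : x ∈ B) (hy : y ∈ B) (hxy : G.Adj x y) {c : ℕ} (hc : c ∈ K.L x) :
    ∃ d ∈ K.L y, K.R x c y d := by
  classical
  by_contra hno
  push Not at hno
  have hf : IsCol G K {x} (fun _ => c) := ⟨by simpa using hc, by simp⟩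
  refine hK (ColOn.of_res hf (by simpa using hx) ?_)
  rw [sdiff_singleton_eq_erase]
  have hdeg' : ∀ v ∈ B.erase x,
      dg G (B.erase x) v ≤ ((K.res G {x} fun _ => c).L v).card := by
    intro v hv
    have h1 := card_le_res K G {x} (fun _ => c) v
    have h2 := hdeg v (mem_of_mem_erase hv)
    by_cases hvx : G.Adj v x
    · have := dg_erase_of_adj hx hvx
      have := dg_singleton_of_adj hvx
      omega
    · have := dg_erase_of_not_adj (X := B) hvx
      have := dg_singleton_of_not_adj hvx
      omega
  have hy' : y ∈ B.erase x := mem_erase.2 ⟨hxy.ne', hy⟩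
  refine colOn_of_surplus hB hdeg' hy' ?_
  -- Coloring `x` with `c` takes no color from `y` but lowers its degree, so `y` has a surplus.
  have : (K.res G {x} fun _ => c).L y = K.L y := by
    ext b
    rw [mem_res]
    refine ⟨fun h => h.1, fun h => ⟨h, ?_⟩⟩
    simp only [mem_singleton, forall_eq]
    exact fun _ => hno b h
  rw [this]
  have := hdeg y hy
  have := dg_erase_of_adj hx hxy.symm
  omega

/-- If every color has a conflict in each adjacent list, then the degrees are equal. -/
theorem dg_eq_of_conflicts {G : SimpleGraph V} {B : Finset V} (hB : Conn G B) {K : Cov V}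
    (hK : ∀ v ∈ B, (K.L v).card = dg G B v)
    (hc : ∀ x ∈ B, ∀ y ∈ B, G.Adj x y → ∀ c ∈ K.L x, ∃ d ∈ K.L y, K.R x c y d) :
    ∀ x ∈ B, ∀ y ∈ B, dg G B x = dg G B y := by
  classical
  have hle : ∀ x ∈ B, ∀ y ∈ B, G.Adj x y → dg G B x ≤ dg G B y := by
    intro x hx y hy hxy
    rw [← hK x hx, ← hK y hy]
    choose! g hg hR using hc x hx y hy hxy
    refine card_le_card_of_injOn g hg fun a ha b hb hab => ?_
    have h1 := hR a ha
    have h2 := hR b hb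
    rw [hab] at h1
    exact K.inj' h1 h2
  intro x hx y hy
  by_contra hne
  obtain ⟨a, ha, b, hb, hbY, hab⟩ := hB (B.filter fun z => dg G B z = dg G B x)
    (filter_subset _ _) ⟨x, by simp [hx]⟩ (by
      intro h
      rw [← h] at hy
      exact hne (mem_filter.1 hy).2.symm)
  rw [mem_filter] at ha
  apply hbY
  rw [mem_filter]
  have h1 := hle a ha.1 b hb hab
  have h2 := hle b hb a ha.1 hab.symm
  exact ⟨hb, by omega⟩

/-- The argument of Brooks' theorem. In a bad cover every color has a conflict along every edge, so
`B` is regular. If its degree is at least 3 and it is no clique, color `y` and `z` of a Brooks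
triple with the partners of one color of `x`: two neighbors then cost `x` a single color, and this
surplus colors the rest. -/
theorem clique_or_cycle {G : SimpleGraph V} {B : Finset V} (hB : Conn G B)
    (hB' : ∀ u ∈ B, Conn G (B.erase u)) (hbad : ¬ Col G B (dg G B)) :
    G.IsClique (B : Set V) ∨ 3 ≤ B.card ∧ ∀ x ∈ B, dg G B x = 2 := by
  classical
  by_contra hcon
  push Not at hcon
  obtain ⟨hcl, hcyc⟩ := hcon
  obtain ⟨K, hK, hcard⟩ := exists_trim hbad
  have hconf : ∀ x ∈ B, ∀ y ∈ B, G.Adj x y → ∀ c ∈ K.L x, ∃ d ∈ K.L y, K.R x c y d :=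
    fun x hx y hy hxy c hc =>
      exists_conflict (hB' x hx) (fun v hv => (hcard v hv).ge) hK hx hy hxy hc
  have hreg := dg_eq_of_conflicts hB hcard hconf
  have hcl' := hcl
  rw [SimpleGraph.IsClique, Set.Pairwise] at hcl'
  push Not at hcl'
  obtain ⟨u, hu, w, hw, huw, hadj⟩ := hcl'
  rw [mem_coe] at hu hw
  obtain ⟨x, hx, z, hz, h1, h2, h3, h4⟩ := exists_dist_two hB hu hw huw.symm hadj
  have htwo : 2 ≤ dg G B x := by
    have e1 := dg_erase_of_adj hu h1
    have e2 := dg_erase_of_adj (X := B.erase u) (mem_erase.2 ⟨h3.symm, hz⟩) h2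
    omega
  have hthree : ∀ v ∈ B, 3 ≤ dg G B v := by
    intro v hv
    rw [hreg v hv x hx]
    by_contra hlt
    have hxe : dg G B x = 2 := by omega
    have hB3 : 3 ≤ B.card := by
      have : dg G B x ≤ (B.erase x).card := by
        rw [← dg_erase_of_not_adj (G.loopless.irrefl x)]
        exact card_filter_le _ _
      rw [card_erase_of_mem hx] at this
      omega
    obtain ⟨v', hv', hne⟩ := hcyc hB3
    exact hne ((hreg v' hv' x hx).trans hxe)
  obtain ⟨x, hx, y, hy, z, hz, hxy, hxz, hyz, hnyz, hconn⟩ :=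
    exists_brooks_triple hB hB' hthree hcl
  have hthree_x := hthree x hx
  obtain ⟨a, ha⟩ : (K.L x).Nonempty := by
    rw [← card_pos, hcard x hx]
    omega
  obtain ⟨c, hc, hac⟩ := hconf x hx y hy hxy a ha
  obtain ⟨d, hd, had⟩ := hconf x hx z hz hxz a ha
  set f : V → ℕ := fun v => if v = y then c else d with hf_def
  have hfy : f y = c := by simp [hf_def]
  have hfz : f z = d := by simp [hf_def, hyz.symm]
  have hf : IsCol G K {y, z} f := by
    refine ⟨?_, ?_⟩
    · simp only [mem_insert, mem_singleton, forall_eq_or_imp, forall_eq, hfy, hfz]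
      exact ⟨hc, hd⟩
    · simp only [mem_insert, mem_singleton, forall_eq_or_imp, forall_eq]
      exact ⟨⟨fun h => absurd rfl h.ne, fun h => absurd h hnyz⟩,
        fun h => absurd h.symm hnyz, fun h => absurd rfl h.ne⟩
  have hyzB : {y, z} ⊆ B := by
    intro t ht
    simp only [mem_insert, mem_singleton] at ht
    rcases ht with rfl | rfl <;> assumption
  refine hK (ColOn.of_res hf hyzB ?_)
  have hset : B \ {y, z} = (B.erase y).erase z := by
    ext t
    simp only [mem_sdiff, mem_insert, mem_singleton, mem_erase]
    tauto
  rw [hset]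
  have hx' : x ∈ (B.erase y).erase z := by simp [hx, hxy.ne, hxz.ne]
  refine colOn_of_surplus hconn (fun v hv => ?_) hx' ?_
  · have h1 := card_le_res K G {y, z} f v
    have h2 := dg_sdiff (G := G) hyzB v
    rw [hset] at h2
    have h3 := hcard v (mem_of_mem_erase (mem_of_mem_erase hv))
    omega
  · have e1 := dg_erase_of_adj hy hxy
    have e2 := dg_erase_of_adj (X := B.erase y) (mem_erase.2 ⟨hyz.symm, hz⟩) hxz
    have hsub : (K.L x).erase a ⊆ (K.res G {y, z} f).L x := by
      intro b hb
      rw [mem_erase] at hb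
      rw [mem_res]
      refine ⟨hb.2, ?_⟩
      simp only [mem_insert, mem_singleton, forall_eq_or_imp, forall_eq, hfy, hfz]
      exact ⟨fun _ hr => hb.1 (K.inj hr (K.symm hac)), fun _ hr => hb.1 (K.inj hr (K.symm had))⟩
    have h1 := card_le_card hsub
    rw [card_erase_of_mem ha, hcard x hx] at h1
    omega

/-- A version of Gallai's theorem: an end block is a clique or a cycle. -/
theorem exists_end_block {G : SimpleGraph V} {X : Finset V} (hX : X.Nonempty)
    (hbad : ∀ Y ⊆ X, Y.Nonempty → ¬ Col G Y (dg G Y)) :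
    (∃ v ∈ X, dg G X v = 0) ∨ ∃ P p, Lobe G X P p ∧
      (G.IsClique ((insert p P : Finset V) : Set V) ∨
        3 ≤ (insert p P).card ∧ ∀ x ∈ insert p P, dg G (insert p P) x = 2) := by
  classical
  by_cases hiso : ∃ v ∈ X, dg G X v = 0
  · exact Or.inl hiso
  right
  push Not at hiso
  obtain ⟨v, hv⟩ := hX
  obtain ⟨v', hv', hvv'⟩ := dg_pos_iff.1 (Nat.pos_of_ne_zero (hiso v hv))
  -- `X.erase v` is a lobe, so there is a minimal one. A cut of `insert p P`, also after the
  -- deletion of a vertex, would produce a smaller lobe.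
  obtain ⟨P, -, ⟨p, hl⟩, hmin⟩ := exists_minimal_not (P := fun P => ∃ p, Lobe G X P p)
    (S := X.erase v) ⟨v, erase_subset _ _, hv, by simp, ⟨v', by simp [hv', hvv'.ne']⟩, by
      intro a _ b hb _
      by_cases h : b = v
      · exact Or.inr h
      · exact Or.inl (mem_erase.2 ⟨h, hb⟩)⟩
  push Not at hmin
  refine ⟨P, p, hl, ?_⟩
  set B := insert p P with hB_def
  have hBX : B ⊆ X := insert_subset hl.mem hl.sub
  have hmemP : ∀ x ∈ B, x ≠ p → x ∈ P := fun x hx hne => (mem_insert.1 hx).resolve_left hne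
  apply clique_or_cycle
  · have main : ∀ Y ⊆ P, Y.Nonempty → ∃ a ∈ Y, ∃ b ∈ B, b ∉ Y ∧ G.Adj a b := by
      intro Y hY hne
      by_contra hcut
      push Not at hcut
      have hsep : ∀ a ∈ Y, ∀ b ∈ X, G.Adj a b → b ∈ Y := by
        intro a ha b hb hab
        by_contra hbY
        refine hcut a ha b ?_ hbY hab
        rcases hl.sep a (hY ha) b hb hab with h | rfl
        · exact mem_insert_of_mem h
        · exact mem_insert_self _ _
      obtain ⟨y, hy⟩ := hne
      obtain ⟨y', hy', hyy'⟩ := dg_pos_iff.1 (Nat.pos_of_ne_zero (hiso y (hl.sub (hY hy))))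
      refine hmin (Y.erase y) ⟨(erase_subset _ _).trans hY, fun h => ?_⟩ y
        ⟨(erase_subset _ _).trans (hY.trans hl.sub), hl.sub (hY hy), by simp,
          ⟨y', mem_erase.2 ⟨hyy'.ne', hsep y hy y' hy' hyy'⟩⟩, ?_⟩
      · simpa using h (hY hy)
      · intro a ha b hb hab
        by_cases h : b = y
        · exact Or.inr h
        · exact Or.inl (mem_erase.2 ⟨h, hsep a (mem_of_mem_erase ha) b hb hab⟩)
    intro Y hY hne hYB
    by_cases hp : p ∈ Y
    · obtain ⟨a, ha, b, hb, hbY, hab⟩ := main (B \ Y) (by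
        intro x hx
        rw [mem_sdiff] at hx
        exact hmemP x hx.1 fun h => hx.2 (h ▸ hp)) (sdiff_nonempty.2 fun h =>
          hYB (subset_antisymm hY h))
      have hbY' : b ∈ Y := by
        by_contra h
        exact hbY (mem_sdiff.2 ⟨hb, h⟩)
      exact ⟨b, hbY', a, (mem_sdiff.1 ha).1, (mem_sdiff.1 ha).2, hab.symm⟩
    · exact main Y (fun x hx => hmemP x (hY hx) fun h => hp (h ▸ hx)) hne
  · intro u hu
    have main : ∀ Y ⊆ B.erase u, p ∉ Y → Y.Nonempty → Y ≠ B.erase u →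
        ∃ a ∈ Y, ∃ b ∈ B.erase u, b ∉ Y ∧ G.Adj a b := by
      intro Y hY hpY hne hYu
      by_contra hcut
      push Not at hcut
      have hYP : Y ⊆ P := fun x hx =>
        hmemP x (mem_of_mem_erase (hY hx)) fun h => hpY (h ▸ hx)
      have huY : u ∉ Y := fun h => by simpa using hY h
      refine hmin Y ⟨hYP, fun h => ?_⟩ u ⟨hYP.trans hl.sub, hBX hu, huY, hne, ?_⟩
      · have hPY : Y = P := subset_antisymm hYP h
        have hup : u = p := by
          by_contra hup
          exact huY (h (hmemP u hu hup))
        apply hYu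
        rw [hPY, hup, hB_def, erase_insert hl.notMem]
      · intro a ha b hb hab
        by_contra hno
        push Not at hno
        refine hcut a ha b (mem_erase.2 ⟨hno.2, ?_⟩) hno.1 hab
        rcases hl.sep a (hYP ha) b hb hab with h | rfl
        · exact mem_insert_of_mem h
        · exact mem_insert_self _ _
    intro Y hY hne hYB
    by_cases hp : p ∈ Y
    · obtain ⟨a, ha, b, hb, hbY, hab⟩ := main (B.erase u \ Y) sdiff_subset (by simp [hp])
        (sdiff_nonempty.2 fun h => hYB (subset_antisymm hY h)) (by
          intro h
          obtain ⟨y, hy⟩ := hne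
          have := hY hy
          rw [← h] at this
          exact (mem_sdiff.1 this).2 hy)
      have hbY' : b ∈ Y := by
        by_contra h
        exact hbY (mem_sdiff.2 ⟨hb, h⟩)
      exact ⟨b, hbY', a, (mem_sdiff.1 ha).1, (mem_sdiff.1 ha).2, hab.symm⟩
    · exact main Y hY hp hne hYB
  · exact hbad B hBX ⟨p, mem_insert_self _ _⟩

/-! ### The edge bound for sets without large cliques -/

theorem dg_of_clique {G : SimpleGraph V} {B : Finset V} (hB : G.IsClique (B : Set V)) {x : V}
    (hx : x ∈ B) : dg G B x = B.card - 1 := by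
  classical
  rw [← card_erase_of_mem hx, dg]
  congr 1
  ext y
  simp only [mem_filter, mem_erase]
  exact ⟨fun h => ⟨h.2.ne', h.1⟩, fun h => ⟨h.2, hB hx h.2 (Ne.symm h.1)⟩⟩

theorem Lobe.dg_eq {G : SimpleGraph V} {X P : Finset V} {p : V} (hl : Lobe G X P p) {x : V}
    (hx : x ∈ P) : dg G X x = dg G (insert p P) x := by
  classical
  unfold dg
  congr 1
  ext y
  simp only [mem_filter, mem_insert]
  constructor
  · rintro ⟨hy, hxy⟩
    exact ⟨(hl.sep x hx y hy hxy).symm, hxy⟩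
  · rintro ⟨rfl | hy, hxy⟩
    · exact ⟨hl.mem, hxy⟩
    · exact ⟨hl.sub hy, hxy⟩

/-- The rest `X \ P` and the end block `insert p P` share only `p`, and every edge lies in one of
them. -/
theorem Lobe.sum_dg {G : SimpleGraph V} {X P : Finset V} {p : V} (hl : Lobe G X P p) :
    ∑ x ∈ X, dg G X x = ∑ x ∈ X \ P, dg G (X \ P) x + ∑ x ∈ insert p P, dg G (insert p P) x := by
  classical
  have hp : p ∈ X \ P := mem_sdiff.2 ⟨hl.mem, hl.notMem⟩
  rw [← sum_sdiff hl.sub, sum_insert hl.notMem, sum_congr rfl fun x hx => hl.dg_eq hx, ← add_assoc]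
  congr 1
  rw [sum_congr rfl fun x _ => dg_sdiff (G := G) hl.sub x, sum_add_distrib, add_comm]
  congr 1
  rw [dg_insert_self]
  refine sum_eq_single_of_mem p hp fun x hx hne => ?_
  by_contra hpos
  obtain ⟨y, hy, hxy⟩ := dg_pos_iff.1 (Nat.pos_of_ne_zero hpos)
  rw [mem_sdiff] at hx
  rcases hl.sep y hy x hx.1 hxy.symm with h | h
  · exact hx.2 h
  · exact hne h

/-- A weighted form of the bound on the number of edges in a graph without large cliques that is
not colorable from lists given by its degrees. -/
theorem weighted_edge_bound {G : SimpleGraph V} {k : ℕ} (hk : 5 ≤ k) {X : Finset V}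
    (hX : X.Nonempty) (hbad : ∀ Y ⊆ X, Y.Nonempty → ¬ Col G Y (dg G Y))
    (hcl : ∀ B ⊆ X, G.IsClique (B : Set V) → B.card ≤ k - 2)
    (hdeg : ∀ v ∈ X, dg G X v ≤ k - 1) (a : V → ℤ)
    (ha : ∀ v ∈ X, a v = (k - 2) * (k - 3) + 3 ∨ a v = 3 * (k - 2) ∧ dg G X v ≤ 2) :
    3 * ((k : ℤ) - 2) ≤ ∑ v ∈ X, a v - (k - 2) * ∑ v ∈ X, (dg G X v : ℤ) := by
  classical
  induction X using Finset.strongInduction generalizing a with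
  | _ X ih =>
    have hk' : (5 : ℤ) ≤ k := by exact_mod_cast hk
    have ha3 : ∀ v ∈ X, 3 * ((k : ℤ) - 2) ≤ a v := by
      intro v hv
      rcases ha v hv with h | h
      · rw [h]; nlinarith
      · rw [h.1]
    rcases exists_end_block hX hbad with ⟨v, hv, hv0⟩ | ⟨P, p, hl, hB⟩
    · have hnadj : ∀ x ∈ X, ¬ G.Adj v x := fun x hx h => by
        have := dg_pos_iff.2 ⟨x, hx, h⟩
        omega
      have hsum : ∑ x ∈ X, (dg G X x : ℤ) = ∑ x ∈ X.erase v, (dg G (X.erase v) x : ℤ) := by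
        rw [← add_sum_erase _ _ hv, hv0, Nat.cast_zero, zero_add]
        refine sum_congr rfl fun x hx => ?_
        rw [dg_erase_of_not_adj fun h => hnadj x (mem_of_mem_erase hx) h.symm]
      rw [hsum, ← add_sum_erase _ _ hv]
      have h3 := ha3 v hv
      by_cases hne : (X.erase v).Nonempty
      · have := ih _ (erase_ssubset hv) hne
          (fun Y hY => hbad Y (hY.trans (erase_subset _ _)))
          (fun B hB => hcl B (hB.trans (erase_subset _ _)))
          (fun x hx => (dg_mono (erase_subset _ _) x).trans (hdeg x (mem_of_mem_erase hx))) a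
          (fun x hx => (ha x (mem_of_mem_erase hx)).imp_right fun h =>
            ⟨h.1, (dg_mono (erase_subset _ _) x).trans h.2⟩)
        linarith
      · rw [not_nonempty_iff_eq_empty] at hne
        rw [hne]
        simpa using h3
    · have hss : X \ P ⊂ X := sdiff_ssubset hl.sub hl.ne
      have hp : p ∈ X \ P := mem_sdiff.2 ⟨hl.mem, hl.notMem⟩
      have step := fun b hb => ih _ hss ⟨p, hp⟩ (fun Y hY => hbad Y (hY.trans hss.subset))
        (fun B hB => hcl B (hB.trans hss.subset))
        (fun x hx => (dg_mono hss.subset x).trans (hdeg x (hss.subset hx))) b hb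
      have hsum : ∑ x ∈ X, (dg G X x : ℤ) = ∑ x ∈ X \ P, (dg G (X \ P) x : ℤ) +
          ∑ x ∈ insert p P, (dg G (insert p P) x : ℤ) := by
        exact_mod_cast hl.sum_dg
      have hcardB : (insert p P).card = P.card + 1 := card_insert_of_notMem hl.notMem
      have hPpos : 1 ≤ P.card := card_pos.2 hl.ne
      have hPpos' : (1 : ℤ) ≤ P.card := by exact_mod_cast hPpos
      have stepa := step a fun x hx => (ha x (hss.subset hx)).imp_right fun h =>
            ⟨h.1, (dg_mono hss.subset x).trans h.2⟩
      rw [hsum, ← sum_sdiff hl.sub]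
      have hPa3 : (P.card : ℤ) * (3 * ((k : ℤ) - 2)) ≤ ∑ x ∈ P, a x := by
        rw [← nsmul_eq_mul]
        exact card_nsmul_le_sum _ _ _ fun x hx => ha3 x (hl.sub hx)
      rcases hB with hB | ⟨hB3, hB2⟩
      · have hBd : ∀ x ∈ insert p P, dg G (insert p P) x = P.card := fun x hx => by
          rw [dg_of_clique hB hx, hcardB, Nat.add_sub_cancel]
        have hBs : ∑ x ∈ insert p P, (dg G (insert p P) x : ℤ) = (P.card + 1) * P.card := by
          rw [sum_congr rfl fun x hx => by rw [hBd x hx], sum_const, hcardB, nsmul_eq_mul]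
          push_cast
          ring
        rw [hBs]
        by_cases hm : P.card ≤ 2
        · have hm' : (P.card : ℤ) ≤ 2 := by exact_mod_cast hm
          have h1 : ((k : ℤ) - 2) * ((P.card + 1) * P.card) ≤ P.card * (3 * ((k : ℤ) - 2)) := by
            have h2 : (0 : ℤ) ≤ ((k : ℤ) - 2) * P.card := mul_nonneg (by linarith) (by linarith)
            nlinarith
          linarith
        · have hclB := hcl _ (insert_subset hl.mem hl.sub) hB
          rw [hcardB] at hclB
          -- The smaller weight is reserved for degrees at most 2, while all degrees in this clique
          -- are at least 3.
          have haA : ∀ x ∈ insert p P, a x = (k - 2) * (k - 3) + 3 := by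
            intro x hx
            have hxX : x ∈ X := insert_subset hl.mem hl.sub hx
            have h1 := dg_mono (G := G) (insert_subset hl.mem hl.sub) x
            have h2 := hBd x hx
            rcases ha x hxX with h | h
            · exact h
            · omega
          have hPA : ∑ x ∈ P, a x = P.card * (((k : ℤ) - 2) * (k - 3) + 3) := by
            rw [sum_congr rfl fun x hx => haA x (mem_insert_of_mem hx), sum_const, nsmul_eq_mul]
          rw [hPA]
          by_cases hm2 : P.card + 1 ≤ k - 3
          · have hm' : (P.card : ℤ) + 1 ≤ k - 3 := by omega
            have h1 : ((k : ℤ) - 2) * ((P.card + 1) * P.card) ≤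
                P.card * (((k : ℤ) - 2) * (k - 3) + 3) := by
              have h2 : (0 : ℤ) ≤ ((k : ℤ) - 2) * P.card := mul_nonneg (by linarith) (by linarith)
              nlinarith
            linarith
          -- For a clique of the largest size k - 2 the weights on `P` fall short by (k - 3)(k - 5).
          -- This is exactly the difference of the two admissible weights, so `p` pays by changing
          -- to the smaller one; it has at most 2 neighbors left.
          · have hm' : (P.card : ℤ) = k - 3 := by omega
            have hpd : dg G (X \ P) p ≤ 2 := by
              have h1 := dg_sdiff (G := G) hl.sub p
              have h2 := hBd p (mem_insert_self _ _)
              rw [dg_insert_self] at h2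
              have h3 := hdeg p hl.mem
              omega
            have h := step (Function.update a p (3 * ((k : ℤ) - 2))) (by
              intro x hx
              by_cases hxp : x = p
              · subst hxp
                right
                simpa using hpd
              · rw [Function.update_of_ne hxp]
                exact (ha x (hss.subset hx)).imp_right fun h =>
                  ⟨h.1, (dg_mono hss.subset x).trans h.2⟩)
            rw [sum_update_of_mem hp] at h
            have h5 := add_sum_erase (X \ P) a hp
            rw [haA p (mem_insert_self _ _), ← sdiff_singleton_eq_erase] at h5
            rw [← h5, hm']
            nlinarith
      · have hBs : ∑ x ∈ insert p P, (dg G (insert p P) x : ℤ) = 2 * (P.card + 1) := by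
          rw [sum_congr rfl fun x hx => by rw [hB2 x hx], sum_const, hcardB, nsmul_eq_mul]
          push_cast
          ring
        rw [hBs]
        have hm' : (2 : ℤ) ≤ P.card := by omega
        have h1 : ((k : ℤ) - 2) * (2 * (P.card + 1)) ≤ P.card * (3 * ((k : ℤ) - 2)) := by nlinarith
        linarith

/-- All weights are the larger one; the factor 2k - 7 is (k - 2)(k - 1) - ((k - 2)(k - 3) + 3). -/
theorem edge_bound {G : SimpleGraph V} {k : ℕ} (hk : 5 ≤ k) {X : Finset V}
    (hX : X.Nonempty) (hbad : ∀ Y ⊆ X, Y.Nonempty → ¬ Col G Y (dg G Y))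
    (hcl : ∀ B ⊆ X, G.IsClique (B : Set V) → B.card ≤ k - 2)
    (hdeg : ∀ v ∈ X, dg G X v ≤ k - 1) :
    (2 * (k : ℤ) - 7) * X.card + 3 * (k - 2) ≤ (k - 2) * ∑ v ∈ X, ((k : ℤ) - 1 - dg G X v) := by
  have h := weighted_edge_bound hk hX hbad hcl hdeg (fun _ => (k - 2) * (k - 3) + 3)
    fun _ _ => Or.inl rfl
  rw [sum_const, nsmul_eq_mul] at h
  rw [sum_sub_distrib, sum_const, nsmul_eq_mul]
  linarith

/-! ### Double counting and cuts -/

theorem dg_eq_sum {G : SimpleGraph V} {X : Finset V} {v : V} [DecidableRel G.Adj] :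
    dg G X v = ∑ u ∈ X, if G.Adj v u then 1 else 0 := by
  rw [dg, card_filter]
  exact sum_congr rfl fun u _ => by congr

theorem sum_dg_comm (G : SimpleGraph V) (A B : Finset V) :
    ∑ v ∈ A, dg G B v = ∑ v ∈ B, dg G A v := by
  classical
  simp only [dg_eq_sum]
  rw [sum_comm]
  simp only [G.adj_comm]

/-- The number of edges between `A` and the rest of `S`. -/
noncomputable def cut (G : SimpleGraph V) (S A : Finset V) : ℕ := ∑ v ∈ A, dg G (S \ A) v

/-- Submodularity, checked separately for each ordered pair of vertices. -/
theorem cut_union_add_cut_inter_le {G : SimpleGraph V} {S A B : Finset V} (hA : A ⊆ S)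
    (hB : B ⊆ S) : cut G S (A ∪ B) + cut G S (A ∩ B) ≤ cut G S A + cut G S B := by
  classical
  have key : ∀ T ⊆ S, cut G S T = ∑ v ∈ S, ∑ u ∈ S,
      if v ∈ T ∧ u ∉ T ∧ G.Adj v u then 1 else 0 := by
    intro T hT
    rw [cut, ← inter_eq_right.2 hT, ← sum_filter_add_sum_filter_not S (· ∈ T),
      filter_mem_eq_inter]
    rw [sum_eq_zero (s := S.filter fun v => v ∉ T), add_zero]
    · refine sum_congr rfl fun v hv => ?_
      rw [mem_inter] at hv
      rw [dg_eq_sum, inter_eq_right.2 hT, ← filter_notMem_eq_sdiff, sum_filter]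
      refine sum_congr rfl fun u _ => ?_
      simp only [hv.2, true_and, ite_and]
    · intro v hv
      rw [mem_filter] at hv
      simp [hv.2]
  rw [key _ (union_subset hA hB), key _ (inter_subset_left.trans hA), key _ hA, key _ hB]
  simp only [← sum_add_distrib]
  refine sum_le_sum fun v _ => sum_le_sum fun u _ => ?_
  by_cases h1 : v ∈ A <;> by_cases h2 : v ∈ B <;> by_cases h3 : u ∈ A <;> by_cases h4 : u ∈ B <;>
    by_cases h5 : G.Adj v u <;> simp [h1, h2, h3, h4, h5]

/-! ### The potential -/

/-- The parameters of the potential. -/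
structure Par where
  k : ℕ
  lam : ℝ
  mu : ℝ
  five_le : 5 ≤ k
  six_le : 6 ≤ lam
  -- Equivalent to bk ≤ λ - 1 for b = (k - 2)/(2k - 7), the charge per edge in the discharging.
  le_lam : (k : ℝ) ^ 2 - 7 ≤ lam * (2 * k - 7)
  -- For this μ a clique on k - 1 vertices with `h = k - 2` has potential exactly -2μ.
  mu_mul : mu * (k - 3) = k - 1
  lam_five : k = 5 → lam = 6
  int : ∃ l : ℤ, lam = l

namespace Par

variable (p : Par)

theorem five_le' : (5 : ℝ) ≤ p.k := by exact_mod_cast p.five_le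

theorem one_lt_mu : 1 < p.mu := by
  have h := p.mu_mul
  have := p.five_le'
  nlinarith

theorem mu_le_two : p.mu ≤ 2 := by
  have h := p.mu_mul
  have := p.five_le'
  nlinarith

theorem mu_five (h5 : p.k = 5) : p.mu = 2 := by
  have h := p.mu_mul
  rw [h5] at h
  push_cast at h
  linarith

/-- The contribution of a vertex to the potential. -/
noncomputable def wt (G : SimpleGraph V) (S : Finset V) (h : V → ℕ) (v : V) : ℝ :=
  1 - p.lam * ((dg G S v : ℝ) - h v) - p.mu * ((p.k : ℝ) - 1 - h v)

noncomputable def pot (G : SimpleGraph V) (S : Finset V) (h : V → ℕ) : ℝ :=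
  ∑ v ∈ S, p.wt G S h v

/-- The potential of a part `I` of `S`. -/
noncomputable def phi (G : SimpleGraph V) (S : Finset V) (h : V → ℕ) (I : Finset V) : ℝ :=
  ∑ v ∈ I, (p.wt G S h v + p.mu * dg G (S \ I) v)

/-- The bound on the potential of critical sets that we prove by induction. -/
def Good (G : SimpleGraph V) (S : Finset V) (h : V → ℕ) : Prop :=
  (G.IsClique (S : Set V) ∧ S.card = p.k ∧ ∀ v ∈ S, h v = p.k - 1) ∨
    ((∀ v ∈ S, h v = p.k - 1) ∧ p.pot G S h ≤ -2) ∨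
      ((∃ v ∈ S, h v < p.k - 1) ∧ p.pot G S h ≤ -2 * p.mu)

variable {p}

theorem phi_self {G : SimpleGraph V} {S : Finset V} {h : V → ℕ} :
    p.phi G S h S = p.pot G S h := by
  simp [phi, pot, dg]

/-- An edge between the parts earns μ at each end in the separate terms and nothing in the union. -/
theorem phi_union {G : SimpleGraph V} {S : Finset V} {h : V → ℕ} {A B : Finset V}
    (hA : A ⊆ S) (hB : B ⊆ S) (hd : Disjoint A B) :
    p.phi G S h (A ∪ B) =
      p.phi G S h A + p.phi G S h B - 2 * p.mu * ∑ v ∈ A, (dg G B v : ℝ) := by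
  have h1 : ∀ v, (dg G (S \ A) v : ℝ) = dg G (S \ (A ∪ B)) v + dg G B v := by
    intro v
    have hB' : B ⊆ S \ A := by
      intro x hx
      exact mem_sdiff.2 ⟨hB hx, fun h => disjoint_left.1 hd h hx⟩
    have := dg_sdiff (G := G) hB' v
    rw [show (S \ A) \ B = S \ (A ∪ B) by ext; simp; tauto] at this
    rw [this]
    push_cast
    ring
  have h2 : ∀ v, (dg G (S \ B) v : ℝ) = dg G (S \ (A ∪ B)) v + dg G A v := by
    intro v
    have hA' : A ⊆ S \ B := by
      intro x hx
      exact mem_sdiff.2 ⟨hA hx, fun h => disjoint_left.1 hd hx h⟩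
    have := dg_sdiff (G := G) hA' v
    rw [show (S \ B) \ A = S \ (A ∪ B) by ext; simp; tauto] at this
    rw [this]
    push_cast
    ring
  have h3 : ∑ v ∈ A, (dg G B v : ℝ) = ∑ v ∈ B, (dg G A v : ℝ) := by
    exact_mod_cast sum_dg_comm G A B
  have h4 : ∑ v ∈ A, (p.wt G S h v + p.mu * (dg G (S \ (A ∪ B)) v + dg G B v)) =
      ∑ v ∈ A, (p.wt G S h v + p.mu * dg G (S \ (A ∪ B)) v) +
        p.mu * ∑ v ∈ A, (dg G B v : ℝ) := by
    rw [mul_sum, ← sum_add_distrib]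
    exact sum_congr rfl fun v _ => by ring
  have h5 : ∑ v ∈ B, (p.wt G S h v + p.mu * (dg G (S \ (A ∪ B)) v + dg G A v)) =
      ∑ v ∈ B, (p.wt G S h v + p.mu * dg G (S \ (A ∪ B)) v) +
        p.mu * ∑ v ∈ B, (dg G A v : ℝ) := by
    rw [mul_sum, ← sum_add_distrib]
    exact sum_congr rfl fun v _ => by ring
  simp only [phi, h1, h2]
  rw [sum_union hd, h4, h5, ← h3]
  ring

theorem phi_singleton {G : SimpleGraph V} {S : Finset V} {h : V → ℕ} {u : V} :
    p.phi G S h {u} = p.wt G S h u + p.mu * dg G S u := by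
  rw [phi, sum_singleton, sdiff_singleton_eq_erase, dg_erase_of_not_adj (G.loopless.irrefl u)]

end Par

/-! ### The smallest counterexample and the gap lemma -/

/-- A smallest counterexample. -/
structure MinCex (p : Par) (G : SimpleGraph V) (S : Finset V) (h : V → ℕ) : Prop where
  crit : Crit G (p.k - 1) S h
  ih : ∀ (G' : SimpleGraph V) (S' : Finset V) (h' : V → ℕ), S'.card < S.card →
    Crit G' (p.k - 1) S' h' → p.Good G' S' h'
  not_good : ¬ p.Good G S h

/-- Equality of colors is an admissible conflict relation; then the pigeonhole principle applies. -/
theorem not_col_clique {G : SimpleGraph V} {B : Finset V} (hB : G.IsClique (B : Set V)) {r : ℕ}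
    (hr : r < B.card) : ¬ Col G B (fun _ => r) := by
  intro hcol
  obtain ⟨f, hf⟩ := hcol ⟨fun _ => range r, fun _ a _ b => a = b, fun h => h.symm,
    fun h h' => h.symm.trans h'⟩ (by simp)
  obtain ⟨x, hx, y, hy, hxy, he⟩ := exists_ne_map_eq_of_card_lt_of_maps_to (t := range r)
    (by simpa using hr) (f := f) (fun v hv => hf.1 v hv)
  exact hf.2 x hx y hy (hB hx hy hxy) he

namespace MinCex

variable {p : Par} {G : SimpleGraph V} {S : Finset V} {h : V → ℕ}

theorem le (hm : MinCex p G S h) {v : V} (hv : v ∈ S) : h v ≤ p.k - 1 := hm.crit.le v hv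

theorem lt_pot (hm : MinCex p G S h) : -2 * p.mu < p.pot G S h := by
  by_contra hle
  push Not at hle
  refine hm.not_good (Or.inr ?_)
  by_cases hd : ∃ v ∈ S, h v < p.k - 1
  · exact Or.inr ⟨hd, hle⟩
  · push Not at hd
    refine Or.inl ⟨fun v hv => le_antisymm (hm.le hv) (hd v hv), ?_⟩
    have := p.one_lt_mu
    linarith

theorem lt_pot_of_eq (hm : MinCex p G S h) (h0 : ∀ v ∈ S, h v = p.k - 1) :
    -2 < p.pot G S h := by
  by_contra hle
  push Not at hle
  exact hm.not_good (Or.inr (Or.inl ⟨h0, hle⟩))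

/-- Such a clique is uncolorable, hence all of `S` by minimality. A value of `h` below k - 1 could
be raised without making it colorable, so `S` would be the first alternative of `Good`. -/
theorem no_clique (hm : MinCex p G S h) {B : Finset V} (hBS : B ⊆ S)
    (hB : G.IsClique (B : Set V)) : B.card ≠ p.k := by
  intro hcard
  have hk := p.five_le
  have hnc : ¬ Col G B (fun _ => p.k - 1) := not_col_clique hB (by omega)
  have hBeq : B = S := by
    by_contra hne
    refine hnc ((hm.crit.minimal B (ssubset_of_subset_of_ne hBS hne)).mono fun v hv => ?_)
    exact hm.le (hBS hv)
  subst hBeq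
  refine hm.not_good (Or.inl ⟨hB, hcard, fun v hv => ?_⟩)
  by_contra hne
  have hlt : h v < p.k - 1 := lt_of_le_of_ne (hm.le hv) hne
  refine hnc ((hm.crit.raise v hv hlt).mono fun w hw => ?_)
  by_cases hwv : w = v
  · subst hwv
    simp
    omega
  · simpa [hwv] using hm.le hw

/-- Color `I` and take a critical `J` in the rest with `h' ≥ h - dg G I`. Since `J` is colorable for
`h`, some `h' v` is less than k - 1, so induction gives the stronger bound -2μ for `J`. -/
theorem exists_gap_step (hm : MinCex p G S h) {I : Finset V} (hI : I ⊂ S) (hne : I.Nonempty) :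
    ∃ J ⊆ S \ I, J.Nonempty ∧ p.phi G S h (I ∪ J) ≤ p.phi G S h I - 2 * p.mu := by
  obtain ⟨K, hK, hcard⟩ := exists_trim hm.crit.not_col
  obtain ⟨f, hf⟩ := hm.crit.minimal I hI K fun v hv => (hcard v (hI.subset hv)).ge
  have hnc : ¬ Col G (S \ I) (fun v => h v - dg G I v) := by
    intro hcol
    refine hK (ColOn.of_res hf hI.subset (hcol _ fun v hv => ?_))
    have := card_le_res K G I f v
    rw [hcard v (mem_sdiff.1 hv).1] at this
    dsimp only
    omega
  obtain ⟨J, hJ, h', hh', hc⟩ := exists_crit (r := p.k - 1) (fun v hv => by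
    have := hm.le (mem_sdiff.1 hv).1
    omega) hnc
  have hJS : J ⊂ S := hJ.trans_ssubset (sdiff_ssubset hI.subset hne)
  have hgood := hm.ih G J h' (card_lt_card hJS) hc
  have hex : ∃ v ∈ J, h' v < p.k - 1 := by
    by_contra hno
    push Not at hno
    exact hc.not_col ((hm.crit.minimal J hJS).mono fun v hv => (hm.le (hJS.subset hv)).trans
      (hno v hv))
  have hpot : p.pot G J h' ≤ -2 * p.mu := by
    obtain ⟨v, hv, hlt⟩ := hex
    rcases hgood with hg | hg | hg
    · exact absurd (hg.2.2 v hv) hlt.ne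
    · exact absurd (hg.1 v hv) hlt.ne
    · exact hg.2
  refine ⟨J, hJ, hc.nonempty, ?_⟩
  have hd : Disjoint I J := disjoint_of_subset_right hJ disjoint_sdiff
  rw [Par.phi_union hI.subset hJS.subset hd]
  suffices hs : p.phi G S h J - 2 * p.mu * ∑ v ∈ I, (dg G J v : ℝ) ≤ p.pot G J h' by linarith
  have h3 : ∑ v ∈ I, (dg G J v : ℝ) = ∑ v ∈ J, (dg G I v : ℝ) := by
    exact_mod_cast sum_dg_comm G I J
  rw [h3, mul_sum, Par.phi, Par.pot, ← sum_sub_distrib]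
  refine sum_le_sum fun v hv => ?_
  have e1 : (dg G S v : ℝ) = dg G J v + dg G (S \ J) v := by
    exact_mod_cast dg_sdiff (G := G) hJS.subset v
  have e2 : (dg G I v : ℝ) ≤ dg G (S \ J) v := by
    exact_mod_cast dg_mono (G := G) (fun x hx => mem_sdiff.2 ⟨hI.subset hx,
      fun hxJ => disjoint_left.1 hd hx hxJ⟩) v
  have e3 : (h v : ℝ) - dg G I v ≤ h' v := by
    have := hh' v
    have e : h v ≤ h' v + dg G I v := by omega
    have e' : (h v : ℝ) ≤ h' v + dg G I v := by exact_mod_cast e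
    linarith
  have hmu := p.mu_le_two
  have hmu' := p.one_lt_mu
  have hlam := p.six_le
  rw [Par.wt, Par.wt, e1]
  -- At each vertex the right side minus the left side is the sum of the products in `f1` and `f2`.
  have f1 : 0 ≤ (p.lam + p.mu) * (h' v - h v + dg G I v) :=
    mul_nonneg (by linarith) (by linarith)
  have f2 : 0 ≤ (p.lam - p.mu) * (dg G (S \ J) v - dg G I v) :=
    mul_nonneg (by linarith) (by linarith)
  linarith

/-- Repeat the gap step until the part is `S`, where `phi` is the potential; at least one step takes
place. -/
theorem pot_add_le_phi (hm : MinCex p G S h) {I : Finset V} (hI : I ⊂ S) (hne : I.Nonempty) :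
    p.pot G S h + 2 * p.mu ≤ p.phi G S h I := by
  obtain ⟨n, hn⟩ : ∃ n, n = (S \ I).card := ⟨_, rfl⟩
  induction n using Nat.strong_induction_on generalizing I with
  | _ n ih =>
    obtain ⟨J, hJ, hJne, hle⟩ := hm.exists_gap_step hI hne
    by_cases hIJ : I ∪ J = S
    · rw [hIJ, Par.phi_self] at hle
      linarith
    · have hss : I ∪ J ⊂ S := ssubset_of_subset_of_ne
        (union_subset hI.subset (hJ.trans sdiff_subset)) hIJ
      have := ih (S \ (I ∪ J)).card (by
        rw [hn]
        apply card_lt_card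
        obtain ⟨x, hx⟩ := hJne
        refine ⟨sdiff_subset_sdiff Subset.rfl subset_union_left, fun hh => ?_⟩
        have := hh (hJ hx)
        simp [hx] at this) hss (hne.mono subset_union_left) rfl
      have := p.one_lt_mu
      linarith

theorem phi_pos (hm : MinCex p G S h) {I : Finset V} (hI : I ⊂ S) (hne : I.Nonempty) :
    0 < p.phi G S h I := by
  have := hm.pot_add_le_phi hI hne
  have := hm.lt_pot
  linarith

theorem lt_phi (hm : MinCex p G S h) {I : Finset V} (hI : I ⊆ S) (hne : I.Nonempty) :
    -2 * p.mu < p.phi G S h I := by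
  by_cases hIS : I = S
  · subst hIS
    rw [Par.phi_self]
    exact hm.lt_pot
  · have := hm.phi_pos (ssubset_of_subset_of_ne hI hIS) hne
    have := p.one_lt_mu
    linarith

/-- The gap lemma for both sides of the cut, with `phi_union`, gives 2μ · cut ≥ pot + 4μ > 2μ. -/
theorem two_le_cut (hm : MinCex p G S h) {I : Finset V} (hI : I ⊂ S) (hne : I.Nonempty) :
    2 ≤ cut G S I := by
  have h1 := hm.pot_add_le_phi hI hne
  have h2 := hm.pot_add_le_phi (sdiff_ssubset hI.subset hne) (sdiff_nonempty.2 hI.not_subset)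
  have h3 := Par.phi_union (p := p) (G := G) (h := h) hI.subset (sdiff_subset (t := I))
    disjoint_sdiff
  rw [union_sdiff_of_subset hI.subset, Par.phi_self] at h3
  have h4 := hm.lt_pot
  have h5 : ∑ v ∈ I, (dg G (S \ I) v : ℝ) = cut G S I := by
    rw [cut]
    push_cast
    rfl
  rw [h5] at h3
  have h6 := p.one_lt_mu
  have h7 : (1 : ℝ) < cut G S I := by
    by_contra hle
    push Not at hle
    nlinarith
  have : 1 < cut G S I := by exact_mod_cast h7
  omega

end MinCex

/-! ### Cliques of k - 1 low vertices -/

theorem conn_of_clique {G : SimpleGraph V} {B : Finset V} (hB : G.IsClique (B : Set V)) :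
    Conn G B := by
  intro Y hY ⟨a, ha⟩ hYB
  obtain ⟨b, hb, hbY⟩ : ∃ b ∈ B, b ∉ Y := by
    by_contra hno
    push Not at hno
    exact hYB (subset_antisymm hY hno)
  exact ⟨a, ha, b, hb, hbY, hB (hY ha) hb fun h => hbY (h ▸ ha)⟩

theorem eq_of_dg_le_one {G : SimpleGraph V} {X : Finset V} {x u v : V} (h : dg G X x ≤ 1)
    (hu : u ∈ X) (hv : v ∈ X) (hxu : G.Adj x u) (hxv : G.Adj x v) : u = v := by
  classical
  exact card_le_one.1 h u (by simp [hu, hxu]) v (by simp [hv, hxv])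

/-- A clique of size `k - 1` whose vertices have the least possible degree. -/
structure LowClique (p : Par) (G : SimpleGraph V) (S : Finset V) (h : V → ℕ) (Q : Finset V) :
    Prop where
  sub : Q ⊆ S
  clique : G.IsClique (Q : Set V)
  card : Q.card = p.k - 1
  low : ∀ x ∈ Q, dg G S x = h x

namespace LowClique

variable {p : Par} {G : SimpleGraph V} {S : Finset V} {h : V → ℕ} {Q : Finset V}

theorem dg_self (hQ : LowClique p G S h Q) {x : V} (hx : x ∈ Q) : dg G Q x = p.k - 2 := by
  rw [dg_of_clique hQ.clique hx, hQ.card]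
  omega

theorem eq_add (hQ : LowClique p G S h Q) {x : V} (hx : x ∈ Q) :
    h x = p.k - 2 + dg G (S \ Q) x := by
  rw [← hQ.low x hx, dg_sdiff hQ.sub, hQ.dg_self hx]

theorem dg_le_one (hm : MinCex p G S h) (hQ : LowClique p G S h Q) {x : V} (hx : x ∈ Q) :
    dg G (S \ Q) x ≤ 1 := by
  have h1 := hQ.eq_add hx
  have h2 := hm.le (hQ.sub hx)
  have := p.five_le
  omega

theorem sdiff_ssubset (hQ : LowClique p G S h Q) : S \ Q ⊂ S :=
  Finset.sdiff_ssubset hQ.sub (card_pos.1 (by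
    have := p.five_le
    have := hQ.card
    omega))

theorem not_colOn_res (hQ : LowClique p G S h Q) {K : Cov V} (hK : ¬ ColOn G K S)
    {f : V → ℕ} (hf : IsCol G K (S \ Q) f) : ¬ ColOn G (K.res G (S \ Q) f) Q := by
  intro hcol
  refine hK (ColOn.of_res hf sdiff_subset ?_)
  rwa [Finset.sdiff_sdiff_eq_self hQ.sub]

theorem le_card_res (hQ : LowClique p G S h Q) {K : Cov V}
    (hcard : ∀ v ∈ S, (K.L v).card = h v) {f : V → ℕ} {x : V} (hx : x ∈ Q) :
    p.k - 2 ≤ ((K.res G (S \ Q) f).L x).card := by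
  have h1 := card_le_res K G (S \ Q) f x
  rw [hcard x (hQ.sub hx), hQ.eq_add hx] at h1
  omega

/-- A longer residual list would be a surplus in the connected set `Q`. -/
theorem card_res (hQ : LowClique p G S h Q) {K : Cov V} (hK : ¬ ColOn G K S)
    (hcard : ∀ v ∈ S, (K.L v).card = h v) {f : V → ℕ} (hf : IsCol G K (S \ Q) f) {x : V}
    (hx : x ∈ Q) : ((K.res G (S \ Q) f).L x).card = p.k - 2 := by
  refine le_antisymm ?_ (hQ.le_card_res hcard hx)
  by_contra hlt
  push Not at hlt
  refine hQ.not_colOn_res hK hf (colOn_of_surplus (conn_of_clique hQ.clique) (fun v hv => ?_) hx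
    ?_)
  · rw [hQ.dg_self hv]
    exact hQ.le_card_res hcard hv
  · rwa [hQ.dg_self hx]

theorem exists_conflict (hQ : LowClique p G S h Q) {K : Cov V} (hK : ¬ ColOn G K S)
    (hcard : ∀ v ∈ S, (K.L v).card = h v) {f : V → ℕ} (hf : IsCol G K (S \ Q) f) {x y : V}
    (hx : x ∈ Q) (hy : y ∈ Q) (hxy : x ≠ y) {c : ℕ} (hc : c ∈ (K.res G (S \ Q) f).L x) :
    ∃ d ∈ (K.res G (S \ Q) f).L y, K.R x c y d := by
  refine DPCover.exists_conflict (K := K.res G (S \ Q) f) (conn_of_clique ?_) (fun v hv => ?_)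
    (hQ.not_colOn_res hK hf) hx hy (hQ.clique hx hy hxy) hc
  · exact hQ.clique.subset (by simp)
  · rw [hQ.dg_self hv]
    exact hQ.le_card_res hcard hv

/-- Two colorings that differ at a neighbor `u` of `x ∈ Q`, but not at the neighbors of `y ∈ Q`,
cannot both fail to extend to `Q`. -/
theorem eq_of_not_colOn (hm : MinCex p G S h) (hQ : LowClique p G S h Q) {K : Cov V}
    (hK : ¬ ColOn G K S) (hcard : ∀ v ∈ S, (K.L v).card = h v) {f f' : V → ℕ}
    (hf : IsCol G K (S \ Q) f) (hf' : IsCol G K (S \ Q) f') {x y u : V} (hx : x ∈ Q) (hy : y ∈ Q)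
    (hxy : x ≠ y) (hu : u ∈ S \ Q) (hxu : G.Adj x u)
    (hff : ∀ v ∈ S \ Q, G.Adj v y → f v = f' v) : f u = f' u := by
  by_contra hne
  have h1 := hQ.card_res hK hcard hf hy
  have hLy : (K.res G (S \ Q) f').L y = (K.res G (S \ Q) f).L y := by
    ext b
    rw [mem_res, mem_res]
    refine and_congr_right fun _ => forall₂_congr fun v hv => ?_
    refine forall_congr' fun hvy => ?_
    rw [hff v hv hvy]
  -- No color of `x` is forbidden both by `f u` and by `f' u`. So every color survives one of the
  -- two colorings and has a conflict in the residual list of `y`, which is the same for both. This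
  -- maps at least k - 1 colors injectively to k - 2.
  have hcon : ∀ c ∈ K.L x, ∃ d ∈ (K.res G (S \ Q) f).L y, K.R x c y d := by
    intro c hc
    by_cases hcr : c ∈ (K.res G (S \ Q) f).L x
    · exact hQ.exists_conflict hK hcard hf hx hy hxy hcr
    · rw [← hLy]
      refine hQ.exists_conflict hK hcard hf' hx hy hxy ?_
      rw [mem_res] at hcr ⊢
      push Not at hcr
      refine ⟨hc, fun v hv hvx hr => ?_⟩
      obtain ⟨v', hv', hvx', hr'⟩ := hcr hc
      have e1 := eq_of_dg_le_one (hQ.dg_le_one hm hx) hu hv hxu hvx.symm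
      have e2 := eq_of_dg_le_one (hQ.dg_le_one hm hx) hu hv' hxu hvx'.symm
      subst e1
      subst e2
      exact hne (K.inj' hr' hr)
  choose! g hg hR using hcon
  have h2 := card_le_card_of_injOn g hg fun a ha b hb hab => by
    have h1 := hR a ha
    have h2 := hR b hb
    rw [hab] at h1
    exact K.inj' h1 h2
  have h3 : 0 < dg G (S \ Q) x := dg_pos_iff.2 ⟨u, hu, hxu⟩
  rw [hcard x (hQ.sub hx), hQ.eq_add hx, h1] at h2
  omega

end LowClique

/-- Compares `A` as a part of `S` with `A` as a critical set for other list sizes: each leaving edge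
costs λ - μ, and each unit by which `h'` exceeds `h` costs λ + μ. -/
theorem Par.phi_eq_pot {p : Par} {G : SimpleGraph V} {S : Finset V} {h : V → ℕ} {A : Finset V}
    (hA : A ⊆ S) (h' : V → ℕ) :
    p.phi G S h A = p.pot G A h' - (p.lam + p.mu) * ∑ v ∈ A, ((h' v : ℝ) - h v) -
      (p.lam - p.mu) * cut G S A := by
  rw [phi, pot, cut]
  push_cast
  rw [mul_sum, mul_sum, ← sum_sub_distrib, ← sum_sub_distrib]
  refine sum_congr rfl fun v _ => ?_
  have e1 : (dg G S v : ℝ) = dg G A v + dg G (S \ A) v := by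
    exact_mod_cast dg_sdiff (G := G) hA v
  rw [wt, wt, e1]
  ring

theorem card_le_cut {G : SimpleGraph V} {S A : Finset V} (P : Finset (V × V))
    (hP : ∀ e ∈ P, e.1 ∈ A ∧ e.2 ∈ S ∧ e.2 ∉ A ∧ G.Adj e.1 e.2) : P.card ≤ cut G S A := by
  classical
  have h1 : cut G S A = (A.sigma fun v => (S \ A).filter (G.Adj v)).card := by
    rw [card_sigma]
    exact sum_congr rfl fun v _ => by
      unfold dg
      congr
  rw [h1]
  refine card_le_card_of_injOn (fun e => ⟨e.1, e.2⟩) (fun e he => ?_) ?_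
  · obtain ⟨h1, h2, h3, h4⟩ := hP e he
    simp [h1, h2, h3, h4]
  · rintro ⟨a, b⟩ _ ⟨c, d⟩ _ hab
    simpa using hab

namespace LowClique

variable {p : Par} {G : SimpleGraph V} {S : Finset V} {h : V → ℕ} {Q : Finset V}

/-- Otherwise `h = k - 2` on `Q`. A proper part `Q` would be both colorable and not, and `Q = S` has
potential exactly -2μ. -/
theorem exists_outer (hm : MinCex p G S h) (hQ : LowClique p G S h Q) :
    ∃ x ∈ Q, 0 < dg G (S \ Q) x := by
  by_contra hno
  push Not at hno
  have hQd : ∀ x ∈ Q, h x = p.k - 2 := fun x hx => by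
    have := hQ.eq_add hx
    have := hno x hx
    omega
  have hk := p.five_le
  have hk' := p.five_le'
  have hQne : Q.Nonempty := card_pos.1 (by rw [hQ.card]; omega)
  have hQS : Q = S := by
    by_contra hne
    refine hm.crit.not_col_dg hQ.sub hQne hQ.low ?_
    refine (hm.crit.minimal Q (ssubset_of_subset_of_ne hQ.sub hne)).mono fun x hx => ?_
    rw [hQ.dg_self hx, hQd x hx]
  subst hQS
  have hpot : p.pot G Q h = -2 * p.mu := by
    rw [Par.pot, sum_congr rfl (g := fun _ => 1 - p.mu), sum_const, hQ.card, nsmul_eq_mul]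
    · have := p.mu_mul
      rw [Nat.cast_sub (by omega)]
      push_cast
      linarith
    · intro x hx
      rw [Par.wt, hQ.dg_self hx, hQd x hx, Nat.cast_sub (by omega)]
      push_cast
      ring
  exact hm.lt_pot.ne' hpot

/-- If `y` had no outer neighbor, all colorings of `S \ Q` in a bad cover would agree at an outer
neighbor `u` of some `x`. Deleting that color at `u` makes `S \ Q` uncolorable, which yields a
critical set with `phi` at most -2μ + (λ + μ) - (λ - μ) = 0. -/
theorem dg_eq_one (hm : MinCex p G S h) (hQ : LowClique p G S h Q) {y : V} (hy : y ∈ Q) :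
    dg G (S \ Q) y = 1 := by
  refine le_antisymm (hQ.dg_le_one hm hy) ?_
  by_contra hlt
  have hy0 : dg G (S \ Q) y = 0 := by omega
  obtain ⟨x, hx, hpos⟩ := hQ.exists_outer hm
  obtain ⟨u, hu, hxu⟩ := dg_pos_iff.1 hpos
  have hxy : x ≠ y := by
    rintro rfl
    omega
  have huS := (mem_sdiff.1 hu).1
  have hnc : ¬ Col G (S \ Q) (Function.update h u (h u - 1)) := by
    intro hcol
    obtain ⟨K, hK, hcard⟩ := exists_trim hm.crit.not_col
    obtain ⟨f, hf⟩ := hm.crit.minimal _ hQ.sdiff_ssubset K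
      fun v hv => (hcard v (mem_sdiff.1 hv).1).ge
    obtain ⟨f', hf'⟩ := hcol ⟨Function.update K.L u ((K.L u).erase (f u)), K.R, K.symm, K.inj⟩ (by
      intro v hv
      by_cases hvu : v = u
      · subst hvu
        simp only [Function.update_self]
        rw [← hcard v (mem_sdiff.1 hv).1]
        exact pred_card_le_card_erase
      · simp [hvu, hcard v (mem_sdiff.1 hv).1])
    have hf'' : IsCol G K (S \ Q) f' := by
      refine ⟨fun v hv => ?_, hf'.2⟩
      have := hf'.1 v hv
      by_cases hvu : v = u
      · subst hvu
        simp only [Function.update_self] at this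
        exact mem_of_mem_erase this
      · simpa [hvu] using this
    have heq := hQ.eq_of_not_colOn hm hK hcard hf hf'' hx hy hxy hu hxu (by
      intro v hv hvy
      have := dg_pos_iff.2 ⟨v, hv, hvy.symm⟩
      omega)
    have := hf'.1 u hu
    simp [heq] at this
  obtain ⟨A, hA, h', hh', hc⟩ := exists_crit (r := p.k - 1) (fun v hv => by
    have := hm.le (mem_sdiff.1 hv).1
    by_cases hvu : v = u
    · subst hvu
      simp
      omega
    · simpa [hvu] using this) hnc
  have hAS : A ⊂ S := hA.trans_ssubset hQ.sdiff_ssubset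
  have hle : ∀ v, v ≠ u → h v ≤ h' v := fun v hv => by simpa [hv] using hh' v
  have hlt : ∃ v ∈ A, h' v < h v := by
    by_contra hno
    push Not at hno
    exact hc.not_col ((hm.crit.minimal A hAS).mono hno)
  obtain ⟨v, hv, hvlt⟩ := hlt
  have hvu : v = u := by
    by_contra hvu
    have := hle v hvu
    omega
  subst hvu
  have hvle := hm.le huS
  have hpot : p.pot G A h' ≤ -2 * p.mu := by
    rcases hm.ih G A h' (card_lt_card hAS) hc with hg | hg | hg
    · exact absurd (hg.2.2 v hv) (by omega)
    · exact absurd (hg.1 v hv) (by omega)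
    · exact hg.2
  have hphi := hm.phi_pos hAS hc.nonempty
  rw [Par.phi_eq_pot hAS.subset h'] at hphi
  have hcut : 1 ≤ cut G S A := by
    have := card_le_cut (G := G) (S := S) (A := A) {(v, x)} (by
      simp only [mem_singleton, forall_eq]
      exact ⟨hv, hQ.sub hx, fun hxA => (mem_sdiff.1 (hA hxA)).2 hx, hxu.symm⟩)
    simpa using this
  have hsum : -1 ≤ ∑ w ∈ A, ((h' w : ℝ) - h w) := by
    rw [← add_sum_erase _ _ hv]
    have h1 : 0 ≤ ∑ w ∈ A.erase v, ((h' w : ℝ) - h w) := sum_nonneg fun w hw => by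
      have : (h w : ℝ) ≤ h' w := by exact_mod_cast hle w (ne_of_mem_erase hw)
      linarith
    have h2 : (h v : ℝ) ≤ h' v + 1 := by
      have := hh' v
      simp only [Function.update_self] at this
      have : h v ≤ h' v + 1 := by omega
      exact_mod_cast this
    linarith
  have hcut' : (1 : ℝ) ≤ cut G S A := by exact_mod_cast hcut
  have := p.six_le
  have := p.mu_le_two
  have := p.one_lt_mu
  nlinarith

theorem eq_pred (hm : MinCex p G S h) (hQ : LowClique p G S h Q) {x : V} (hx : x ∈ Q) :
    h x = p.k - 1 := by
  rw [hQ.eq_add hx, hQ.dg_eq_one hm hx]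
  have := p.five_le
  omega

theorem exists_adj (hm : MinCex p G S h) (hQ : LowClique p G S h Q) {x : V} (hx : x ∈ Q) :
    ∃ u ∈ S \ Q, G.Adj x u := by
  apply dg_pos_iff.1
  rw [hQ.dg_eq_one hm hx]
  exact one_pos

theorem adj_unique (hm : MinCex p G S h) (hQ : LowClique p G S h Q) {x u v : V} (hx : x ∈ Q)
    (hu : u ∈ S \ Q) (hv : v ∈ S \ Q) (hxu : G.Adj x u) (hxv : G.Adj x v) : u = v :=
  eq_of_dg_le_one (hQ.dg_eq_one hm hx).le hu hv hxu hxv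

theorem exists_not_adj (hm : MinCex p G S h) (hQ : LowClique p G S h Q) {u : V} (hu : u ∈ S \ Q) :
    ∃ y ∈ Q, ¬ G.Adj y u := by
  by_contra hno
  push Not at hno
  rw [mem_sdiff] at hu
  refine hm.no_clique (B := insert u Q) (insert_subset hu.1 hQ.sub) ?_ ?_
  · rw [coe_insert, SimpleGraph.isClique_insert]
    exact ⟨hQ.clique, fun b hb _ => (hno b hb).symm⟩
  · rw [card_insert_of_notMem hu.2, hQ.card]
    have := p.five_le
    omega

/-- The degree of a vertex outside of `Q` with a neighbor in `Q` is not much smaller than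
expected. -/
theorem add_dg_le (hm : MinCex p G S h) (hQ : LowClique p G S h Q) {u x : V} (hu : u ∈ S \ Q)
    (hx : x ∈ Q) (hxu : G.Adj x u) : h u + dg G Q u ≤ dg G S u + 1 := by
  by_contra hlt
  push Not at hlt
  obtain ⟨y, hy, hyu⟩ := hQ.exists_not_adj hm hu
  obtain ⟨K, hK, hcard⟩ := exists_trim hm.crit.not_col
  have huS := (mem_sdiff.1 hu).1
  set T := (S \ Q).erase u with hT
  have hTS : T ⊂ S := (erase_subset _ _).trans_ssubset hQ.sdiff_ssubset
  obtain ⟨f, hf⟩ := hm.crit.minimal T hTS K fun v hv => (hcard v (hTS.subset hv)).ge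
  have h1 := card_le_res K G T f u
  have h2 := dg_sdiff (G := G) hQ.sub u
  have h3 : dg G T u = dg G (S \ Q) u := dg_erase_of_not_adj (G.loopless.irrefl u)
  have h4 := hcard u huS
  -- Two colors are left for `u`, and the extensions agree at the outer neighbors of `y`.
  obtain ⟨b, hb, b', hb', hbb'⟩ := one_lt_card.1
    (show 1 < ((K.res G T f).L u).card by omega)
  have hins : insert u T = S \ Q := insert_erase hu
  have hc := hf.insert (notMem_erase u _) hb
  have hc' := hf.insert (notMem_erase u _) hb'
  rw [hins] at hc hc'
  have := hQ.eq_of_not_colOn hm hK hcard hc hc' hx hy (by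
    rintro rfl
    exact hyu hxu) hu hxu (by
    intro v _ hvy
    have : v ≠ u := by
      rintro rfl
      exact hyu hvy.symm
    simp [this])
  simp at this
  exact hbb' this

/-- Color `u` and `w` last. Then `u` has two choices, `w` has one after each of them, and the color
of `v`, the outer neighbor of `z`, stays fixed, against `eq_of_not_colOn`. -/
theorem not_both_tight (hm : MinCex p G S h) (hQ : LowClique p G S h Q) {u w v x z : V}
    (hu : u ∈ S \ Q) (hw : w ∈ S \ Q) (hv : v ∈ S \ Q) (huw : G.Adj u w) (hvu : v ≠ u)
    (hvw : v ≠ w) (hx : x ∈ Q) (hz : z ∈ Q) (hxu : G.Adj x u)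
    (hzv : G.Adj z v) (hut : dg G S u + 1 ≤ h u + dg G Q u)
    (hwt : dg G S w + 1 ≤ h w + dg G Q w) : False := by
  obtain ⟨K, hK, hcard⟩ := exists_trim hm.crit.not_col
  have huS := (mem_sdiff.1 hu).1
  have hwS := (mem_sdiff.1 hw).1
  have hw1 : w ∈ (S \ Q).erase u := mem_erase.2 ⟨huw.ne', hw⟩
  set T := ((S \ Q).erase u).erase w with hT
  have hTS : T ⊂ S :=
    ((erase_subset _ _).trans (erase_subset _ _)).trans_ssubset hQ.sdiff_ssubset
  obtain ⟨f, hf⟩ := hm.crit.minimal T hTS K fun v hv => (hcard v (hTS.subset hv)).ge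
  have huT : u ∉ T := by simp [hT]
  have hwT : w ∉ insert u T := by simp [hT, huw.ne']
  have hins : insert w (insert u T) = S \ Q := by
    rw [Finset.insert_comm, hT, insert_erase hw1, insert_erase hu]
  have h1 := card_le_res K G T f u
  have h2 := dg_sdiff (G := G) hQ.sub u
  have h3 : dg G T u + 1 = dg G (S \ Q) u := by
    rw [dg_erase_of_adj hw1 huw, dg_erase_of_not_adj (G.loopless.irrefl u)]
  have h4 := hcard u huS
  obtain ⟨b, hb, b', hb', hbb'⟩ := one_lt_card.1
    (show 1 < ((K.res G T f).L u).card by omega)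
  have step : ∀ b ∈ (K.res G T f).L u, ∃ f', IsCol G K (S \ Q) f' ∧ f' u = b ∧
      ∀ t, t ≠ u → t ≠ w → f' t = f t := by
    intro b hb
    have hc := hf.insert huT hb
    have e1 := card_le_res K G (insert u T) (Function.update f u b) w
    have e2 := dg_sdiff (G := G) hQ.sub w
    have e3 : dg G (insert u T) w = dg G (S \ Q) w := by
      rw [← hins, dg_insert_self]
    have e4 := hcard w hwS
    obtain ⟨c, hc'⟩ := card_pos.1
      (show 0 < ((K.res G (insert u T) (Function.update f u b)).L w).card by omega)
    have := hc.insert hwT hc'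
    rw [hins] at this
    refine ⟨_, this, by simp [huw.ne], fun t ht1 ht2 => by simp [ht1, ht2]⟩
  obtain ⟨f₁, hf₁, hfb, hfe⟩ := step b hb
  obtain ⟨f₂, hf₂, hfb', hfe'⟩ := step b' hb'
  have := hQ.eq_of_not_colOn hm hK hcard hf₁ hf₂ hx hz (by
    rintro rfl
    exact hvu (hQ.adj_unique hm hx hv hu hzv hxu)) hu hxu (by
    intro t ht htz
    obtain rfl := hQ.adj_unique hm hz hv ht hzv htz.symm
    rw [hfe v hvu hvw, hfe' v hvu hvw])
  rw [hfb, hfb'] at this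
  exact hbb' this

end LowClique

/-! ### Replacing the clique by an edge -/

/-- The pairs of colors of `u` and `w` that block the extension of a coloring to a clique that
contains a neighbor `x` of `u` and a neighbor `y` of `w`. -/
def Cov.Blocks (K : Cov V) (u w x y : V) (a b : ℕ) : Prop :=
  (∃ c ∈ K.L x, K.R u a x c) ∧ (∃ d ∈ K.L y, K.R w b y d) ∧
    ∀ c ∈ K.L x, ¬ K.R u a x c → ∃ d ∈ K.L y, K.R x c y d ∧ ¬ K.R w b y d

/-- If `b` and `b'` differed, the colors of `x` other than `c` would map injectively by conflicts
into the list of `y` without two colors. -/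
theorem Cov.Blocks.right_unique {K : Cov V} {u w x y : V} {a b b' : ℕ}
    (hxy : (K.L x).card = (K.L y).card) (h : K.Blocks u w x y a b)
    (h' : K.Blocks u w x y a b') : b = b' := by
  by_contra hne
  obtain ⟨⟨c, hc, hac⟩, ⟨d, hd, hbd⟩, hall⟩ := h
  obtain ⟨-, ⟨d', hd', hbd'⟩, hall'⟩ := h'
  have hdd : d' ≠ d := by
    rintro rfl
    exact hne (K.inj' hbd hbd')
  have hcon : ∀ t ∈ (K.L x).erase c, ∃ e ∈ ((K.L y).erase d).erase d', K.R x t y e := by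
    intro t ht
    rw [mem_erase] at ht
    have htn : ¬ K.R u a x t := fun hr => ht.1 (K.inj hr hac)
    obtain ⟨e, he, hr, hn⟩ := hall t ht.2 htn
    obtain ⟨e', he', hr', hn'⟩ := hall' t ht.2 htn
    obtain rfl := K.inj hr hr'
    refine ⟨e, mem_erase.2 ⟨?_, mem_erase.2 ⟨?_, he⟩⟩, hr⟩
    · rintro rfl
      exact hn' hbd'
    · rintro rfl
      exact hn hbd
  choose! g hg hR using hcon
  have h2 := card_le_card_of_injOn g hg fun a ha b hb hab => by
    have h1 := hR a ha
    have h2 := hR b hb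
    rw [hab] at h1
    exact K.inj' h1 h2
  rw [card_erase_of_mem hc, card_erase_of_mem (mem_erase.2 ⟨hdd, hd'⟩), card_erase_of_mem hd,
    hxy] at h2
  have h3 := card_pos.2 ⟨d', mem_erase.2 ⟨hdd, hd'⟩⟩
  rw [card_erase_of_mem hd] at h3
  omega

/-- If `a` and `a'` differed, every color of `x` would survive one of them, so the whole list of `x`
would map injectively into that of `y` without `d`. -/
theorem Cov.Blocks.left_unique {K : Cov V} {u w x y : V} {a a' b : ℕ}
    (hxy : (K.L x).card = (K.L y).card) (h : K.Blocks u w x y a b)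
    (h' : K.Blocks u w x y a' b) : a = a' := by
  by_contra hne
  obtain ⟨-, ⟨d, hd, hbd⟩, hall⟩ := h
  obtain ⟨-, -, hall'⟩ := h'
  have hcon : ∀ t ∈ K.L x, ∃ e ∈ (K.L y).erase d, K.R x t y e := by
    intro t ht
    have : ∃ e ∈ K.L y, K.R x t y e ∧ ¬ K.R w b y e := by
      by_cases hr : K.R u a x t
      · exact hall' t ht fun hr' => hne (K.inj' hr hr')
      · exact hall t ht hr
    obtain ⟨e, he, hr, hn⟩ := this
    refine ⟨e, mem_erase.2 ⟨?_, he⟩, hr⟩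
    rintro rfl
    exact hn hbd
  choose! g hg hR using hcon
  have h2 := card_le_card_of_injOn g hg fun a ha b hb hab => by
    have h1 := hR a ha
    have h2 := hR b hb
    rw [hab] at h1
    exact K.inj' h1 h2
  rw [card_erase_of_mem hd, hxy] at h2
  have := card_pos.2 ⟨d, hd⟩
  omega

/-- Replace the conflicts between `u` and `w` with the blocking pairs. -/
def Cov.withBlocks (K : Cov V) {u w x y : V} (huw : u ≠ w)
    (hxy : (K.L x).card = (K.L y).card) : Cov V where
  L := K.L
  R s a t b := if s = u ∧ t = w then K.Blocks u w x y a b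
    else if s = w ∧ t = u then K.Blocks u w x y b a else K.R s a t b
  symm := by
    intro s a t b hr
    by_cases h1 : s = u ∧ t = w
    · obtain ⟨rfl, rfl⟩ := h1
      simpa [huw, huw.symm] using hr
    by_cases h2 : s = w ∧ t = u
    · obtain ⟨rfl, rfl⟩ := h2
      simpa [huw, huw.symm] using hr
    have h1' : ¬ (t = w ∧ s = u) := fun h => h1 h.symm
    have h2' : ¬ (t = u ∧ s = w) := fun h => h2 h.symm
    rw [if_neg h1, if_neg h2] at hr
    rw [if_neg h2', if_neg h1']
    exact K.symm hr
  inj := by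
    intro s a t b b' hr hr'
    by_cases h1 : s = u ∧ t = w
    · rw [if_pos h1] at hr hr'
      exact hr.right_unique hxy hr'
    by_cases h2 : s = w ∧ t = u
    · rw [if_neg h1, if_pos h2] at hr hr'
      exact hr.left_unique hxy hr'
    rw [if_neg h1, if_neg h2] at hr hr'
    exact K.inj hr hr'

theorem dg_sup_edge {G : SimpleGraph V} {A : Finset V} {u w : V} (hu : u ∈ A) (hw : w ∈ A)
    (huw : u ≠ w) (hn : ¬ G.Adj u w) (v : V) :
    dg (G ⊔ SimpleGraph.edge u w) A v =
      dg G A v + (if v = u then 1 else 0) + (if v = w then 1 else 0) := by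
  classical
  have h1 : (if v = u then 1 else 0) = ∑ t ∈ A, if v = u ∧ t = w then 1 else 0 := by
    by_cases h : v = u
    · simp [h, hw]
    · simp [h]
  have h2 : (if v = w then 1 else 0) = ∑ t ∈ A, if v = w ∧ t = u then 1 else 0 := by
    by_cases h : v = w
    · simp [h, hu]
    · simp [h]
  rw [dg_eq_sum, dg_eq_sum, h1, h2, ← sum_add_distrib, ← sum_add_distrib]
  refine sum_congr rfl fun t _ => ?_
  simp only [SimpleGraph.sup_adj, SimpleGraph.edge_adj]
  by_cases h1 : v = u ∧ t = w
  · obtain ⟨rfl, rfl⟩ := h1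
    simp [huw, hn]
  by_cases h2 : v = w ∧ t = u
  · obtain ⟨rfl, rfl⟩ := h2
    simpa [huw.symm] using fun h : G.Adj v t => hn h.symm
  simp [h1, h2]

namespace Par

variable {p : Par}

theorem pot_sup_edge {G : SimpleGraph V} {A : Finset V} {h : V → ℕ} {u w : V} (hu : u ∈ A)
    (hw : w ∈ A) (huw : u ≠ w) (hn : ¬ G.Adj u w) :
    p.pot (G ⊔ SimpleGraph.edge u w) A h = p.pot G A h - 2 * p.lam := by
  have h1 : ∀ t ∈ A, ∑ v ∈ A, (if v = t then (1 : ℝ) else 0) = 1 := fun t ht => by simp [ht]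
  have h2 : 2 * p.lam = ∑ v ∈ A, p.lam * ((if v = u then 1 else 0) + if v = w then 1 else 0) := by
    rw [← mul_sum, sum_add_distrib, h1 u hu, h1 w hw]
    ring
  rw [pot, pot, h2, ← sum_sub_distrib]
  refine sum_congr rfl fun v _ => ?_
  rw [wt, wt, dg_sup_edge hu hw huw hn]
  push_cast
  ring

/-- Three leaving edges beyond the first two use up `phi` of a near-clique; hence the bound 4 on its
cut. -/
theorem add_le_three_mul (p : Par) : p.k + 2 * p.mu ≤ 3 * (p.lam - p.mu) := by
  have h1 := p.five_le'
  have h2 := p.mu_mul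
  have h3 := p.six_le
  have h4 := p.le_lam
  have hk := p.five_le
  -- This is the polynomial part of (k^2 - 7)/(2k - 7); the remainder is positive.
  have h5 : (p.k : ℝ) / 2 + 7 / 4 ≤ p.lam := by
    by_contra hlt
    push Not at hlt
    nlinarith
  rcases (show p.k = 5 ∨ p.k = 6 ∨ 7 ≤ p.k by omega) with h | h | h
  · rw [h] at h2 ⊢
    push_cast at h2 ⊢
    linarith
  · rw [h] at h2 ⊢
    push_cast at h2 ⊢
    linarith
  · have h7 : (7 : ℝ) ≤ p.k := by exact_mod_cast h
    have hmu : p.mu ≤ 3 / 2 := by nlinarith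
    linarith

end Par

namespace LowClique

variable {p : Par} {G : SimpleGraph V} {S : Finset V} {h : V → ℕ} {Q : Finset V}

theorem blocks (hm : MinCex p G S h) (hQ : LowClique p G S h Q) {K : Cov V}
    (hK : ¬ ColOn G K S) (hcard : ∀ v ∈ S, (K.L v).card = h v) {f : V → ℕ}
    (hf : IsCol G K (S \ Q) f) {u w x y : V} (hu : u ∈ S \ Q) (hw : w ∈ S \ Q) (hx : x ∈ Q)
    (hy : y ∈ Q) (hxy : x ≠ y) (hxu : G.Adj x u) (hyw : G.Adj y w) :
    K.Blocks u w x y (f u) (f w) := by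
  have hkill : ∀ t ∈ Q, ∀ v ∈ S \ Q, G.Adj t v → ∃ c ∈ K.L t, K.R v (f v) t c := by
    intro t ht v hv htv
    have h1 := hQ.card_res hK hcard hf ht
    have h2 := hcard t (hQ.sub ht)
    rw [hQ.eq_pred hm ht] at h2
    have := p.five_le
    obtain ⟨c, hc, hcr⟩ := exists_mem_notMem_of_card_lt_card
      (show ((K.res G (S \ Q) f).L t).card < (K.L t).card by omega)
    rw [mem_res] at hcr
    push Not at hcr
    obtain ⟨v', hv', hvt', hr⟩ := hcr hc
    obtain rfl := hQ.adj_unique hm ht hv hv' htv hvt'.symm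
    exact ⟨c, hc, hr⟩
  refine ⟨hkill x hx u hu hxu, hkill y hy w hw hyw, fun c hc hr => ?_⟩
  have hcr : c ∈ (K.res G (S \ Q) f).L x := by
    rw [mem_res]
    refine ⟨hc, fun v hv hvx => ?_⟩
    obtain rfl := hQ.adj_unique hm hx hu hv hxu hvx.symm
    exact hr
  obtain ⟨d, hd, hcd⟩ := hQ.exists_conflict hK hcard hf hx hy hxy hcr
  rw [mem_res] at hd
  exact ⟨d, hd.1, hcd, hd.2 w hw hyw.symm⟩

/-- Blocking pairs are admissible conflicts on a new edge `uw`, and with them `S \ Q` is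
uncolorable. A critical set without both ends would be colorable by minimality. -/
theorem exists_crit_of_not_adj (hm : MinCex p G S h) (hQ : LowClique p G S h Q) {u w x y : V}
    (hu : u ∈ S \ Q) (hw : w ∈ S \ Q) (huw : u ≠ w) (hn : ¬ G.Adj u w) (hx : x ∈ Q) (hy : y ∈ Q)
    (hxu : G.Adj x u) (hyw : G.Adj y w) :
    ∃ A ⊆ S \ Q, ∃ h' : V → ℕ, u ∈ A ∧ w ∈ A ∧ (∀ v, h v ≤ h' v) ∧
      Crit (G ⊔ SimpleGraph.edge u w) (p.k - 1) A h' := by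
  have hxy : x ≠ y := by
    rintro rfl
    exact huw (hQ.adj_unique hm hx hu hw hxu hyw)
  have hnc : ¬ Col (G ⊔ SimpleGraph.edge u w) (S \ Q) h := by
    intro hcol
    obtain ⟨K, hK, hcard⟩ := exists_trim hm.crit.not_col
    have hxyc : (K.L x).card = (K.L y).card := by
      rw [hcard x (hQ.sub hx), hcard y (hQ.sub hy), hQ.eq_pred hm hx, hQ.eq_pred hm hy]
    obtain ⟨f, hf⟩ := hcol (K.withBlocks huw hxyc)
      fun v hv => (hcard v (mem_sdiff.1 hv).1).ge
    have hf' : IsCol G K (S \ Q) f := by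
      refine ⟨hf.1, fun s hs t ht hst hr => hf.2 s hs t ht (Or.inl hst) ?_⟩
      have h1 : ¬ (s = u ∧ t = w) := by
        rintro ⟨rfl, rfl⟩
        exact hn hst
      have h2 : ¬ (s = w ∧ t = u) := by
        rintro ⟨rfl, rfl⟩
        exact hn hst.symm
      simpa only [Cov.withBlocks, if_neg h1, if_neg h2] using hr
    refine hf.2 u hu w hw (Or.inr ?_) ?_
    · simp [SimpleGraph.edge_adj, huw]
    · simpa [Cov.withBlocks] using hQ.blocks hm hK hcard hf' hu hw hx hy hxy hxu hyw
  obtain ⟨A, hA, h', hh', hc⟩ := exists_crit (fun v hv => hm.le (mem_sdiff.1 hv).1) hnc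
  have hAS : A ⊂ S := hA.trans_ssubset hQ.sdiff_ssubset
  have hmem : u ∈ A ∧ w ∈ A := by
    by_contra hno
    refine hc.not_col fun K hK => ?_
    obtain ⟨f, hf⟩ := (hm.crit.minimal A hAS).mono (fun v _ => hh' v) K hK
    refine ⟨f, hf.1, fun s hs t ht hst => hf.2 s hs t ht ?_⟩
    rcases hst with hst | hst
    · exact hst
    · rw [SimpleGraph.edge_adj] at hst
      rcases hst.1 with ⟨rfl, rfl⟩ | ⟨rfl, rfl⟩
      · exact absurd ⟨hs, ht⟩ hno
      · exact absurd ⟨ht, hs⟩ hno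
  exact ⟨A, hA, h', hmem.1, hmem.2, hh', hc⟩

/-- `A` is a clique of size `k` that lacks the edge `uw`, and not many edges leave `A`. -/
structure NearClique (p : Par) (G : SimpleGraph V) (S : Finset V) (h : V → ℕ) (u w : V)
    (A : Finset V) : Prop where
  card : A.card = p.k
  adj : ∀ a ∈ A, ∀ b ∈ A, a ≠ b → G.Adj a b ∨ (a = u ∧ b = w) ∨ (a = w ∧ b = u)
  cut_le : cut G S A ≤ 4
  phi : p.phi G S h A = p.k + 2 * p.mu - (p.lam - p.mu) * ((cut G S A : ℝ) - 2) -
    (p.lam + p.mu) * ∑ v ∈ A, ((p.k : ℝ) - 1 - h v)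

theorem NearClique.symm {u w : V} {A : Finset V} (hA : NearClique p G S h u w A) :
    NearClique p G S h w u A :=
  ⟨hA.card, fun a ha b hb hab => (hA.adj a ha b hb hab).imp_right Or.symm, hA.cut_le, hA.phi⟩

theorem two_le_cut (hQ : LowClique p G S h Q) {u w x y : V} {A : Finset V} (hA : A ⊆ S \ Q)
    (huw : u ≠ w) (hx : x ∈ Q) (hy : y ∈ Q) (hxu : G.Adj x u) (hyw : G.Adj y w) (huA : u ∈ A)
    (hwA : w ∈ A) : 2 ≤ cut G S A := by
  have := card_le_cut (G := G) (S := S) (A := A) {(u, x), (w, y)} (by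
    simp only [mem_insert, mem_singleton, forall_eq_or_imp, forall_eq]
    exact ⟨⟨huA, hQ.sub hx, fun h => (mem_sdiff.1 (hA h)).2 hx, hxu.symm⟩,
      ⟨hwA, hQ.sub hy, fun h => (mem_sdiff.1 (hA h)).2 hy, hyw.symm⟩⟩)
  rwa [card_pair (by simp [huw])] at this

/-- The new edge is worth 2λ, and the edges `ux`, `wy` cost 2(λ - μ). Of the alternatives in `Good`,
the bound -2μ gives `phi ≤ 0`, the bound -2 leaves no room for a third edge, and K_k becomes the
near-clique. -/
theorem exists_of_not_adj (hm : MinCex p G S h) (hQ : LowClique p G S h Q) {u w x y : V}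
    (hu : u ∈ S \ Q) (hw : w ∈ S \ Q) (huw : u ≠ w) (hn : ¬ G.Adj u w) (hx : x ∈ Q) (hy : y ∈ Q)
    (hxu : G.Adj x u) (hyw : G.Adj y w) :
    ∃ A ⊆ S \ Q, u ∈ A ∧ w ∈ A ∧ (cut G S A = 2 ∨ NearClique p G S h u w A) := by
  obtain ⟨A, hA, h', huA, hwA, hh', hc⟩ :=
    hQ.exists_crit_of_not_adj hm hu hw huw hn hx hy hxu hyw
  refine ⟨A, hA, huA, hwA, ?_⟩
  have hAS : A ⊂ S := hA.trans_ssubset hQ.sdiff_ssubset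
  have hcut := hQ.two_le_cut hA huw hx hy hxu hyw huA hwA
  have hcut' : (2 : ℝ) ≤ cut G S A := by exact_mod_cast hcut
  have hphi := hm.phi_pos hAS hc.nonempty
  have heq := Par.phi_eq_pot (p := p) (G := G) (h := h) hAS.subset h'
  have hpot := Par.pot_sup_edge (p := p) (h := h') huA hwA huw hn
  have hgood := hm.ih _ A h' (card_lt_card hAS) hc
  have g1 := p.six_le
  have g2 := p.mu_le_two
  have g3 := p.one_lt_mu
  have g4 := p.five_le'
  have g5 := p.five_le
  have hsum : 0 ≤ ∑ v ∈ A, ((h' v : ℝ) - h v) := sum_nonneg fun v _ => by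
    have : (h v : ℝ) ≤ h' v := by exact_mod_cast hh' v
    linarith
  have hsum' : 0 ≤ (p.lam + p.mu) * ∑ v ∈ A, ((h' v : ℝ) - h v) :=
    mul_nonneg (by linarith) hsum
  have hf : 0 ≤ (p.lam - p.mu) * ((cut G S A : ℝ) - 2) := mul_nonneg (by linarith) (by linarith)
  rcases hgood with ⟨hcl, hcard, hk1⟩ | ⟨-, hle⟩ | ⟨-, hle⟩
  · right
    have hpk : p.pot (G ⊔ SimpleGraph.edge u w) A h' = p.k := by
      rw [Par.pot, sum_congr rfl (g := fun _ => (1 : ℝ)), sum_const, hcard, nsmul_eq_mul, mul_one]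
      intro v hv
      rw [Par.wt, dg_of_clique hcl hv, hcard, hk1 v hv, Nat.cast_sub (by omega)]
      push_cast
      ring
    have hsumk : ∑ v ∈ A, ((h' v : ℝ) - h v) = ∑ v ∈ A, ((p.k : ℝ) - 1 - h v) :=
      sum_congr rfl fun v hv => by
        rw [hk1 v hv, Nat.cast_sub (by omega)]
        push_cast
        ring
    have hcut4 : cut G S A ≤ 4 := by
      by_contra hlt
      have h5 : (5 : ℝ) ≤ cut G S A := by exact_mod_cast (by omega : 5 ≤ cut G S A)
      have h6 := p.add_le_three_mul
      have h7 : 0 ≤ (p.lam - p.mu) * ((cut G S A : ℝ) - 5) :=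
        mul_nonneg (by linarith) (by linarith)
      nlinarith
    refine ⟨hcard, fun a ha b hb hab => ?_, hcut4, ?_⟩
    · have := hcl ha hb hab
      rw [SimpleGraph.sup_adj, SimpleGraph.edge_adj] at this
      exact this.imp_right And.left
    · rw [heq, ← hsumk]
      linarith
  · left
    by_contra hne
    have h3 : (3 : ℝ) ≤ cut G S A := by exact_mod_cast (by omega : 3 ≤ cut G S A)
    nlinarith
  · exfalso
    nlinarith

end LowClique

/-! ### Outer neighbors are pairwise adjacent -/

namespace LowClique

variable {p : Par} {G : SimpleGraph V} {S : Finset V} {h : V → ℕ} {Q : Finset V}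

/-- Each of the k - 2 common neighbors of `u` and `v` in `A'` gives a path from `u` to `v` with an
edge that leaves `A`; `g` selects this edge. Two edges to `Q` are added. -/
theorem five_le_cut (hQ : LowClique p G S h Q) {u w v x y : V} {A A' : Finset V}
    (hA : A ⊆ S \ Q) (hA' : A' ⊆ S \ Q) (huw : u ≠ w) (hx : x ∈ Q) (hy : y ∈ Q)
    (hxu : G.Adj x u) (hyw : G.Adj y w) (huA : u ∈ A) (hwA : w ∈ A) (huv : u ≠ v) (hvA : v ∉ A)
    (huA' : u ∈ A') (hvA' : v ∈ A') (hn : NearClique p G S h u v A') : 5 ≤ cut G S A := by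
  have hk := p.five_le
  set Z := (A'.erase u).erase v with hZ
  have hZc : Z.card = p.k - 2 := by
    rw [hZ, card_erase_of_mem (mem_erase.2 ⟨huv.symm, hvA'⟩), card_erase_of_mem huA', hn.card]
    omega
  have hZm : ∀ r ∈ Z, r ∈ A' ∧ r ≠ u ∧ r ≠ v := fun r hr => by
    simp only [hZ, mem_erase] at hr
    exact ⟨hr.2.2, hr.2.1, hr.1⟩
  have hZu : ∀ r ∈ Z, G.Adj u r := fun r hr => by
    obtain ⟨h1, h2, h3⟩ := hZm r hr
    rcases hn.adj u huA' r h1 h2.symm with h | h | h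
    · exact h
    · exact absurd h.2 h3
    · exact absurd h.2 h2
  have hZv : ∀ r ∈ Z, G.Adj r v := fun r hr => by
    obtain ⟨h1, h2, h3⟩ := hZm r hr
    rcases hn.adj r h1 v hvA' h3 with h | h | h
    · exact h
    · exact absurd h.1 h2
    · exact absurd h.1 h3
  have hSQ : ∀ t, t ∈ Q → t ∉ S \ Q := fun t ht h => (mem_sdiff.1 h).2 ht
  set g : V → V × V := fun r => if r ∈ A then (r, v) else (u, r) with hg
  have hgQ : ∀ r ∈ Z, (g r).2 ∈ S \ Q := fun r hr => by
    simp only [hg]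
    split_ifs
    · exact hA' hvA'
    · exact hA' (hZm r hr).1
  have hginj : Set.InjOn g Z := by
    intro r hr r' hr' he
    have h1 := (hZm r hr).2
    have h2 := (hZm r' hr').2
    simp only [hg] at he
    split_ifs at he <;> simp only [Prod.mk.injEq] at he
    · exact he.1
    · exact absurd he.1 h1.1
    · exact absurd he.1.symm h2.1
    · exact he.2
  have hcard := card_le_cut (G := G) (S := S) (A := A) ({(u, x), (w, y)} ∪ Z.image g) (by
    intro e he
    rw [mem_union, mem_insert, mem_singleton, mem_image] at he
    rcases he with (rfl | rfl) | ⟨r, hr, rfl⟩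
    · exact ⟨huA, hQ.sub hx, fun h => hSQ x hx (hA h), hxu.symm⟩
    · exact ⟨hwA, hQ.sub hy, fun h => hSQ y hy (hA h), hyw.symm⟩
    · refine ⟨?_, (mem_sdiff.1 (hgQ r hr)).1, ?_, ?_⟩
      · simp only [hg]
        split_ifs with h
        exacts [h, huA]
      · simp only [hg]
        split_ifs with h
        exacts [hvA, h]
      · simp only [hg]
        split_ifs with h
        exacts [hZv r hr, hZu r hr])
  rw [card_union_of_disjoint, card_pair (by simp [huw]), card_image_of_injOn hginj, hZc] at hcard
  · omega
  · rw [disjoint_right]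
    intro e he
    rw [mem_image] at he
    obtain ⟨r, hr, rfl⟩ := he
    rw [mem_insert, mem_singleton, not_or]
    exact ⟨fun h => hSQ x hx (by have := hgQ r hr; rwa [h] at this),
      fun h => hSQ y hy (by have := hgQ r hr; rwa [h] at this)⟩

theorem exists_third (hQ : LowClique p G S h Q) (x y : V) : ∃ z ∈ Q, z ≠ x ∧ z ≠ y := by
  have hk := p.five_le
  have h2 : ({x, y} : Finset V).card < Q.card := by
    have := card_le_two (a := x) (b := y)
    rw [hQ.card]
    omega
  obtain ⟨z, hz, hzn⟩ := exists_mem_notMem_of_card_lt_card h2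
  rw [mem_insert, mem_singleton, not_or] at hzn
  exact ⟨z, hz, hzn⟩

/-- If only two edges leave `A`, the outer neighbor `v` of a third vertex of `Q` is neither in `A`
nor adjacent to `u`. The set `A'` for `u`, `v` also has cut 2, by `five_le_cut`. But at least three
edges leave the union and two the intersection, against submodularity. -/
theorem exists_nearClique (hm : MinCex p G S h) (hQ : LowClique p G S h Q) {u w x y : V}
    (hu : u ∈ S \ Q) (hw : w ∈ S \ Q) (huw : u ≠ w) (hn : ¬ G.Adj u w) (hx : x ∈ Q) (hy : y ∈ Q)
    (hxu : G.Adj x u) (hyw : G.Adj y w) :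
    ∃ A ⊆ S \ Q, u ∈ A ∧ w ∈ A ∧ NearClique p G S h u w A := by
  obtain ⟨A, hA, huA, hwA, hcase⟩ := hQ.exists_of_not_adj hm hu hw huw hn hx hy hxu hyw
  refine ⟨A, hA, huA, hwA, hcase.resolve_left fun hcut => ?_⟩
  have hSQ : ∀ t, t ∈ Q → t ∉ S \ Q := fun t ht h => (mem_sdiff.1 h).2 ht
  obtain ⟨z, hz, hzx, hzy⟩ := hQ.exists_third x y
  obtain ⟨v, hv, hzv⟩ := hQ.exists_adj hm hz
  have hxy : x ≠ y := by
    rintro rfl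
    exact huw (hQ.adj_unique hm hx hu hw hxu hyw)
  have hout : ∀ B ⊆ S \ Q, ∀ t ∈ Q, t ∉ B := fun B hB t ht h => hSQ t ht (hB h)
  have hthree : ∀ B ⊆ S \ Q, u ∈ B → w ∈ B → v ∈ B → 3 ≤ cut G S B := by
    intro B hB huB hwB hvB
    have := card_le_cut (G := G) (S := S) (A := B) {(u, x), (w, y), (v, z)} (by
      simp only [mem_insert, mem_singleton, forall_eq_or_imp, forall_eq]
      exact ⟨⟨huB, hQ.sub hx, hout B hB x hx, hxu.symm⟩, ⟨hwB, hQ.sub hy, hout B hB y hy, hyw.symm⟩,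
        ⟨hvB, hQ.sub hz, hout B hB z hz, hzv.symm⟩⟩)
    rwa [card_eq_three.2 ⟨_, _, _, by simp [hxy], by simp [hzx.symm], by simp [hzy.symm], rfl⟩]
      at this
  have hvA : v ∉ A := fun hvA => by
    have := hthree A hA huA hwA hvA
    omega
  have huv : u ≠ v := fun h => hvA (h ▸ huA)
  have hnuv : ¬ G.Adj u v := fun hadj => by
    have := card_le_cut (G := G) (S := S) (A := A) {(u, x), (w, y), (u, v)} (by
      simp only [mem_insert, mem_singleton, forall_eq_or_imp, forall_eq]
      exact ⟨⟨huA, hQ.sub hx, hout A hA x hx, hxu.symm⟩,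
        ⟨hwA, hQ.sub hy, hout A hA y hy, hyw.symm⟩, ⟨huA, (mem_sdiff.1 hv).1, hvA, hadj⟩⟩)
    rw [card_eq_three.2 ⟨_, _, _, by simp [hxy], ?_, by simp [huw.symm], rfl⟩] at this
    · omega
    · simp only [ne_eq, Prod.mk.injEq, true_and]
      rintro rfl
      exact hSQ x hx hv
  obtain ⟨A', hA', huA', hvA', hcase'⟩ := hQ.exists_of_not_adj hm hu hv huv hnuv hx hz hxu hzv
  rcases hcase' with hcut' | hnear
  · have h1 := cut_union_add_cut_inter_le (G := G) (hA.trans sdiff_subset) (hA'.trans sdiff_subset)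
    have h2 := hthree (A ∪ A') (union_subset hA hA') (mem_union_left _ huA) (mem_union_left _ hwA)
      (mem_union_right _ hvA')
    have h3 := hm.two_le_cut (I := A ∩ A')
      ((inter_subset_left.trans hA).trans_ssubset hQ.sdiff_ssubset)
      ⟨u, mem_inter.2 ⟨huA, huA'⟩⟩
    omega
  · have := hQ.five_le_cut hA hA' huw hx hy hxu hyw huA hwA huv hvA huA' hvA' hnear
    omega

theorem adj_of_notMem (hm : MinCex p G S h) (hQ : LowClique p G S h Q) {u w v x y z : V}
    {A : Finset V} (hA : A ⊆ S \ Q) (hnear : NearClique p G S h u w A) (huw : u ≠ w)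
    (hx : x ∈ Q) (hy : y ∈ Q) (hz : z ∈ Q) (hxu : G.Adj x u) (hyw : G.Adj y w) (hzv : G.Adj z v)
    (huA : u ∈ A) (hwA : w ∈ A) (hv : v ∈ S \ Q) (hvA : v ∉ A) : G.Adj u v := by
  by_contra hn
  have huv : u ≠ v := fun h => hvA (h ▸ huA)
  obtain ⟨A', hA', huA', hvA', hnear'⟩ :=
    hQ.exists_nearClique hm (hA huA) hv huv hn hx hz hxu hzv
  have := hQ.five_le_cut hA hA' huw hx hy hxu hyw huA hwA huv hvA huA' hvA' hnear'
  have := hnear.cut_le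
  omega

theorem phi_eq (hm : MinCex p G S h) (hQ : LowClique p G S h Q) :
    p.phi G S h Q = (p.k - 1) * (1 + p.mu) := by
  have hk := p.five_le
  rw [Par.phi, sum_congr rfl (g := fun _ => 1 + p.mu), sum_const, hQ.card, nsmul_eq_mul,
    Nat.cast_sub (by omega)]
  · push_cast
    ring
  · intro x hx
    rw [Par.wt, hQ.low x hx, hQ.eq_pred hm hx, hQ.dg_eq_one hm hx, Nat.cast_sub (by omega)]
    push_cast
    ring

theorem disjoint_of_subset (hA : A ⊆ S \ Q) : Disjoint A Q :=
  disjoint_of_subset_left hA sdiff_disjoint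

/-- Otherwise at least k - 1 edges leave `A`, so k = 5 and the cut is 4. Then `phi` of `A ∪ Q` is at
most 1 + 12 - 16 = -3, too small also if the union is `S`. -/
theorem exists_notMem_nearClique (hm : MinCex p G S h) (hQ : LowClique p G S h Q) {u w : V}
    {A : Finset V} (hA : A ⊆ S \ Q) (huA : u ∈ A) (hnear : NearClique p G S h u w A) :
    ∃ z ∈ Q, ∃ v ∈ S \ Q, G.Adj z v ∧ v ∉ A := by
  by_contra hno
  push Not at hno
  have hk := p.five_le
  have hk' := p.five_le'
  have hAS : A ⊂ S := hA.trans_ssubset hQ.sdiff_ssubset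
  have hSQ : ∀ t, t ∈ Q → t ∉ S \ Q := fun t ht h => (mem_sdiff.1 h).2 ht
  have hone : ∀ z ∈ Q, dg G A z = 1 := by
    intro z hz
    refine le_antisymm ((dg_mono hA z).trans (hQ.dg_eq_one hm hz).le) ?_
    obtain ⟨v, hv, hzv⟩ := hQ.exists_adj hm hz
    exact dg_pos_iff.2 ⟨v, hno z hz v hv hzv, hzv⟩
  have hsumQ : ∑ v ∈ A, dg G Q v = p.k - 1 := by
    rw [sum_dg_comm, sum_congr rfl hone, sum_const, hQ.card, smul_eq_mul, mul_one]
  have hcut : p.k - 1 ≤ cut G S A := by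
    rw [← hsumQ, cut]
    refine sum_le_sum fun v _ => dg_mono (fun t ht => ?_) v
    exact mem_sdiff.2 ⟨hQ.sub ht, fun h => hSQ t ht (hA h)⟩
  have hcut4 := hnear.cut_le
  have h5 : p.k = 5 := by omega
  have hc4 : cut G S A = 4 := by omega
  have hmu := p.mu_five h5
  have hlam := p.lam_five h5
  have hphi := hnear.phi
  have hpos := hm.phi_pos hAS ⟨u, huA⟩
  have hdef : ∀ v ∈ A, (0 : ℝ) ≤ (p.k : ℝ) - 1 - h v := fun v hv => by
    have : (h v : ℝ) + 1 ≤ p.k := by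
      have := hm.le (hAS.subset hv)
      exact_mod_cast (by omega : h v + 1 ≤ p.k)
    linarith
  have hdefsum := sum_nonneg hdef
  rw [hphi, hc4, hmu, hlam, h5] at hpos
  push_cast at hpos
  rw [hc4, hmu, hlam, h5] at hphi
  push_cast at hphi
  have hunion := Par.phi_union (p := p) (G := G) (h := h) hAS.subset hQ.sub (disjoint_of_subset hA)
  have hsumQ' : ∑ v ∈ A, (dg G Q v : ℝ) = 4 := by
    have : ∑ v ∈ A, dg G Q v = 4 := by omega
    exact_mod_cast this
  rw [hQ.phi_eq hm, hsumQ', hphi, hmu, h5] at hunion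
  push_cast at hunion
  rw [h5] at hdefsum
  push_cast at hdefsum
  by_cases hS : A ∪ Q = S
  · have h0 : ∀ v ∈ S, h v = p.k - 1 := by
      intro v hv
      rw [← hS, mem_union] at hv
      rcases hv with hv | hv
      · by_contra hne
        have h1 := hm.le (hAS.subset hv)
        have h2 := single_le_sum hdef hv
        have h3 : (h v : ℝ) ≤ 3 := by exact_mod_cast (by omega : h v ≤ 3)
        rw [h5] at h2
        push_cast at h2
        linarith
      · exact hQ.eq_pred hm hv
    have h1 := hm.lt_pot_of_eq h0
    rw [hS, Par.phi_self] at hunion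
    linarith
  · have h1 := hm.phi_pos (ssubset_of_subset_of_ne (union_subset hAS.subset hQ.sub) hS)
      ⟨u, mem_union_left _ huA⟩
    linarith

/-- The vertices with neighbors in `Q` are pairwise adjacent. -/
theorem adj_of_outer (hm : MinCex p G S h) (hQ : LowClique p G S h Q) {u w x y : V}
    (hu : u ∈ S \ Q) (hw : w ∈ S \ Q) (huw : u ≠ w) (hx : x ∈ Q) (hy : y ∈ Q)
    (hxu : G.Adj x u) (hyw : G.Adj y w) : G.Adj u w := by
  classical
  by_contra hn
  have hk := p.five_le
  have hk' := p.five_le'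
  obtain ⟨A, hA, huA, hwA, hnear⟩ := hQ.exists_nearClique hm hu hw huw hn hx hy hxu hyw
  have hAS : A ⊂ S := hA.trans_ssubset hQ.sdiff_ssubset
  have hSQ : ∀ t, t ∈ Q → t ∉ S \ Q := fun t ht h => (mem_sdiff.1 h).2 ht
  have hxy : x ≠ y := by
    rintro rfl
    exact huw (hQ.adj_unique hm hx hu hw hxu hyw)
  obtain ⟨z, hz, v, hv, hzv, hvA⟩ := hQ.exists_notMem_nearClique hm hA huA hnear
  have hadj : ∀ z' ∈ Q, ∀ v' ∈ S \ Q, G.Adj z' v' → v' ∉ A → G.Adj u v' ∧ G.Adj w v' := by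
    intro z' hz' v' hv' hzv' hvA'
    exact ⟨hQ.adj_of_notMem hm hA hnear huw hx hy hz' hxu hyw hzv' huA hwA hv' hvA',
      hQ.adj_of_notMem hm hA hnear.symm huw.symm hy hx hz' hyw hxu hzv' hwA huA hv' hvA'⟩
  obtain ⟨huv, hwv⟩ := hadj z hz v hv hzv hvA
  have hvQ : v ∉ Q := (mem_sdiff.1 hv).2
  have hxv : x ≠ v := fun h => hvQ (h ▸ hx)
  have hyv : y ≠ v := fun h => hvQ (h ▸ hy)
  have hfour : ∀ e ∈ ({(u, x), (w, y), (u, v), (w, v)} : Finset (V × V)),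
      e.1 ∈ A ∧ e.2 ∈ S ∧ e.2 ∉ A ∧ G.Adj e.1 e.2 := by
    simp only [mem_insert, mem_singleton, forall_eq_or_imp, forall_eq]
    exact ⟨⟨huA, hQ.sub hx, fun h => hSQ x hx (hA h), hxu.symm⟩,
      ⟨hwA, hQ.sub hy, fun h => hSQ y hy (hA h), hyw.symm⟩,
      ⟨huA, (mem_sdiff.1 hv).1, hvA, huv⟩, ⟨hwA, (mem_sdiff.1 hv).1, hvA, hwv⟩⟩
  have hfourcard : ({(u, x), (w, y), (u, v), (w, v)} : Finset (V × V)).card = 4 := by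
    rw [card_insert_of_notMem (by simp [huw, hxv]), card_insert_of_notMem (by simp [huw.symm, hyv]),
      card_pair (by simp [huw])]
  -- These four are all the leaving edges, so every vertex of `Q` other than `x` and `y` has `v` as
  -- its outer neighbor.
  have hcut4 : cut G S A = 4 := by
    have := card_le_cut _ hfour
    have := hnear.cut_le
    omega
  have hno5 : ∀ a ∈ A, ∀ b ∈ S, b ∉ A → G.Adj a b →
      (a, b) ∈ ({(u, x), (w, y), (u, v), (w, v)} : Finset (V × V)) := by
    intro a ha b hb hbA hab
    by_contra hnot
    have := card_le_cut (G := G) (S := S) (A := A)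
      (insert (a, b) {(u, x), (w, y), (u, v), (w, v)}) (by
        intro e he
        rw [mem_insert] at he
        rcases he with rfl | he
        · exact ⟨ha, hb, hbA, hab⟩
        · exact hfour e he)
    rw [card_insert_of_notMem hnot, hfourcard] at this
    omega
  have hall : ∀ t ∈ (Q.erase x).erase y, G.Adj v t := by
    intro t ht
    simp only [mem_erase] at ht
    obtain ⟨v', hv', htv'⟩ := hQ.exists_adj hm ht.2.2
    have htv : t ≠ v := fun h => hvQ (h ▸ ht.2.2)
    have hv'A : v' ∉ A := fun hv'A => by
      have := hno5 v' hv'A t (hQ.sub ht.2.2) (fun h => hSQ t ht.2.2 (hA h)) htv'.symm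
      simp [ht.1, ht.2.1, htv] at this
    have h1 := hno5 u huA v' (mem_sdiff.1 hv').1 hv'A (hadj t ht.2.2 v' hv' htv' hv'A).1
    have hv'x : v' ≠ x := fun h => (mem_sdiff.1 hv').2 (h ▸ hx)
    simp only [mem_insert, mem_singleton, Prod.mk.injEq, huw, true_and, false_and, or_false,
      false_or, hv'x] at h1
    rw [← h1]
    exact htv'.symm
  have hdv : p.k - 3 ≤ dg G Q v := by
    have h1 : ((Q.erase x).erase y).card = p.k - 3 := by
      rw [card_erase_of_mem (mem_erase.2 ⟨hxy.symm, hy⟩), card_erase_of_mem hx, hQ.card]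
      omega
    rw [← h1, dg]
    refine card_le_card fun t ht => ?_
    rw [mem_filter]
    exact ⟨mem_of_mem_erase (mem_of_mem_erase ht), hall t ht⟩
  have hdv' : (p.k : ℝ) - 3 ≤ dg G Q v := by
    have : p.k ≤ dg G Q v + 3 := by omega
    have : (p.k : ℝ) ≤ dg G Q v + 3 := by exact_mod_cast this
    linarith
  have htv := hQ.add_dg_le hm hv hz hzv
  have htv' : (h v : ℝ) + dg G Q v ≤ dg G S v + 1 := by exact_mod_cast htv
  have hhv : (h v : ℝ) + 1 ≤ p.k := by
    have := hm.le (mem_sdiff.1 hv).1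
    exact_mod_cast (by omega : h v + 1 ≤ p.k)
  have hg1 := p.six_le
  have hg2 := p.mu_le_two
  have hg3 := p.one_lt_mu
  have hg4 := p.mu_mul
  have hvS : v ∈ S := (mem_sdiff.1 hv).1
  have hAQS : A ∪ Q ⊆ S := union_subset hAS.subset hQ.sub
  have hd2 : Disjoint (A ∪ Q) {v} := by
    rw [disjoint_singleton_right, mem_union, not_or]
    exact ⟨hvA, hvQ⟩
  have e1 := Par.phi_union (p := p) (G := G) (h := h) hAS.subset hQ.sub (disjoint_of_subset hA)
  have e2 := Par.phi_union (p := p) (G := G) (h := h) hAQS (singleton_subset_iff.2 hvS) hd2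
  have e3 := hm.lt_phi (union_subset hAQS (singleton_subset_iff.2 hvS))
    ⟨v, mem_union_right _ (mem_singleton_self v)⟩
  have hs1 : (2 : ℝ) ≤ ∑ t ∈ A, (dg G Q t : ℝ) := by
    have h1 : dg G Q u + dg G Q w ≤ ∑ t ∈ A, dg G Q t := by
      rw [← sum_pair huw]
      exact sum_le_sum_of_subset (insert_subset huA (singleton_subset_iff.2 hwA))
    have h2 : 0 < dg G Q u := dg_pos_iff.2 ⟨x, hx, hxu.symm⟩
    have h3 : 0 < dg G Q w := dg_pos_iff.2 ⟨y, hy, hyw.symm⟩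
    exact_mod_cast (by omega : 2 ≤ ∑ t ∈ A, dg G Q t)
  have hs2 : (p.k : ℝ) - 1 ≤ ∑ t ∈ A ∪ Q, (dg G {v} t : ℝ) := by
    have h1 : ∑ t ∈ A ∪ Q, dg G {v} t = dg G (A ∪ Q) v := by
      rw [sum_dg_comm, sum_singleton]
    have h2 : dg G (A ∪ Q) v = dg G A v + dg G Q v := dg_union (disjoint_of_subset hA) v
    have h3 : 2 ≤ dg G A v := by
      rw [← card_pair huw, dg]
      refine card_le_card fun t ht => ?_
      rw [mem_insert, mem_singleton] at ht
      rw [mem_filter]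
      rcases ht with rfl | rfl
      · exact ⟨huA, huv.symm⟩
      · exact ⟨hwA, hwv.symm⟩
    have h4 : p.k ≤ (∑ t ∈ A ∪ Q, dg G {v} t) + 1 := by omega
    have h5 : (p.k : ℝ) ≤ (∑ t ∈ A ∪ Q, (dg G {v} t : ℝ)) + 1 := by exact_mod_cast h4
    linarith
  have hphiA : p.phi G S h A ≤ p.k + 2 * p.mu - (p.lam - p.mu) * 2 := by
    rw [hnear.phi, hcut4]
    have : 0 ≤ (p.lam + p.mu) * ∑ v ∈ A, ((p.k : ℝ) - 1 - h v) := by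
      refine mul_nonneg (by linarith) (sum_nonneg fun t ht => ?_)
      have : (h t : ℝ) + 1 ≤ p.k := by
        have := hm.le (hAS.subset ht)
        exact_mod_cast (by omega : h t + 1 ≤ p.k)
      linarith
    push_cast
    linarith
  have hphiv : p.phi G S h {v} ≤ 1 - (p.lam - p.mu) * (p.k - 4) + p.mu * (p.k - 1) := by
    rw [Par.phi_singleton, Par.wt]
    have h1 : 0 ≤ (p.lam - p.mu) * ((dg G S v : ℝ) - h v - (p.k - 4)) :=
      mul_nonneg (by linarith) (by linarith)
    have h2 : 0 ≤ p.mu * (p.k - 1 - h v) := mul_nonneg (by linarith) (by linarith)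
    linarith
  have hphiQ := hQ.phi_eq hm
  have m1 : 2 * p.mu * 2 ≤ 2 * p.mu * ∑ t ∈ A, (dg G Q t : ℝ) :=
    mul_le_mul_of_nonneg_left hs1 (by linarith)
  have m2 : 2 * p.mu * (p.k - 1) ≤ 2 * p.mu * ∑ t ∈ A ∪ Q, (dg G {v} t : ℝ) :=
    mul_le_mul_of_nonneg_left hs2 (by linarith)
  -- The bounds for `phi` of `A ∪ Q ∪ {v}` add up to 2k - 2μ - (λ - μ)(k - 2), which is now at most
  -- -2μ.
  have m3 : 2 * (p.k : ℝ) ≤ (p.lam - p.mu) * (p.k - 2) := by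
    rcases (show p.k = 5 ∨ 6 ≤ p.k by omega) with h5 | h6
    · rw [h5, p.mu_five h5]
      push_cast
      linarith
    · have h6' : (6 : ℝ) ≤ p.k := by exact_mod_cast h6
      have hmu : p.mu ≤ 5 / 3 := by nlinarith
      have : (13 / 3) * ((p.k : ℝ) - 2) ≤ (p.lam - p.mu) * (p.k - 2) :=
        mul_le_mul_of_nonneg_right (by linarith) (by linarith)
      linarith
  nlinarith

end LowClique

/-! ### Cliques of outer neighbors and the exception k = 5 -/

namespace Par

variable (p : Par)

/-- Makes `phi` of `Q` with its `j` outer neighbors nonpositive, where (k - 1)(1 - μ) = -2μ. -/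
theorem clique_bound {j : ℕ} (hj : 3 ≤ j) (hjk : j + 1 ≤ p.k) :
    j + p.mu * (j * (p.k - j)) ≤ 2 * p.mu + (p.lam - p.mu) * (p.k - 2) := by
  have h1 := p.five_le'
  have h2 := p.mu_mul
  have h3 := p.six_le
  have h4 := p.le_lam
  have hk := p.five_le
  have h6 := p.one_lt_mu
  by_cases h5 : p.k = 5
  · rw [p.mu_five h5, h5, p.lam_five h5]
    push_cast
    obtain rfl | rfl : j = 3 ∨ j = 4 := by omega
    · norm_num
    · norm_num
  have hj' : (0 : ℝ) ≤ j := Nat.cast_nonneg j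
  have h7 : (p.k : ℝ) / 2 + 7 / 4 ≤ p.lam := by
    by_contra hlt
    push Not at hlt
    nlinarith
  -- First `1 ≤ μ` absorbs the summand `j`, then j(k + 1 - j) is at most ((k + 1)/2)^2.
  have e1 : j + p.mu * (j * (p.k - j)) ≤ p.mu * (j * (p.k + 1 - j)) := by nlinarith
  have e2 : p.mu * ((j : ℝ) * (p.k + 1 - j)) ≤ p.mu * ((p.k + 1) ^ 2 / 4) := by
    refine mul_le_mul_of_nonneg_left ?_ (by linarith)
    nlinarith [sq_nonneg (2 * (j : ℝ) - (p.k + 1))]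
  have e3 : p.mu * ((p.k + 1) ^ 2 / 4 + p.k - 4) ≤ p.lam * (p.k - 2) := by
    have hpos : (0 : ℝ) < p.k - 3 := by linarith
    refine le_of_mul_le_mul_right ?_ hpos
    have e4 : p.mu * (((p.k : ℝ) + 1) ^ 2 / 4 + p.k - 4) * (p.k - 3) =
        (p.k - 1) * ((p.k + 1) ^ 2 / 4 + p.k - 4) := by
      rw [← h2]
      ring
    rw [e4]
    rcases (show p.k = 6 ∨ p.k = 7 ∨ 8 ≤ p.k by omega) with h | h | h
    · rw [h]
      push_cast
      linarith
    · rw [h]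
      push_cast
      linarith
    · have h8 : (8 : ℝ) ≤ p.k := by exact_mod_cast h
      have e5 : ((p.k : ℝ) / 2 + 7 / 4) * ((p.k - 2) * (p.k - 3)) ≤
          p.lam * ((p.k - 2) * (p.k - 3)) :=
        mul_le_mul_of_nonneg_right h7 (mul_nonneg (by linarith) (by linarith))
      obtain ⟨m, hm⟩ : ∃ m : ℝ, (p.k : ℝ) = m + 8 := ⟨p.k - 8, by ring⟩
      have hm0 : 0 ≤ m := by linarith
      rw [hm] at e5 ⊢
      have := pow_nonneg hm0 3
      have := pow_nonneg hm0 2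
      nlinarith
  nlinarith

end Par

/-- The exceptional cliques, which have precisely two outer neighbors `u` and `w`. -/
structure Special (G : SimpleGraph V) (S : Finset V) (h : V → ℕ) (Q : Finset V) (u w : V) :
    Prop where
  hu : u ∈ S \ Q
  hw : w ∈ S \ Q
  adj : G.Adj u w
  hu4 : h u = 4
  hw4 : h w = 4
  dgu : dg G S u = dg G Q u + 3
  dgw : dg G S w = dg G Q w + 3
  sum : dg G Q u + dg G Q w = 4
  posu : 0 < dg G Q u
  posw : 0 < dg G Q w
  outer : ∀ x ∈ Q, ∀ v ∈ S \ Q, G.Adj x v → v = u ∨ v = w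

namespace LowClique

variable {p : Par} {G : SimpleGraph V} {S : Finset V} {h : V → ℕ} {Q : Finset V}

/-- The outer neighbors form a clique `N` of at least two vertices. If there are three or more, at
most one has slack `t` less than 1, and `phi` of `Q ∪ N`, or the potential if this is `S`, is too
small. With two of them only k = 5 survives, where `phi = 2 - 4T - 4D` must be positive: no slack
and no deficiency in `N`. -/
theorem special (hm : MinCex p G S h) (hQ : LowClique p G S h Q) :
    p.k = 5 ∧ (∃ v ∈ S, h v < p.k - 1) ∧ ∃ u w, Special G S h Q u w := by
  classical
  have hk := p.five_le
  have hk' := p.five_le'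
  have hg1 := p.six_le
  have hg2 := p.mu_le_two
  have hg3 := p.one_lt_mu
  have hg4 := p.mu_mul
  set N := (S \ Q).filter fun u => ∃ x ∈ Q, G.Adj x u with hN
  have hNS : N ⊆ S \ Q := filter_subset _ _
  have hmemN : ∀ u ∈ N, ∃ x ∈ Q, G.Adj x u := fun u hu => (mem_filter.1 hu).2
  have hNadj : G.IsClique (N : Set V) := by
    intro u hu w hw huw
    obtain ⟨x, hx, hxu⟩ := hmemN u hu
    obtain ⟨y, hy, hyw⟩ := hmemN w hw
    exact hQ.adj_of_outer hm (hNS hu) (hNS hw) huw hx hy hxu hyw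
  have hsumN : ∑ u ∈ N, dg G Q u = p.k - 1 := by
    rw [sum_dg_comm, sum_congr rfl (g := fun _ => 1), sum_const, hQ.card, smul_eq_mul, mul_one]
    intro x hx
    refine le_antisymm ((dg_mono hNS x).trans (hQ.dg_eq_one hm hx).le) ?_
    obtain ⟨v, hv, hxv⟩ := hQ.exists_adj hm hx
    exact dg_pos_iff.2 ⟨v, mem_filter.2 ⟨hv, x, hx, hxv⟩, hxv⟩
  have hpos : ∀ u ∈ N, 0 < dg G Q u := fun u hu => by
    obtain ⟨x, hx, hxu⟩ := hmemN u hu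
    exact dg_pos_iff.2 ⟨x, hx, hxu.symm⟩
  have hcardle : N.card ≤ p.k - 1 := by
    rw [← hsumN, card_eq_sum_ones]
    exact sum_le_sum fun u hu => hpos u hu
  have hcard2 : 2 ≤ N.card := by
    have hQne : Q.Nonempty := card_pos.1 (by rw [hQ.card]; omega)
    obtain ⟨x, hx⟩ := hQne
    obtain ⟨u, hu, hxu⟩ := hQ.exists_adj hm hx
    obtain ⟨y, hy, hyu⟩ := hQ.exists_not_adj hm hu
    obtain ⟨w, hw, hyw⟩ := hQ.exists_adj hm hy
    refine one_lt_card.2 ⟨u, mem_filter.2 ⟨hu, x, hx, hxu⟩, w, mem_filter.2 ⟨hw, y, hy, hyw⟩, ?_⟩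
    rintro rfl
    exact hyu hyw
  set t : V → ℝ := fun u => (dg G S u : ℝ) - h u - dg G Q u + 1 with ht
  have ht0 : ∀ u ∈ N, 0 ≤ t u := fun u hu => by
    obtain ⟨x, hx, hxu⟩ := hmemN u hu
    have : (h u : ℝ) + dg G Q u ≤ dg G S u + 1 := by
      exact_mod_cast hQ.add_dg_le hm (hNS hu) hx hxu
    simp only [ht]
    linarith
  have htight : ∀ u ∈ N, t u < 1 → dg G S u + 1 ≤ h u + dg G Q u := fun u _ htu => by
    simp only [ht] at htu
    have : (dg G S u : ℝ) < h u + dg G Q u := by linarith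
    have : dg G S u < h u + dg G Q u := by exact_mod_cast this
    omega
  have hdef0 : ∀ u ∈ N, (0 : ℝ) ≤ (p.k : ℝ) - 1 - h u := fun u hu => by
    have : (h u : ℝ) + 1 ≤ p.k := by
      have := hm.le (mem_sdiff.1 (hNS hu)).1
      exact_mod_cast (by omega : h u + 1 ≤ p.k)
    linarith
  set T := ∑ u ∈ N, t u with hT
  set D := ∑ u ∈ N, ((p.k : ℝ) - 1 - h u) with hD
  have hT0 : 0 ≤ T := sum_nonneg ht0
  have hD0 : 0 ≤ D := sum_nonneg hdef0
  have hNS' : N ⊆ S := hNS.trans sdiff_subset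
  have hd : Disjoint Q N := (disjoint_of_subset hNS).symm
  have hsumN' : ∑ u ∈ N, (dg G Q u : ℝ) = p.k - 1 := by
    have : ((p.k - 1 : ℕ) : ℝ) = p.k - 1 := by
      rw [Nat.cast_sub (by omega)]
      simp
    rw [← this, ← hsumN]
    push_cast
    rfl
  have hphiN : p.phi G S h N = N.card - (p.lam - p.mu) * (p.k - 1 - N.card + T) +
      p.mu * (N.card * (p.k - N.card)) - 2 * p.mu * D := by
    have h1 : ∀ u ∈ N, p.wt G S h u + p.mu * dg G (S \ N) u =
        (1 + (p.lam - p.mu) + p.mu * (p.k - N.card)) - (p.lam - p.mu) * dg G Q u -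
          (p.lam - p.mu) * t u - 2 * p.mu * (p.k - 1 - h u) := by
      intro u hu
      have e1 := dg_sdiff (G := G) hNS' u
      rw [dg_of_clique hNadj hu] at e1
      have e2 : (dg G S u : ℝ) = N.card - 1 + dg G (S \ N) u := by
        rw [e1]
        push_cast [Nat.cast_sub (show 1 ≤ N.card by omega)]
        ring
      have e3 : (dg G (S \ N) u : ℝ) = dg G S u - (N.card - 1) := by linarith
      rw [e3, Par.wt, ht]
      ring
    rw [Par.phi, sum_congr rfl h1, sum_sub_distrib, sum_sub_distrib, sum_sub_distrib, ← mul_sum,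
      ← mul_sum, ← mul_sum, hsumN', ← hT, ← hD, sum_const, nsmul_eq_mul]
    ring
  have hunion := Par.phi_union (p := p) (G := G) (h := h) hQ.sub hNS' hd
  have hsumQ : ∑ x ∈ Q, (dg G N x : ℝ) = p.k - 1 := by
    rw [← hsumN']
    exact_mod_cast sum_dg_comm G Q N
  rw [hsumQ, hQ.phi_eq hm, hphiN] at hunion
  have hQNS : Q ∪ N ⊆ S := union_subset hQ.sub hNS'
  have hQNne : (Q ∪ N).Nonempty := (card_pos.1 (show 0 < N.card by omega)).mono subset_union_right
  have hpot : Q ∪ N = S → p.pot G S h =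
      p.k - 1 + N.card - p.lam * (p.k - 1 - N.card + T) - p.mu * D := by
    intro hS
    have hwQ : ∑ x ∈ Q, p.wt G S h x = p.k - 1 := by
      rw [sum_congr rfl (g := fun _ => (1 : ℝ)), sum_const, hQ.card, nsmul_eq_mul, mul_one,
        Nat.cast_sub (by omega)]
      · simp
      · intro x hx
        rw [Par.wt, hQ.low x hx, hQ.eq_pred hm hx, Nat.cast_sub (by omega)]
        push_cast
        ring
    have hwN : ∀ u ∈ N, p.wt G S h u =
        (1 + p.lam) - p.lam * dg G Q u - p.lam * t u - p.mu * (p.k - 1 - h u) := by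
      intro u _
      rw [Par.wt, ht]
      ring
    have hsplit : p.pot G S h = ∑ x ∈ Q, p.wt G S h x + ∑ x ∈ N, p.wt G S h x := by
      rw [← sum_union hd, hS, Par.pot]
    rw [hsplit, hwQ, sum_congr rfl hwN, sum_sub_distrib, sum_sub_distrib, sum_sub_distrib,
      ← mul_sum, ← mul_sum, ← mul_sum, hsumN', ← hT, ← hD, sum_const, nsmul_eq_mul]
    ring
  have hcardle' : (N.card : ℝ) + 1 ≤ p.k := by
    exact_mod_cast (by omega : N.card + 1 ≤ p.k)
  have hcard2' : (2 : ℝ) ≤ N.card := by exact_mod_cast hcard2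
  have hlt := hm.lt_pot
  by_cases hcard3 : 3 ≤ N.card
  · exfalso
    have hTge : (N.card : ℝ) - 1 ≤ T := by
      by_cases hex : ∃ u ∈ N, t u < 1
      · obtain ⟨u, hu, htu⟩ := hex
        have hge : ∀ w ∈ N.erase u, 1 ≤ t w := by
          intro w hw
          by_contra htw
          push Not at htw
          obtain ⟨hwu, hw⟩ := mem_erase.1 hw
          obtain ⟨v, hv, hvn⟩ := exists_mem_notMem_of_card_lt_card
            (show ({u, w} : Finset V).card < N.card by
              have := card_le_two (a := u) (b := w)
              omega)
          rw [mem_insert, mem_singleton, not_or] at hvn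
          obtain ⟨x, hx, hxu⟩ := hmemN u hu
          obtain ⟨z, hz, hzv⟩ := hmemN v hv
          exact hQ.not_both_tight hm (hNS hu) (hNS hw) (hNS hv) (hNadj hu hw hwu.symm) hvn.1 hvn.2
            hx hz hxu hzv (htight u hu htu) (htight w hw htw)
        have h1 := card_nsmul_le_sum _ _ _ hge
        rw [card_erase_of_mem hu, nsmul_eq_mul, mul_one, Nat.cast_sub (by omega)] at h1
        have h2 := add_sum_erase N t hu
        have h3 := ht0 u hu
        push_cast at h1
        linarith
      · push Not at hex
        have h1 := card_nsmul_le_sum _ _ _ hex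
        rw [nsmul_eq_mul, mul_one] at h1
        linarith
    have hm1 : 0 ≤ p.mu * D := mul_nonneg (by linarith) hD0
    by_cases hS : Q ∪ N = S
    · have h1 := hpot hS
      have h2 : p.lam * (p.k - 2) ≤ p.lam * (p.k - 1 - N.card + T) :=
        mul_le_mul_of_nonneg_left (by linarith) (by linarith)
      have h3 : 6 * ((p.k : ℝ) - 2) ≤ p.lam * (p.k - 2) :=
        mul_le_mul_of_nonneg_right hg1 (by linarith)
      linarith
    · have h1 := hm.phi_pos (ssubset_of_subset_of_ne hQNS hS) hQNne
      have h2 := p.clique_bound hcard3 (by omega)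
      have h3 : (p.lam - p.mu) * (p.k - 2) ≤ (p.lam - p.mu) * (p.k - 1 - N.card + T) :=
        mul_le_mul_of_nonneg_left (by linarith) (by linarith)
      linarith
  · have hc2 : N.card = 2 := by omega
    rw [hc2] at hunion hpot
    push_cast at hunion hpot
    have hm1 : 0 ≤ p.mu * D := mul_nonneg (by linarith) hD0
    have hm2 : 0 ≤ (p.lam - p.mu) * T := mul_nonneg (by linarith) hT0
    have hm3 : 0 ≤ p.lam * T := mul_nonneg (by linarith) hT0
    have hS : Q ∪ N ≠ S := by
      intro hS
      have h1 := hpot hS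
      have h3 : 6 * ((p.k : ℝ) - 3) ≤ p.lam * (p.k - 3) :=
        mul_le_mul_of_nonneg_right hg1 (by linarith)
      linarith
    have hss := ssubset_of_subset_of_ne hQNS hS
    have hp := hm.phi_pos hss hQNne
    have h5 : p.k = 5 := by
      by_contra hne
      have h6 : (6 : ℝ) ≤ p.k := by exact_mod_cast (by omega : 6 ≤ p.k)
      have h3 : 6 * ((p.k : ℝ) - 3) ≤ p.lam * (p.k - 3) :=
        mul_le_mul_of_nonneg_right hg1 (by linarith)
      linarith
    rw [p.mu_five h5, p.lam_five h5, h5] at hunion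
    push_cast at hunion
    -- The gap lemma bounds the potential by 2 - 2μ = -2, impossible if `h` is constantly k - 1.
    have hdef : ∃ v ∈ S, h v < p.k - 1 := by
      by_contra hno
      push Not at hno
      have h1 := hm.lt_pot_of_eq fun v hv => le_antisymm (hm.le hv) (hno v hv)
      have h2 := hm.pot_add_le_phi hss hQNne
      rw [p.mu_five h5] at h2
      linarith
    refine ⟨h5, hdef, ?_⟩
    obtain ⟨u, w, huw, hNuw⟩ := card_eq_two.1 hc2
    have hu : u ∈ N := by simp [hNuw]
    have hw : w ∈ N := by simp [hNuw]
    have hval : ∀ v ∈ N, h v = 4 ∧ dg G S v = dg G Q v + 3 := by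
      intro v hv
      have h1 := single_le_sum ht0 hv
      rw [← hT] at h1
      have h2 := single_le_sum hdef0 hv
      have h3 := hm.le (hNS' hv)
      have h4 : h v = 4 := by
        by_contra hne
        have h5' : (h v : ℝ) ≤ 3 := by exact_mod_cast (by omega : h v ≤ 3)
        rw [← hD, h5] at h2
        push_cast at h2
        linarith
      have h6 := htight v hv (by linarith)
      obtain ⟨x, hx, hxv⟩ := hmemN v hv
      have h7 := hQ.add_dg_le hm (hNS hv) hx hxv
      omega
    have hsum : dg G Q u + dg G Q w = 4 := by
      rw [← sum_pair huw, ← hNuw, hsumN, h5]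
    refine ⟨u, w, hNS hu, hNS hw, hNadj hu hw huw, (hval u hu).1, (hval w hw).1, (hval u hu).2,
      (hval w hw).2, hsum, hpos u hu, hpos w hw, fun x hx v hv hxv => ?_⟩
    have : v ∈ N := mem_filter.2 ⟨hv, x, hx, hxv⟩
    rw [hNuw, mem_insert, mem_singleton] at this
    exact this

end LowClique

/-! ### Discharging -/

namespace MinCex

variable {p : Par} {G : SimpleGraph V} {S : Finset V} {h : V → ℕ}

theorem cast_le (hm : MinCex p G S h) {v : V} (hv : v ∈ S) : (h v : ℝ) ≤ p.k - 1 := by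
  have h1 := hm.le hv
  have := p.five_le
  have : (h v : ℝ) + 1 ≤ p.k := by exact_mod_cast (by omega : h v + 1 ≤ p.k)
  linarith

theorem _root_.DPCover.LowClique.clique_card_le {X : Finset V} (hX : X ⊆ S)
    (hd : ∀ v ∈ X, dg G S v = h v) (hno : ∀ Q ⊆ X, ¬ LowClique p G S h Q) {B : Finset V}
    (hB : B ⊆ X) (hcl : G.IsClique (B : Set V)) : B.card ≤ p.k - 2 := by
  by_contra hlt
  have := p.five_le
  obtain ⟨Q, hQB, hQ⟩ := exists_subset_card_eq (show p.k - 1 ≤ B.card by omega)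
  exact hno Q (hQB.trans hB) ⟨(hQB.trans hB).trans hX, hcl.subset hQB, hQ,
    fun x hx => hd x (hB (hQB hx))⟩

/-- For a low vertex, `k - 1 - dg G X v` is its deficiency `k - 1 - h v` plus the number of its
neighbors outside `X`. -/
theorem edge_bound (hm : MinCex p G S h) {X : Finset V} (hX : X ⊆ S) (hne : X.Nonempty)
    (hd : ∀ v ∈ X, dg G S v = h v) (hno : ∀ Q ⊆ X, ¬ LowClique p G S h Q) :
    (2 * (p.k : ℝ) - 7) * X.card + 3 * (p.k - 2) ≤
      (p.k - 2) * (∑ v ∈ X, ((p.k : ℝ) - 1 - h v) + ∑ v ∈ S \ X, (dg G X v : ℝ)) := by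
  have h1 := DPCover.edge_bound p.five_le hne
    (fun Y hY hYne => hm.crit.not_col_dg (hY.trans hX) hYne fun v hv => hd v (hY hv))
    (fun B hB => LowClique.clique_card_le hX hd hno hB) (fun v hv => by
      have := hm.le (hX hv)
      rw [← hd v hv] at this
      exact (dg_mono hX v).trans this)
  have h2 : ((∑ v ∈ X, ((p.k : ℤ) - 1 - dg G X v) : ℤ) : ℝ) =
      ∑ v ∈ X, ((p.k : ℝ) - 1 - h v) + ∑ v ∈ S \ X, (dg G X v : ℝ) := by
    have h3 : ∑ v ∈ S \ X, (dg G X v : ℝ) = ∑ v ∈ X, (dg G (S \ X) v : ℝ) := by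
      exact_mod_cast sum_dg_comm G (S \ X) X
    rw [h3, ← sum_add_distrib]
    push_cast
    refine sum_congr rfl fun v hv => ?_
    have : (h v : ℝ) = dg G X v + dg G (S \ X) v := by
      rw [← hd v hv]
      exact_mod_cast dg_sdiff (G := G) hX v
    rw [this]
    ring
  rw [← h2]
  exact_mod_cast h1

theorem add_one_le_dg (hm : MinCex p G S h) {v : V} (hv : v ∈ S) (hne : dg G S v ≠ h v) :
    (h v : ℝ) + 1 ≤ dg G S v := by
  have := hm.crit.le_dg hv
  exact_mod_cast (by omega : h v + 1 ≤ dg G S v)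

theorem wt_of_low {v : V} (hv : dg G S v = h v) :
    p.wt G S h v = 1 - p.mu * ((p.k : ℝ) - 1 - h v) := by
  rw [Par.wt, hv]
  ring

theorem exists_int_pot (p : Par) (G : SimpleGraph V) (S : Finset V) (h : V → ℕ) :
    ∃ z : ℤ, p.pot G S h = z - p.mu * ∑ v ∈ S, ((p.k : ℝ) - 1 - h v) := by
  obtain ⟨l, hl⟩ := p.int
  refine ⟨∑ v ∈ S, (1 - l * ((dg G S v : ℤ) - h v)), ?_⟩
  rw [Par.pot, mul_sum]
  push_cast
  rw [← sum_sub_distrib]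
  refine sum_congr rfl fun v _ => ?_
  rw [Par.wt, hl]

/-- Edges between low and other vertices carry the charge b = (k - 2)/(2k - 7). By `edge_bound` this
pays for the low vertices with 3b to spare, and the others can afford it since bk ≤ λ - 1. So the
potential is at most -3b - (μ - b)d, with `d` the total deficiency and b > 1/2. This suffices for d
≥ 2; for d = 0 and d = 1 the integrality of λ rules out the remaining gap. -/
theorem exists_lowClique (hm : MinCex p G S h) : ∃ Q, LowClique p G S h Q := by
  by_contra hno
  push Not at hno
  have g1 := p.six_le
  have g2 := p.mu_le_two
  have g3 := p.one_lt_mu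
  have g4 := p.five_le'
  have g5 := p.le_lam
  have hdef0 : ∀ v ∈ S, (0 : ℝ) ≤ (p.k : ℝ) - 1 - h v := fun v hv => by
    linarith [hm.cast_le hv]
  set D := S.filter fun v => dg G S v = h v with hD
  have hDS : D ⊆ S := filter_subset _ _
  have hDl : ∀ v ∈ D, dg G S v = h v := fun v hv => (mem_filter.1 hv).2
  have hDn : ∀ v ∈ S \ D, dg G S v ≠ h v := fun v hv hvl =>
    (mem_sdiff.1 hv).2 (mem_filter.2 ⟨(mem_sdiff.1 hv).1, hvl⟩)
  set d := ∑ v ∈ S, ((p.k : ℝ) - 1 - h v) with hd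
  have hd0 : 0 ≤ d := sum_nonneg hdef0
  have hdd : d = 0 ∨ 1 ≤ d := by
    by_cases hall : ∀ v ∈ S, h v = p.k - 1
    · left
      refine sum_eq_zero fun v hv => ?_
      rw [hall v hv, Nat.cast_sub (by have := p.five_le; omega)]
      push_cast
      ring
    · right
      push Not at hall
      obtain ⟨v, hv, hne⟩ := hall
      have h1 := single_le_sum hdef0 hv
      have h2 := hm.le hv
      have h3 : (h v : ℝ) + 2 ≤ p.k := by exact_mod_cast (by omega : h v + 2 ≤ p.k)
      linarith
  have hdint : ∃ n : ℤ, d = n := ⟨∑ v ∈ S, ((p.k : ℤ) - 1 - h v), by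
    rw [hd]
    push_cast
    rfl⟩
  obtain ⟨z, hz⟩ := exists_int_pot p G S h
  rw [← hd] at hz
  have hpot : p.pot G S h > -2 * p.mu := hm.lt_pot
  have hpot0 : d = 0 → p.pot G S h > -2 := fun h0 => by
    refine hm.lt_pot_of_eq fun v hv => ?_
    have h1 := (sum_eq_zero_iff_of_nonneg hdef0).1 h0 v hv
    have h2 : (p.k : ℝ) = ((h v + 1 : ℕ) : ℝ) := by
      push_cast
      linarith
    have h3 : p.k = h v + 1 := by exact_mod_cast h2
    omega
  by_cases hDne : D.Nonempty
  · have h1 := hm.edge_bound hDS hDne hDl fun Q _ => hno Q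
    have hpos : (0 : ℝ) < 2 * p.k - 7 := by linarith
    obtain ⟨b, hb⟩ : ∃ b : ℝ, b * (2 * p.k - 7) = p.k - 2 :=
      ⟨((p.k : ℝ) - 2) / (2 * p.k - 7), div_mul_cancel₀ _ hpos.ne'⟩
    have hb1 : b ≤ 1 := by
      by_contra hlt
      push Not at hlt
      nlinarith
    have hb2 : 1 / 2 < b := by
      by_contra hlt
      push Not at hlt
      nlinarith
    have hb3 : b * p.k ≤ p.lam - 1 := by
      refine le_of_mul_le_mul_right ?_ hpos
      have : b * p.k * (2 * (p.k : ℝ) - 7) = p.k * (p.k - 2) := by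
        rw [← hb]
        ring
      rw [this]
      linarith
    have hDcard : (D.card : ℝ) ≤ b * (∑ v ∈ D, ((p.k : ℝ) - 1 - h v) +
        ∑ v ∈ S \ D, (dg G D v : ℝ)) - 3 * b := by
      refine le_of_mul_le_mul_right ?_ hpos
      rw [sub_mul, mul_right_comm, hb, mul_assoc 3, hb]
      linarith
    have hwD : ∑ v ∈ D, p.wt G S h v = D.card - p.mu * ∑ v ∈ D, ((p.k : ℝ) - 1 - h v) := by
      rw [sum_congr rfl fun v hv => wt_of_low (hDl v hv), sum_sub_distrib, ← mul_sum, sum_const,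
        nsmul_eq_mul, mul_one]
    have hwR : ∑ v ∈ S \ D, p.wt G S h v + b * ∑ v ∈ S \ D, (dg G D v : ℝ) ≤
        -(p.mu - b) * ∑ v ∈ S \ D, ((p.k : ℝ) - 1 - h v) := by
      rw [mul_sum, mul_sum, ← sum_add_distrib]
      refine sum_le_sum fun v hv => ?_
      have hvS := (mem_sdiff.1 hv).1
      have e1 := hm.add_one_le_dg hvS (hDn v hv)
      have e2 : (dg G D v : ℝ) ≤ dg G S v := by exact_mod_cast dg_mono hDS v
      have e3 : b * (dg G D v : ℝ) ≤ b * dg G S v := mul_le_mul_of_nonneg_left e2 (by linarith)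
      have e4 := hdef0 v hvS
      have e5 : 0 ≤ (p.lam - b) * ((dg G S v : ℝ) - h v - 1) :=
        mul_nonneg (by linarith) (by linarith)
      have e6 : 0 ≤ b * ((p.k : ℝ) - 1 - h v) := mul_nonneg (by linarith) e4
      rw [Par.wt]
      nlinarith
    have hsplit : p.pot G S h = ∑ v ∈ S \ D, p.wt G S h v + ∑ v ∈ D, p.wt G S h v := by
      rw [Par.pot, sum_sdiff hDS]
    have hdsplit : d = ∑ v ∈ S \ D, ((p.k : ℝ) - 1 - h v) + ∑ v ∈ D, ((p.k : ℝ) - 1 - h v) := by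
      rw [hd, sum_sdiff hDS]
    have key : p.pot G S h ≤ -3 * b - (p.mu - b) * d := by
      rw [hsplit, hdsplit]
      linarith
    rcases hdd with h0 | h1
    · have e1 := hpot0 h0
      rw [hz, h0] at e1 key
      have e2 : (-2 : ℝ) < z := by linarith
      have e3 : (z : ℝ) < -1 := by linarith
      have e4 : (-2 : ℤ) < z := by exact_mod_cast e2
      have e5 : z < (-1 : ℤ) := by exact_mod_cast e3
      omega
    · obtain ⟨n, hn⟩ := hdint
      by_cases hn1 : n = 1
      · rw [hz, hn, hn1] at hpot key
        push_cast at hpot key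
        have e2 : (-2 : ℝ) < z := by linarith
        have e3 : (z : ℝ) < -1 := by linarith
        have e4 : (-2 : ℤ) < z := by exact_mod_cast e2
        have e5 : z < (-1 : ℤ) := by exact_mod_cast e3
        omega
      · have h1' : (1 : ℤ) ≤ n := by
          rw [hn] at h1
          exact_mod_cast h1
        have h2 : (2 : ℝ) ≤ d := by
          rw [hn]
          exact_mod_cast (by omega : (2 : ℤ) ≤ n)
        nlinarith
  · rw [not_nonempty_iff_eq_empty] at hDne
    have hw : ∀ v ∈ S, p.wt G S h v ≤ -5 - p.mu * ((p.k : ℝ) - 1 - h v) := by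
      intro v hv
      have e1 := hm.add_one_le_dg hv (hDn v (by simp [hDne, hv]))
      rw [Par.wt]
      nlinarith
    have h1 := sum_le_sum hw
    rw [sum_sub_distrib, ← mul_sum, ← hd, sum_const, nsmul_eq_mul] at h1
    change p.pot G S h ≤ _ at h1
    have h2 : (1 : ℝ) ≤ S.card := by exact_mod_cast card_pos.2 hm.crit.nonempty
    rcases hdd with h0 | h3
    · have := hpot0 h0
      rw [h0] at h1
      linarith
    · nlinarith

/-- The sum of the weights in a set, plus the number of edges that leave it. -/
noncomputable def _root_.DPCover.Par.psi (p : Par) (G : SimpleGraph V) (S : Finset V)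
    (h : V → ℕ) (A : Finset V) : ℝ :=
  ∑ v ∈ A, p.wt G S h v + cut G S A

theorem psi_union_le {A B : Finset V} (hA : A ⊆ S) (hB : B ⊆ S) :
    p.psi G S h (A ∪ B) ≤ p.psi G S h A + p.psi G S h B - p.psi G S h (A ∩ B) := by
  have h1 : (cut G S (A ∪ B) : ℝ) + cut G S (A ∩ B) ≤ cut G S A + cut G S B := by
    exact_mod_cast cut_union_add_cut_inter_le (G := G) hA hB
  have h2 := sum_union_inter (s₁ := A) (s₂ := B) (f := p.wt G S h)
  rw [Par.psi, Par.psi, Par.psi, Par.psi]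
  linarith

end MinCex

/-! ### The exceptional blocks for k = 5 -/

namespace Special

variable {p : Par} {G : SimpleGraph V} {S : Finset V} {h : V → ℕ} {Q Q' : Finset V} {u w : V}

theorem symm (hs : Special G S h Q u w) : Special G S h Q w u :=
  ⟨hs.hw, hs.hu, hs.adj.symm, hs.hw4, hs.hu4, hs.dgw, hs.dgu, by rw [add_comm, hs.sum], hs.posw,
    hs.posu, fun x hx v hv hxv => (hs.outer x hx v hv hxv).symm⟩

/-- If `Q` and `Q'` share `x`, the only vertex `v` of `Q'` outside `Q` is the outer neighbor of `x`.
It has three neighbors in `Q`, hence degree at least 6, but low vertices have degree at most 4. -/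
theorem disjoint (hm : MinCex p G S h) (h5 : p.k = 5) (hQ : LowClique p G S h Q)
    (hQ' : LowClique p G S h Q') (hs : Special G S h Q u w) (hne : Q ≠ Q') : Disjoint Q Q' := by
  classical
  rw [disjoint_left]
  intro x hx hx'
  have hcard : Q.card = Q'.card := by rw [hQ.card, hQ'.card]
  obtain ⟨v, hv', hv⟩ : ∃ v ∈ Q', v ∉ Q := by
    by_contra hno
    push Not at hno
    exact hne (eq_of_subset_of_card_le hno hcard.le).symm
  have hvS : v ∈ S \ Q := mem_sdiff.2 ⟨hQ'.sub hv', hv⟩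
  have hxv : G.Adj x v := hQ'.clique hx' hv' fun h => hv (h ▸ hx)
  have h3 : 3 ≤ dg G Q v := by
    have h1 : (Q'.erase v).card = 3 := by rw [card_erase_of_mem hv', hQ'.card, h5]
    rw [← h1, dg]
    refine card_le_card fun y hy => ?_
    rw [mem_erase] at hy
    rw [mem_filter]
    refine ⟨?_, hQ'.clique hv' hy.2 hy.1.symm⟩
    by_contra hyQ
    have hyS : y ∈ S \ Q := mem_sdiff.2 ⟨hQ'.sub hy.2, hyQ⟩
    exact hy.1 (hQ.adj_unique hm hx hyS hvS
      (hQ'.clique hx' hy.2 fun h => hyQ (h ▸ hx)) hxv)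
  have h4 : dg G S v = dg G Q v + 3 := by
    rcases hs.outer x hx v hvS hxv with rfl | rfl
    · exact hs.dgu
    · exact hs.dgw
  have h6 := hQ'.low v hv'
  have h7 := hm.le (hQ'.sub hv')
  omega

/-- A vertex `u ∈ Q'` has degree 4 and a single neighbor outside `Q'`. That neighbor lies in `Q`, so
`w ∈ Q'` too, and the two degrees add up to 8 instead of 4 + 6. -/
theorem notMem (hm : MinCex p G S h) (h5 : p.k = 5) (hQ : LowClique p G S h Q)
    (hQ' : LowClique p G S h Q') (hs : Special G S h Q u w) (hne : Q ≠ Q') : u ∉ Q' := by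
  intro hu
  have hd := hs.disjoint hm h5 hQ hQ' hne
  have h1 := hQ'.low u hu
  have h2 := hs.dgu
  have h3 := hs.hu4
  have h4 := hs.sum
  obtain ⟨x, hx, hux⟩ := dg_pos_iff.1 hs.posu
  have hxS : x ∈ S \ Q' := mem_sdiff.2 ⟨hQ.sub hx, disjoint_left.1 hd hx⟩
  by_cases hw : w ∈ Q'
  · have h6 := hQ'.low w hw
    have h7 := hs.dgw
    have h8 := hs.hw4
    omega
  · have := hQ'.adj_unique hm hu hxS (mem_sdiff.2 ⟨(mem_sdiff.1 hs.hw).1, hw⟩) hux hs.adj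
    exact (mem_sdiff.1 hs.hw).2 (this ▸ hx)

/-- `u` has equally many neighbors in `Q` and `Q'`; with `w` they number at most `dg G Q u + 3`. -/
theorem dg_le_two {w' : V} (hm : MinCex p G S h) (h5 : p.k = 5) (hQ : LowClique p G S h Q)
    (hQ' : LowClique p G S h Q') (hs : Special G S h Q u w) (hs' : Special G S h Q' u w')
    (hne : Q ≠ Q') : dg G Q u ≤ 2 := by
  have hd := hs.disjoint hm h5 hQ hQ' hne
  have hw : w ∉ Q ∪ Q' := by
    rw [mem_union, not_or]
    exact ⟨(mem_sdiff.1 hs.hw).2, hs.symm.notMem hm h5 hQ hQ' hne⟩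
  have h1 := dg_insert_of_adj (G := G) hw hs.adj
  rw [dg_union hd] at h1
  have h2 : dg G (insert w (Q ∪ Q')) u ≤ dg G S u :=
    dg_mono (insert_subset (mem_sdiff.1 hs.hw).1 (union_subset hQ.sub hQ'.sub)) u
  have h3 := hs.dgu
  have h4 := hs'.dgu
  omega

theorem wt_left (h5 : p.k = 5) (hs : Special G S h Q u w) :
    p.wt G S h u = 7 - 6 * dg G Q u := by
  rw [Par.wt, hs.dgu, hs.hu4, h5, p.lam_five h5]
  push_cast
  ring

theorem psi_left (h5 : p.k = 5) (hs : Special G S h Q u w) :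
    p.psi G S h {u} = 10 - 5 * dg G Q u := by
  rw [Par.psi, sum_singleton, cut, sum_singleton, sdiff_singleton_eq_erase,
    dg_erase_of_not_adj (G.loopless.irrefl u), hs.wt_left h5, hs.dgu]
  push_cast
  ring

theorem dg_sdiff_pair (hs : Special G S h Q u w) : dg G (S \ {u, w}) u = dg G Q u + 2 := by
  have h1 := dg_sdiff (G := G) (X := {u, w}) (S := S)
    (insert_subset (mem_sdiff.1 hs.hu).1 (singleton_subset_iff.2 (mem_sdiff.1 hs.hw).1)) u
  rw [dg_insert_self, dg_singleton_of_adj hs.adj, hs.dgu] at h1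
  omega

theorem psi_pair (h5 : p.k = 5) (hs : Special G S h Q u w) : p.psi G S h {u, w} = -2 := by
  have h1 := hs.symm.dg_sdiff_pair
  rw [pair_comm] at h1
  have h2 : (dg G Q u : ℝ) + dg G Q w = 4 := by exact_mod_cast hs.sum
  rw [Par.psi, cut, sum_pair hs.adj.ne, sum_pair hs.adj.ne, hs.dg_sdiff_pair, h1, hs.wt_left h5,
    hs.symm.wt_left h5]
  push_cast
  linarith

/-- The weights are 4 on `Q` and 14 - 24 on the pair; each of `u`, `w` has two neighbors outside the
block. -/
theorem psi_block (hm : MinCex p G S h) (h5 : p.k = 5) (hQ : LowClique p G S h Q)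
    (hs : Special G S h Q u w) : p.psi G S h (Q ∪ {u, w}) ≤ -2 := by
  have hu := mem_sdiff.1 hs.hu
  have hw := mem_sdiff.1 hs.hw
  have hd : Disjoint Q {u, w} := by
    rw [disjoint_right]
    simp only [mem_insert, mem_singleton, forall_eq_or_imp, forall_eq]
    exact ⟨hu.2, hw.2⟩
  have h1 : ∑ v ∈ Q, p.wt G S h v = 4 := by
    rw [sum_congr rfl (g := fun _ => (1 : ℝ)), sum_const, hQ.card, h5]
    · norm_num
    · intro x hx
      rw [MinCex.wt_of_low (hQ.low x hx), hQ.eq_pred hm hx, h5]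
      norm_num
  have h2 : (dg G Q u : ℝ) + dg G Q w = 4 := by exact_mod_cast hs.sum
  have h3 : cut G S (Q ∪ {u, w}) ≤ 4 := by
    have hsub : Q ∪ {u, w} ⊆ S :=
      union_subset hQ.sub (insert_subset hu.1 (singleton_subset_iff.2 hw.1))
    have e1 : ∑ v ∈ Q, dg G (S \ (Q ∪ {u, w})) v = 0 := by
      refine sum_eq_zero fun x hx => ?_
      by_contra hpos
      obtain ⟨v, hv, hxv⟩ := dg_pos_iff.1 (Nat.pos_of_ne_zero hpos)
      simp only [mem_sdiff, mem_union, mem_insert, mem_singleton, not_or] at hv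
      rcases hs.outer x hx v (mem_sdiff.2 ⟨hv.1, hv.2.1⟩) hxv with h | h
      · exact hv.2.2.1 h
      · exact hv.2.2.2 h
    have e2 := dg_sdiff (G := G) hsub u
    have e3 := dg_sdiff (G := G) hsub w
    rw [dg_union hd, dg_insert_self, dg_singleton_of_adj hs.adj, hs.dgu] at e2
    rw [dg_union hd, pair_comm, dg_insert_self, dg_singleton_of_adj hs.adj.symm, hs.dgw] at e3
    rw [pair_comm] at e3
    rw [cut, sum_union hd, e1, sum_pair hs.adj.ne]
    omega
  have h4 : (cut G S (Q ∪ {u, w}) : ℝ) ≤ 4 := by exact_mod_cast h3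
  rw [Par.psi, sum_union hd, h1, sum_pair hs.adj.ne, hs.wt_left h5, hs.symm.wt_left h5]
  linarith

end Special

namespace MinCex

variable {p : Par} {G : SimpleGraph V} {S : Finset V} {h : V → ℕ}

/-- Add the blocks one by one. The new block meets the union of the others only inside its pair,
where `psi` is at least -2: it is -2 on the pair, and a single common vertex has at most two
neighbors in `Q`. So submodularity preserves the bound. -/
theorem psi_blocks (hm : MinCex p G S h) (h5 : p.k = 5) {a b : Finset V → V}
    (hab : ∀ Q, LowClique p G S h Q → Special G S h Q (a Q) (b Q)) (F : Finset (Finset V))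
    (hF : ∀ Q ∈ F, LowClique p G S h Q) (hne : F.Nonempty) :
    p.psi G S h (F.biUnion fun Q => Q ∪ {a Q, b Q}) ≤ -2 := by
  have hsub : ∀ Q, LowClique p G S h Q → Q ∪ {a Q, b Q} ⊆ S := fun Q hQ =>
    union_subset hQ.sub (insert_subset (mem_sdiff.1 (hab Q hQ).hu).1
      (singleton_subset_iff.2 (mem_sdiff.1 (hab Q hQ).hw).1))
  induction hne using Finset.Nonempty.cons_induction with
  | singleton Q =>
    rw [singleton_biUnion]
    have hQ := hF Q (mem_singleton_self Q)
    exact (hab Q hQ).psi_block hm h5 hQ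
  | cons Q F hQF hne ih =>
    rw [cons_eq_insert] at hF ⊢
    rw [biUnion_insert]
    have hQ := hF Q (mem_insert_self _ _)
    have hF' : ∀ Q' ∈ F, LowClique p G S h Q' := fun Q' hQ' => hF Q' (mem_insert_of_mem hQ')
    have hs := hab Q hQ
    set R := F.biUnion fun Q => Q ∪ {a Q, b Q} with hR
    have hRS : R ⊆ S := biUnion_subset.2 fun Q' hQ' => hsub Q' (hF' Q' hQ')
    have hle := psi_union_le (p := p) (G := G) (h := h) (hsub Q hQ) hRS
    have h1 := hs.psi_block hm h5 hQ
    have h2 := ih hF'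
    have hneq : ∀ Q' ∈ F, Q ≠ Q' := by
      rintro Q' hQ' rfl
      exact hQF hQ'
    have hmemR : ∀ x ∈ R, ∃ Q' ∈ F, x ∈ Q' ∨ x = a Q' ∨ x = b Q' := by
      intro x hx
      obtain ⟨Q', hQ', hx'⟩ := mem_biUnion.1 hx
      rw [mem_union, mem_insert, mem_singleton] at hx'
      exact ⟨Q', hQ', hx'⟩
    have hinter : (Q ∪ {a Q, b Q}) ∩ R ⊆ {a Q, b Q} := by
      intro x hx
      rw [mem_inter, mem_union] at hx
      refine hx.1.resolve_left fun hxQ => ?_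
      obtain ⟨Q', hQ', hx'⟩ := hmemR x hx.2
      have hs' := hab Q' (hF' Q' hQ')
      rcases hx' with hx' | rfl | rfl
      · exact disjoint_left.1 (hs.disjoint hm h5 hQ (hF' Q' hQ') (hneq Q' hQ')) hxQ hx'
      · exact hs'.notMem hm h5 (hF' Q' hQ') hQ (hneq Q' hQ').symm hxQ
      · exact hs'.symm.notMem hm h5 (hF' Q' hQ') hQ (hneq Q' hQ').symm hxQ
    have htwo : ∀ s t, Special G S h Q s t → s ∈ R → -2 ≤ p.psi G S h {s} := by
      intro s t hst hsR
      obtain ⟨Q', hQ', hs'⟩ := hmemR s hsR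
      have hsp := hab Q' (hF' Q' hQ')
      have : dg G Q s ≤ 2 := by
        rcases hs' with hs' | rfl | rfl
        · exact absurd hs' (hst.notMem hm h5 hQ (hF' Q' hQ') (hneq Q' hQ'))
        · exact hst.dg_le_two hm h5 hQ (hF' Q' hQ') hsp (hneq Q' hQ')
        · exact hst.dg_le_two hm h5 hQ (hF' Q' hQ') hsp.symm (hneq Q' hQ')
      have : (dg G Q s : ℝ) ≤ 2 := by exact_mod_cast this
      rw [hst.psi_left h5]
      linarith
    have h3 : -2 ≤ p.psi G S h ((Q ∪ {a Q, b Q}) ∩ R) := by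
      set I := (Q ∪ {a Q, b Q}) ∩ R with hI
      have hIR : I ⊆ R := inter_subset_right
      by_cases ha : a Q ∈ I <;> by_cases hb : b Q ∈ I
      · have : I = {a Q, b Q} := subset_antisymm hinter (by
          intro x hx
          rw [mem_insert, mem_singleton] at hx
          rcases hx with rfl | rfl <;> assumption)
        rw [this, hs.psi_pair h5]
      · have : I = {a Q} := by
          ext x
          rw [mem_singleton]
          refine ⟨fun hx => ?_, fun hx => hx ▸ ha⟩
          have := hinter hx
          rw [mem_insert, mem_singleton] at this
          exact this.resolve_right fun h => hb (h ▸ hx)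
        rw [this]
        exact htwo _ _ hs (hIR ha)
      · have : I = {b Q} := by
          ext x
          rw [mem_singleton]
          refine ⟨fun hx => ?_, fun hx => hx ▸ hb⟩
          have := hinter hx
          rw [mem_insert, mem_singleton] at this
          exact this.resolve_left fun h => ha (h ▸ hx)
        rw [this]
        exact htwo _ _ hs.symm (hIR hb)
      · have : I = ∅ := by
          rw [eq_empty_iff_forall_notMem]
          intro x hx
          have := hinter hx
          rw [mem_insert, mem_singleton] at this
          rcases this with rfl | rfl
          · exact ha hx
          · exact hb hx
        rw [this, Par.psi, cut, sum_empty, sum_empty]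
        norm_num
    linarith

/-- The union `R` of all blocks contains every low clique, so `edge_bound` holds for the low
vertices outside, with charge 1 per edge. The cut in `psi` pays for the edges from `R`, and the
potential is at most -2 - 3 < -2μ. If no low vertex is outside `R`, the deficient `v₀` contributes
at most -5. -/
theorem not_lowClique (hm : MinCex p G S h) (Q₀ : Finset V) : ¬ LowClique p G S h Q₀ := by
  classical
  intro hQ₀
  obtain ⟨h5, ⟨v₀, hv₀, hlt⟩, -⟩ := hQ₀.special hm
  have hsp : ∀ Q, ∃ u w, LowClique p G S h Q → Special G S h Q u w := by
    intro Q
    by_cases hQ : LowClique p G S h Q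
    · obtain ⟨u, w, hs⟩ := (hQ.special hm).2.2
      exact ⟨u, w, fun _ => hs⟩
    · exact ⟨v₀, v₀, fun h => absurd h hQ⟩
  choose a b hab using hsp
  set F := S.powerset.filter fun Q => LowClique p G S h Q with hF
  have hFl : ∀ Q ∈ F, LowClique p G S h Q := fun Q hQ => (mem_filter.1 hQ).2
  have hFm : ∀ Q, LowClique p G S h Q → Q ∈ F := fun Q hQ =>
    mem_filter.2 ⟨mem_powerset.2 hQ.sub, hQ⟩
  have hpsi := hm.psi_blocks h5 hab F hFl ⟨Q₀, hFm Q₀ hQ₀⟩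
  set R := F.biUnion fun Q => Q ∪ {a Q, b Q} with hR
  have hRS : R ⊆ S := biUnion_subset.2 fun Q hQ =>
    union_subset (hFl Q hQ).sub (insert_subset (mem_sdiff.1 (hab Q (hFl Q hQ)).hu).1
      (singleton_subset_iff.2 (mem_sdiff.1 (hab Q (hFl Q hQ)).hw).1))
  have hQR : ∀ Q, LowClique p G S h Q → Q ⊆ R := fun Q hQ x hx =>
    mem_biUnion.2 ⟨Q, hFm Q hQ, mem_union_left _ hx⟩
  have hR4 : ∀ v ∈ R, h v = p.k - 1 := by
    intro v hv
    obtain ⟨Q, hQ, hvQ⟩ := mem_biUnion.1 hv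
    simp only [mem_union, mem_insert, mem_singleton] at hvQ
    rcases hvQ with hvQ | rfl | rfl
    · exact (hFl Q hQ).eq_pred hm hvQ
    · rw [(hab Q (hFl Q hQ)).hu4, h5]
    · rw [(hab Q (hFl Q hQ)).hw4, h5]
  have hv₀R : v₀ ∉ R := fun hv => hlt.ne (hR4 v₀ hv)
  have hlam := p.lam_five h5
  have hmu := p.mu_five h5
  have hk : (p.k : ℝ) = 5 := by exact_mod_cast h5
  set X := (S \ R).filter fun v => dg G S v = h v with hX
  set Y := (S \ R).filter fun v => ¬ dg G S v = h v with hY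
  have hXR : X ⊆ S \ R := filter_subset _ _
  have hYR : Y ⊆ S \ R := filter_subset _ _
  have hXl : ∀ v ∈ X, dg G S v = h v := fun v hv => (mem_filter.1 hv).2
  have hYn : ∀ v ∈ Y, dg G S v ≠ h v := fun v hv => (mem_filter.1 hv).2
  have hXS : X ⊆ S := hXR.trans sdiff_subset
  have hYS : Y ⊆ S := hYR.trans sdiff_subset
  have hsplit : ∀ g : V → ℝ, ∑ v ∈ S, g v = ∑ v ∈ R, g v + (∑ v ∈ X, g v + ∑ v ∈ Y, g v) := by
    intro g
    rw [hX, hY, sum_filter_add_sum_filter_not, add_comm, sum_sdiff hRS]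
  have hpot : p.pot G S h = ∑ v ∈ R, p.wt G S h v +
      (∑ v ∈ X, p.wt G S h v + ∑ v ∈ Y, p.wt G S h v) := hsplit _
  have hlt4 := hm.lt_pot
  rw [hmu] at hlt4
  rw [Par.psi] at hpsi
  by_cases hXne : X.Nonempty
  · have h1 := hm.edge_bound hXS hXne hXl fun Q hQX hQ => by
      have hne : Q.Nonempty := card_pos.1 (by rw [hQ.card, h5]; norm_num)
      obtain ⟨x, hx⟩ := hne
      exact (mem_sdiff.1 (hXR (hQX hx))).2 (hQR Q hQ hx)
    rw [hk] at h1
    have h2 : S \ X = R ∪ Y := by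
      ext v
      simp only [mem_sdiff, mem_union, hX, hY, mem_filter]
      constructor
      · rintro ⟨h1, h2⟩
        by_cases hv : v ∈ R
        · exact Or.inl hv
        · exact Or.inr ⟨⟨h1, hv⟩, fun h => h2 ⟨⟨h1, hv⟩, h⟩⟩
      · rintro (hv | ⟨⟨h1, h2⟩, h3⟩)
        · exact ⟨hRS hv, fun h => h.1.2 hv⟩
        · exact ⟨h1, fun h => h3 h.2⟩
    have hdRY : Disjoint R Y := disjoint_of_subset_right hYR disjoint_sdiff
    rw [h2, sum_union hdRY] at h1
    have h3 : ∑ v ∈ R, (dg G X v : ℝ) ≤ cut G S R := by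
      rw [cut]
      push_cast
      exact sum_le_sum fun v _ => by exact_mod_cast dg_mono hXR v
    have hwX : ∑ v ∈ X, p.wt G S h v = X.card - 2 * ∑ v ∈ X, ((5 : ℝ) - 1 - h v) := by
      rw [sum_congr rfl fun v hv => wt_of_low (hXl v hv), sum_sub_distrib, ← mul_sum, sum_const,
        nsmul_eq_mul, mul_one, hk, hmu]
    have hwY : ∑ v ∈ Y, p.wt G S h v + ∑ v ∈ Y, (dg G X v : ℝ) ≤ 0 := by
      rw [← sum_add_distrib]
      refine sum_nonpos fun v hv => ?_
      have e1 := hm.add_one_le_dg (hYS hv) (hYn v hv)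
      have e2 : (dg G X v : ℝ) ≤ dg G S v := by exact_mod_cast dg_mono hXS v
      have e3 := hm.cast_le (hYS hv)
      rw [Par.wt, hlam, hmu, hk]
      rw [hk] at e3
      linarith
    have hdX : 0 ≤ ∑ v ∈ X, ((5 : ℝ) - 1 - h v) := sum_nonneg fun v hv => by
      have := hm.cast_le (hXS hv)
      rw [hk] at this
      linarith
    linarith
  · rw [not_nonempty_iff_eq_empty] at hXne
    have hv₀Y : v₀ ∈ Y := by
      refine mem_filter.2 ⟨mem_sdiff.2 ⟨hv₀, hv₀R⟩, fun hl => ?_⟩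
      have : v₀ ∈ X := mem_filter.2 ⟨mem_sdiff.2 ⟨hv₀, hv₀R⟩, hl⟩
      rw [hXne] at this
      simp at this
    have hwY : ∀ v ∈ Y, p.wt G S h v ≤ -5 := by
      intro v hv
      have e1 := hm.add_one_le_dg (hYS hv) (hYn v hv)
      have e3 := hm.cast_le (hYS hv)
      rw [Par.wt, hlam, hmu]
      linarith
    have h1 := sum_le_card_nsmul Y _ _ hwY
    have h2 : (1 : ℝ) ≤ Y.card := by exact_mod_cast card_pos.2 ⟨v₀, hv₀Y⟩
    rw [nsmul_eq_mul] at h1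
    rw [hXne, sum_empty] at hpot
    have h3 : (0 : ℝ) ≤ cut G S R := Nat.cast_nonneg _
    linarith

end MinCex

/-! ### Conclusion of the induction -/

/-- The bound on the potential holds for all critical sets. -/
theorem good_of_crit (p : Par) (n : ℕ) (G : SimpleGraph V) (S : Finset V) (h : V → ℕ)
    (hn : S.card = n) (hc : Crit G (p.k - 1) S h) : p.Good G S h := by
  induction n using Nat.strong_induction_on generalizing G S h with
  | _ n ih =>
    by_contra hng
    have hm : MinCex p G S h := ⟨hc, fun G' S' h' hS' hc' =>
      ih S'.card (hn ▸ hS') G' S' h' rfl hc', hng⟩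
    obtain ⟨Q, hQ⟩ := hm.exists_lowClique
    exact hm.not_lowClique Q hQ

/-! ### Translation between multigraph covers and conflict systems -/

/-- The simple graph of adjacent vertices. -/
def _root_.Multigraph.support {W : Type*} (M : Multigraph W) : SimpleGraph W where
  Adj u v := M.mult s(u, v) ≠ 0
  symm := ⟨fun u v h => by rwa [Sym2.eq_swap]⟩
  loopless := ⟨fun u h => h (M.loopless _ (by simp))⟩

variable {W : Type*} [Fintype W] [DecidableEq W] {M : Multigraph W}

theorem adj_of_mem_lists {C : Type} (K : M.Cover C) {u v : W} {c d : C} (hc : c ∈ K.L u)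
    (hd : d ∈ K.L v) (hcd : K.H.Adj c d) :
    u ≠ v ∧ ∃ N : Fin (M.mult s(u, v)) → K.H.Subgraph, (∀ i, (N i).IsMatching) ∧
      ∀ c' ∈ K.L u, ∀ d' ∈ K.L v, K.H.Adj c' d' → ∃ i, (N i).Adj c' d' := by
  have huv : u ≠ v := by
    rintro rfl
    exact K.indep u hc hd hcd.ne hcd
  refine ⟨huv, ?_⟩
  obtain ⟨N, hN, hE⟩ := K.matchings u v huv
  refine ⟨N, hN, fun c' hc' d' hd' h => ?_⟩
  have : s(c', d') ∈ Multigraph.edgesBetween K.H (K.L u : Set C) (K.L v : Set C) :=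
    ⟨h, c', hc', d', hd', rfl⟩
  rw [hE, Set.mem_iUnion] at this
  exact this

/-- Number the finitely many colors. Simplicity leaves at most one matching for each pair of
vertices, which gives `inj`. -/
theorem dpColorable_of_col (hs : M.IsSimple) {n : ℕ} (hcol : Col M.support univ fun _ => n) :
    M.DPColorable n := by
  classical
  intro C K hK
  have : Finite C := by
    have hfin : (⋃ v, (K.L v : Set C)).Finite := Set.finite_iUnion fun v => finite_toSet _
    have huniv : (⋃ v, (K.L v : Set C)) = Set.univ := by
      rw [Set.eq_univ_iff_forall]
      intro c
      rw [Set.mem_iUnion]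
      exact K.exhaustive c
    rw [huniv] at hfin
    exact Set.finite_univ_iff.1 hfin
  obtain ⟨m, ⟨e⟩⟩ := Finite.exists_equiv_fin C
  set g : C → ℕ := fun c => e c with hg
  have hginj : Function.Injective g := fun a b h => e.injective (Fin.ext h)
  obtain ⟨f, hf⟩ := hcol
    { L := fun v => (K.L v).image g
      R := fun u a v b => ∃ c ∈ K.L u, ∃ d ∈ K.L v, g c = a ∧ g d = b ∧ K.H.Adj c d
      symm := by
        rintro u a v b ⟨c, hc, d, hd, h1, h2, h3⟩
        exact ⟨d, hd, c, hc, h2, h1, h3.symm⟩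
      inj := by
        rintro u a v b b' ⟨c, hc, d, hd, rfl, rfl, hcd⟩ ⟨c', hc', d', hd', hcc, rfl, hcd'⟩
        obtain rfl := hginj hcc
        obtain ⟨huv, N, hN, hE⟩ := adj_of_mem_lists K hc hd hcd
        obtain ⟨i, hi⟩ := hE _ hc _ hd hcd
        obtain ⟨j, hj⟩ := hE _ hc _ hd' hcd'
        have hij : i = j := by
          have := hs s(u, v)
          exact Fin.ext (by omega)
        subst hij
        rw [(hN i).eq_of_adj_left hi hj] }
    (by
      intro v _
      rw [card_image_of_injective _ hginj]
      exact hK v)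
  have hfv : ∀ v, ∃ c ∈ K.L v, g c = f v := fun v => mem_image.1 (hf.1 v (mem_univ v))
  refine ⟨{c | ∃ v, c ∈ K.L v ∧ g c = f v}, ?_, fun v => ?_⟩
  · rintro c ⟨u, hc, hcu⟩ d ⟨v, hd, hdv⟩ _ hcd
    obtain ⟨huv, N, hN, hE⟩ := adj_of_mem_lists K hc hd hcd
    obtain ⟨i, -⟩ := hE _ hc _ hd hcd
    have hadj : M.support.Adj u v := Nat.pos_iff_ne_zero.1 i.pos
    exact hf.2 u (mem_univ u) v (mem_univ v) hadj ⟨c, hc, d, hd, hcu, hdv, hcd⟩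
  · obtain ⟨c, hc, hcv⟩ := hfv v
    refine ⟨c, ⟨hc, v, hc, hcv⟩, ?_⟩
    rintro d ⟨hd, u, hdu, hdf⟩
    have huv : u = v := by
      by_contra hne
      exact disjoint_left.1 (K.disjoint u v hne) hdu hd
    subst huv
    exact hginj (hdf.trans hcv.symm)

/-- Colors become pairs of a vertex and a number. The vertices are coded in `Fin (Fintype.card W)`
because `DPColorable` ranges over colors in `Type` only. -/
theorem col_of_dpColorable {n : ℕ} (hM : M.DPColorable n) :
    Col M.support univ fun _ => n := by
  classical
  intro K hK
  obtain ⟨e⟩ := Fintype.truncEquivFin W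
  let C : Type := {x : Fin (Fintype.card W) × ℕ // x.2 ∈ K.L (e.symm x.1)}
  let H : SimpleGraph C :=
    { Adj := fun x y => M.support.Adj (e.symm x.1.1) (e.symm y.1.1) ∧
        K.R (e.symm x.1.1) x.1.2 (e.symm y.1.1) y.1.2
      symm := ⟨fun x y h => ⟨h.1.symm, K.symm h.2⟩⟩
      loopless := ⟨fun x h => M.support.loopless.irrefl _ h.1⟩ }
  let L : W → Finset C := fun v => (K.L v).attach.map
    ⟨fun a => ⟨(e v, a.1), by simp⟩, fun a b h => Subtype.ext (congrArg (fun x : C => x.1.2) h)⟩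
  have hL : ∀ v x, x ∈ L v ↔ e.symm x.1.1 = v := by
    intro v x
    constructor
    · intro hx
      obtain ⟨a, -, rfl⟩ := mem_map.1 hx
      exact e.symm_apply_apply v
    · rintro rfl
      exact mem_map.2 ⟨⟨x.1.2, x.2⟩, mem_attach _ _,
        Subtype.ext (Prod.ext (e.apply_symm_apply _) rfl)⟩
  let N : W → W → H.Subgraph := fun u v =>
    { verts := {x | ∃ y, H.Adj x y ∧ ((x ∈ L u ∧ y ∈ L v) ∨ (x ∈ L v ∧ y ∈ L u))}
      Adj := fun x y => H.Adj x y ∧ ((x ∈ L u ∧ y ∈ L v) ∨ (x ∈ L v ∧ y ∈ L u))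
      adj_sub := fun h => h.1
      edge_vert := fun {x y} h => ⟨y, h⟩
      symm := ⟨fun x y h => ⟨h.1.symm, h.2.symm.imp And.symm And.symm⟩⟩ }
  obtain ⟨I, hI, hI'⟩ := hM C
    { H := H
      L := L
      disjoint := fun u v huv => disjoint_left.2 fun x hx hx' =>
        huv (((hL u x).1 hx).symm.trans ((hL v x).1 hx'))
      exhaustive := fun x => ⟨_, (hL _ x).2 rfl⟩
      indep := by
        intro u x hx y hy _ hxy
        have h1 := (hL u x).1 hx
        have h2 := (hL u y).1 hy
        exact hxy.1.ne (h1.trans h2.symm)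
      matchings := by
        intro u v huv
        -- All matchings may be the same one; for nonadjacent `u`, `v` there is no index and no
        -- edge.
        refine ⟨fun _ => N u v, fun _ => ?_, ?_⟩
        · rintro x ⟨y, hxy⟩
          refine ⟨y, hxy, fun z hxz => ?_⟩
          have hyz : e.symm z.1.1 = e.symm y.1.1 := by
            rcases hxy.2 with h1 | h1 <;> rcases hxz.2 with h2 | h2
            · exact ((hL _ _).1 h2.2).trans ((hL _ _).1 h1.2).symm
            · exact absurd (((hL _ _).1 h1.1).symm.trans ((hL _ _).1 h2.1)) huv
            · exact absurd (((hL _ _).1 h2.1).symm.trans ((hL _ _).1 h1.1)) huv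
            · exact ((hL _ _).1 h2.2).trans ((hL _ _).1 h1.2).symm
          have hR := hxz.1.2
          rw [hyz] at hR
          exact Subtype.ext (Prod.ext (e.symm.injective hyz) (K.inj hR hxy.1.2))
        · ext s
          rw [Set.mem_iUnion]
          constructor
          · rintro ⟨hs, a, ha, b, hb, rfl⟩
            have hab : H.Adj a b := hs
            have h1 : M.support.Adj u v := by
              have := hab.1
              rwa [(hL _ _).1 ha, (hL _ _).1 hb] at this
            exact ⟨⟨0, Nat.pos_of_ne_zero h1⟩, ⟨hab, Or.inl ⟨ha, hb⟩⟩⟩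
          · rintro ⟨_, hs⟩
            induction s with
            | _ a b =>
              obtain ⟨hab, h | h⟩ := hs
              · exact ⟨hab, a, h.1, b, h.2, rfl⟩
              · exact ⟨hab, b, h.2, a, h.1, Sym2.eq_swap⟩ }
    (fun v => by
      simp only [L, card_map, card_attach]
      exact hK v (mem_univ v))
  choose c hc _ using fun v => hI' v
  have hcv : ∀ v, e.symm (c v).1.1 = v := fun v => (hL v _).1 (hc v).1
  refine ⟨fun v => (c v).1.2, fun v _ => ?_, fun u _ v _ huv hR => ?_⟩
  · have := (c v).2
    rwa [hcv v] at this
  · have hne : c u ≠ c v := fun h => huv.ne (by rw [← hcv u, ← hcv v, h])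
    refine hI (hc u).2 (hc v).2 hne ⟨?_, ?_⟩
    · rwa [hcv u, hcv v]
    · rwa [hcv u, hcv v]

/-- Ensures that the infimum in `dpChromaticNumber` is attained, not the default 0. A critical set
would have a vertex of degree larger than `Fintype.card W`. -/
theorem exists_dpColorable (hs : M.IsSimple) : ∃ n, 0 < n ∧ M.DPColorable n := by
  classical
  refine ⟨Fintype.card W + 1, Nat.succ_pos _, dpColorable_of_col hs ?_⟩
  by_contra hno
  obtain ⟨T, -, h', hh', hc⟩ := exists_crit (fun _ _ => le_rfl) hno
  obtain ⟨v, hv⟩ := hc.nonempty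
  have h1 := hc.le_dg hv
  have h2 := hh' v
  have h3 : dg M.support T v ≤ Fintype.card W :=
    (card_filter_le _ _).trans (card_le_univ T)
  omega

theorem dpColorable_of_chromaticNumber_le (hs : M.IsSimple) {n : ℕ}
    (hn : M.dpChromaticNumber ≤ n) : M.DPColorable n :=
  fun C K hK => (Nat.sInf_mem (exists_dpColorable hs)).2 C K fun v => hn.trans (hK v)

open Classical in
/-- The subgraph induced by a set of vertices. -/
noncomputable def induced (M : Multigraph W) (T : Finset W) : M.Subgraph where
  verts := T
  mult e := if ∀ v ∈ e, v ∈ T then M.mult e else 0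
  mult_le e := by split_ifs <;> simp
  mem_verts e he v hv := by
    by_contra hvT
    exact he (if_neg fun h => hvT (h v hv))

/-- Only induced subgraphs are needed, and `raise` is vacuous since all list sizes are already k -
1. -/
theorem crit_of_isDPCritical (hs : M.IsSimple) {k : ℕ} (hk : 2 ≤ k) (hM : M.IsDPCritical k) :
    Crit M.support (k - 1) univ fun _ => k - 1 := by
  classical
  refine ⟨fun _ _ => le_rfl, fun hcol => ?_, fun T hT => ?_, fun _ _ h => absurd h (lt_irrefl _)⟩
  · have h1 : M.dpChromaticNumber ≤ k - 1 :=
      Nat.sInf_le ⟨by omega, dpColorable_of_col hs hcol⟩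
    have := hM.1
    omega
  · have hproper : (induced M T).IsProper := by
      rintro ⟨h, -⟩
      refine hT.ne (coe_injective ?_)
      rw [coe_univ]
      exact h
    have hsimp : (induced M T).coe.IsSimple := fun e => ((induced M T).mult_le _).trans (hs _)
    have : Fintype (induced M T).verts := Fintype.ofFinite _
    have hcol := col_of_dpColorable
      (dpColorable_of_chromaticNumber_le hsimp (hM.2 _ hproper))
    intro K hK
    obtain ⟨f, hf⟩ := hcol ⟨fun v => K.L v, fun u a v b => K.R u a v b, K.symm, K.inj⟩
      fun v _ => hK v v.2
    refine ⟨fun v => if hv : v ∈ (induced M T).verts then f ⟨v, hv⟩ else 0, fun v hv => ?_, fun u hu v hv huv => ?_⟩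
    · have hv' : v ∈ (induced M T).verts := hv
      simp only [dif_pos hv']
      exact hf.1 ⟨v, hv⟩ (mem_univ _)
    · have hu' : u ∈ (induced M T).verts := hu
      have hv' : v ∈ (induced M T).verts := hv
      simp only [dif_pos hu', dif_pos hv']
      refine hf.2 ⟨u, hu⟩ (mem_univ _) ⟨v, hv⟩ (mem_univ _) ?_
      change (if ∀ t ∈ s(u, v), t ∈ T then M.mult s(u, v) else 0) ≠ 0
      rw [if_pos]
      · exact huv
      · intro t ht
        rcases Sym2.mem_iff.1 ht with rfl | rfl <;> assumption

theorem sum_dg_univ (hs : M.IsSimple) : ∑ v, dg M.support univ v = 2 * M.edgeCount := by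
  classical
  have h1 : M.edgeCount = M.support.edgeFinset.card := by
    rw [Multigraph.edgeCount, ← sum_subset (subset_univ M.support.edgeFinset), card_eq_sum_ones]
    · refine sum_congr rfl fun e he => ?_
      rw [SimpleGraph.mem_edgeFinset] at he
      induction e with
      | _ a b =>
        have h1 : M.mult s(a, b) ≠ 0 := he
        have := hs s(a, b)
        omega
    · intro e _ he
      rw [SimpleGraph.mem_edgeFinset] at he
      induction e with
      | _ a b => exact not_not.1 he
  rw [h1, ← SimpleGraph.sum_degrees_eq_twice_card_edges]
  refine sum_congr rfl fun v _ => ?_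
  rw [dg, ← SimpleGraph.card_neighborFinset_eq_degree, SimpleGraph.neighborFinset_eq_filter]

theorem isCompleteMultiple_of_isClique (hs : M.IsSimple) {k : ℕ} (hcard : Fintype.card W = k)
    (hcl : M.support.IsClique ((univ : Finset W) : Set W)) : M.IsCompleteMultiple k 1 := by
  classical
  refine ⟨Fintype.equivFinOfCardEq hcard, fun u v => ?_⟩
  simp only [Multigraph.multiple, SimpleGraph.mem_edgeSet, SimpleGraph.top_adj, ne_eq,
    EmbeddingLike.apply_eq_iff_eq]
  by_cases huv : u = v
  · subst huv
    rw [if_neg (by simp), M.loopless _ (by simp)]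
  · rw [if_pos huv]
    have h1 : M.mult s(u, v) ≠ 0 := hcl (mem_univ u) (mem_univ v) huv
    have := hs s(u, v)
    omega

/-- The parameters for a given number `k` of colors. -/
noncomputable def Par.ofNat (k : ℕ) (hk : 5 ≤ k) (lam : ℤ)
    (hlam : lam = ⌈((k : ℝ) ^ 2 - 7) / (2 * (k : ℝ) - 7)⌉) : Par where
  k := k
  lam := lam
  mu := ((k : ℝ) - 1) / (k - 3)
  five_le := hk
  six_le := by
    have hk' : (5 : ℝ) ≤ k := by exact_mod_cast hk
    -- The quotient exceeds 5 because k^2 - 7 - 5(2k - 7) = (k - 5)^2 + 3.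
    have h5 : (5 : ℤ) < lam := by
      rw [hlam, Int.lt_ceil, lt_div_iff₀ (by linarith)]
      push_cast
      nlinarith [sq_nonneg ((k : ℝ) - 5)]
    exact_mod_cast (by omega : (6 : ℤ) ≤ lam)
  le_lam := by
    have hk' : (5 : ℝ) ≤ k := by exact_mod_cast hk
    rw [← div_le_iff₀ (by linarith), hlam]
    exact Int.le_ceil _
  mu_mul := div_mul_cancel₀ _ (by
    have hk' : (5 : ℝ) ≤ k := by exact_mod_cast hk
    linarith)
  lam_five h := by
    subst h
    rw [hlam]
    norm_num
  int := ⟨lam, rfl⟩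

end DPCover

theorem theorem1p9 (k : ℕ) (hk : 5 ≤ k)
    (lam : ℤ) (hlam : lam = ⌈((k : ℝ) ^ 2 - 7) / (2 * (k : ℝ) - 7)⌉)
    {V : Type*} [Fintype V] [DecidableEq V] (n : ℕ) (hn : Fintype.card V = n)
    (G : Multigraph V) (hsimple : G.IsSimple) (hG : G.IsDPCritical k) :
    G.IsCompleteMultiple k 1 ∨
      (k = 5 ∧ (G.IsCompleteMultiple 2 4 ∨ G.IsDoubleCycle)) ∨
      ((k : ℝ) - 1 + 1 / (lam : ℝ)) * ((n : ℝ) / 2) + 1 / (lam : ℝ) ≤ (G.edgeCount : ℝ) := by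
  set p := DPCover.Par.ofNat k hk lam hlam with hp
  have hc : DPCover.Crit G.support (p.k - 1) Finset.univ fun _ => k - 1 :=
    DPCover.crit_of_isDPCritical (k := k) hsimple (by omega) hG
  rcases DPCover.good_of_crit p _ G.support Finset.univ (fun _ => k - 1) rfl hc with
    ⟨h1, h2, -⟩ | ⟨-, h⟩ | ⟨⟨v, -, hv⟩, -⟩
  · exact Or.inl (DPCover.isCompleteMultiple_of_isClique hsimple h2 h1)
  · right
    right
    have hsum : ∑ v, (DPCover.dg G.support Finset.univ v : ℝ) = 2 * G.edgeCount := by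
      exact_mod_cast DPCover.sum_dg_univ hsimple
    have hpot : p.pot G.support Finset.univ (fun _ => k - 1) =
        n - lam * (2 * G.edgeCount - n * (k - 1)) := by
      have : ∀ v, p.wt G.support Finset.univ (fun _ => k - 1) v =
          1 - lam * (DPCover.dg G.support Finset.univ v - (k - 1)) := by
        intro v
        change 1 - (lam : ℝ) * (_ - ((k - 1 : ℕ) : ℝ)) - _ * ((k : ℝ) - 1 - ((k - 1 : ℕ) : ℝ)) = _
        rw [Nat.cast_sub (by omega)]
        push_cast
        ring
      rw [DPCover.Par.pot, Finset.sum_congr rfl fun v _ => this v, Finset.sum_sub_distrib,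
        ← Finset.mul_sum, Finset.sum_sub_distrib, hsum, Finset.sum_const, Finset.sum_const,
        Finset.card_univ, hn]
      simp only [nsmul_eq_mul]
      ring
    -- Dividing `pot ≤ -2` by 2λ gives the bound on the number of edges.
    rw [hpot] at h
    have hl : (0 : ℝ) < lam := by
      have h6 : (6 : ℝ) ≤ lam := p.six_le
      linarith
    have e : (((k : ℝ) - 1 + 1 / (lam : ℝ)) * ((n : ℝ) / 2) + 1 / (lam : ℝ)) * lam =
        (lam * (k - 1) + 1) * (n / 2) + 1 := by
      field_simp
    refine le_of_mul_le_mul_right ?_ hl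
    rw [e]
    linarith
  · exact absurd hv (lt_irrefl _)
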